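/- Let $a<1$, $\lambda(z)=z^a$ and $\sigma=\frac{1-a}{2-a}\in(0,1)$. Let $\Omega$ be either the torus $\mathbb T^2=(\mathbb R/2\pi\mathbb Z)^2$ or a bounded convex domain in $\mathbb R^2$. Let $V$ be the space of mean-zero functions of $H^1(\mathbb T^2)$ in the first case and $V=H^1_0(\Omega)$ in the second, and let $C_p$ be the optimal constant in the Poincaré inequality $\|w\|_{L^2(\Omega)}\le C_p\|\overline\nabla w\|_{L^2(\Omega)}$, $w\in V$. Let $(e_i)$ be an orthonormal basis of $L^2(\Omega)$ (of its mean-zero subspace if $\Omega=\mathbb T^2$) consisting of eigenfunctions $e_i\in V$ of the Laplacian, $-\overline\Delta e_i=k_ie_i$ (then $k_i>0$). For $s\in(-1,1)$ let $\dot H^s(\Omega)$ be the space of series $\theta=\sum_i\theta_ie_i$ with $\|\theta\|_{\dot H^s(\Omega)}^2=\sum_ik_i^s\theta_i^2<\infty$; the duality pairing of $\theta\in\dot H^{-s}(\Omega)$ and $\eta\in\dot H^{s}(\Omega)$ is $\int_\Omega\theta\,\eta\,dx:=\sum_i\theta_i\eta_i$. On $\mathbb R_+\times\Omega$, with variables $(z,x)$,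 put, in the sense of distributions, $\nabla_{\sqrt\lambda}u=(\sqrt\lambda\,\partial_zu,\overline\nabla u)$ and $\Delta_\lambda u=\partial_z(\lambda\,\partial_zu)+\overline\Delta u$, where $\overline\nabla,\overline\Delta$ act in $x$. Let $\mathcal H$ be the space of $u\in L^2(\mathbb R_+\times\Omega)$ with $\nabla_{\sqrt\lambda}u\in L^2(\mathbb R_+\times\Omega)$ and $u(z,\cdot)\in V$ for a.e. $z>0$, with norm $\|u\|_{\mathcal H}=\|u\|_{L^2}+\|\nabla_{\sqrt\lambda}u\|_{L^2}$, and let $\mathcal H^2=\{v\in\mathcal H:\Delta_\lambda v\in L^2(\mathbb R_+\times\Omega)\}$ with norm $\|v\|_{\mathcal H^2}=\|v\|_{\mathcal H}+\|\Delta_\lambda v\|_{L^2}$. There are constants $C_0,C_1>0$ depending only on $a$, with $C_0=1$ if $a\le0$ and $C_1=1$ if $a\ge0$, such that for every such $\Omega$ the following holds. 1. There is a linear operator $\gamma_0:\mathcal H\to\dot H^{\sigma}(\Omega)$ such that, for every $u\in\mathcal H$, $\gamma_0u\in L^2(\Omega)$ and $u(z,\cdot)\to\gamma_0u$ in $L^2(\Omega)$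 as $z\to0^+$ (through a.e. $z$). In particular $\gamma_0u(x)=u(0,x)$ for a.e. $x\in\Omega$ if $u$ is continuous up to $z=0$. It is bounded: $$\|\gamma_0u\|_{\dot H^{\sigma}(\Omega)}\le C_0\,\|\nabla_{\sqrt\lambda}u\|_{L^2(\mathbb R_+\times\Omega)}\qquad(u\in\mathcal H).$$ 2. There is a linear operator $\gamma_\lambda:\mathcal H^2\to\dot H^{-\sigma}(\Omega)$ such that, for every $v\in\mathcal H^2$, $\gamma_\lambda v=-\lim_{z\to0^+}\lambda\,\partial_zv(z,\cdot)$, the limit (through a.e. $z$) being taken weakly against every $\varphi\in V$. In particular $\gamma_\lambda v=-(\lambda\,\partial_zv)(0,\cdot)$, as a functional on $C_c^\infty(\Omega)$ (on smooth mean-zero functions if $\Omega=\mathbb T^2$), if $\lambda\,\partial_zv$ is continuous up to $z=0$. It is bounded: $$\|\gamma_\lambda v\|_{\dot H^{-\sigma}(\Omega)}\le C_1\left(\|\nabla_{\sqrt\lambda}v\|_{L^2(\mathbb R_+\times\Omega)}+C_p\,\|\Delta_\lambda v\|_{L^2(\mathbb R_+\times\Omega)}\right)\qquad(v\in\mathcal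 H^2).$$ 3. For all $u\in\mathcal H$ and $v\in\mathcal H^2$, $$\int_{\mathbb R_+\times\Omega}\nabla_{\sqrt\lambda}u\cdot\nabla_{\sqrt\lambda}v\,dx\,dz=\int_{\mathbb R_+\times\Omega}u\,(-\Delta_\lambda v)\,dx\,dz+\int_\Omega\gamma_\lambda v\,\gamma_0u\,dx,$$ where the last integral is the duality pairing of $\dot H^{-\sigma}(\Omega)$ and $\dot H^{\sigma}(\Omega)$. -/

import Mathlib

open MeasureTheory Set Filter Topology
open scoped ContDiff ENNReal

namespace QGTrace

noncomputable section

/-- The horizontal plane, with coordinates `x = (x₁, x₂)`. -/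
abbrev Plane : Type := EuclideanSpace ℝ (Fin 2)

/-- The admissible horizontal domains `Ω`: the torus `𝕋² = (ℝ / 2πℤ)²`, or a (nonempty, open)
bounded convex domain of the plane. -/
inductive HorizontalDomain : Type
  | torus : HorizontalDomain
  | bounded (Ω : Set Plane) (isOpen : IsOpen Ω) (convex : Convex ℝ Ω)
      (isBounded : Bornology.IsBounded Ω) (nonempty : Ω.Nonempty) : HorizontalDomain

namespace HorizontalDomain

/-- The set of points of `Ω`; the torus is represented by its closed fundamental cell `[0, 2π]²`. -/
def carrier : HorizontalDomain → Set Plane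
  | torus => {x | ∀ j, x j ∈ Icc (0 : ℝ) (2 * Real.pi)}
  | bounded Ω _ _ _ _ => Ω

/-- Lebesgue measure on `Ω`. -/
def meas (D : HorizontalDomain) : Measure Plane := volume.restrict D.carrier

/-- Lebesgue measure `dz dx` on `ℝ₊ × Ω`. -/
def bulk (D : HorizontalDomain) : Measure (ℝ × Plane) :=
  (volume.restrict (Ioi (0 : ℝ))).prod D.meas

/-- `L²(Ω)`. -/
abbrev L2 (D : HorizontalDomain) : Type := Lp ℝ 2 D.meas

/-- `L²(ℝ₊ × Ω)`. -/
abbrev L2Bulk (D : HorizontalDomain) : Type := Lp ℝ 2 D.bulk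

/-- What a function that is smooth in the whole plane (or in `ℝ × Plane`, for fixed `z`) has to
satisfy to be a test function on `Ω`: periodicity for the torus, compact support in `Ω` for a
bounded domain. The parameter `ι` is the range of the variable `z`
(a one-point type when there is none). -/
def IsLocalised (D : HorizontalDomain) {ι : Type} (φ : ι → Plane → ℝ) : Prop :=
  match D with
  | torus => ∀ z x j, φ z (x + EuclideanSpace.single j (2 * Real.pi)) = φ z x
  | bounded Ω _ _ _ _ => ∃ K : Set Plane, IsCompact K ∧ K ⊆ Ω ∧ ∀ z, ∀ x ∉ K, φ z x = 0

/-- Zero mean over the cell in the case of the torus, no condition for a bounded domain. -/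
def MeanFree (D : HorizontalDomain) (v : Plane → ℝ) : Prop :=
  match D with
  | torus => ∫ x, v x ∂(torus.meas) = 0
  | bounded _ _ _ _ _ => True

end HorizontalDomain

open HorizontalDomain

variable (D : HorizontalDomain)

/-- Horizontal partial derivative `∂_{x_j} φ` of a function of `x`. -/
def dx (j : Fin 2) (φ : Plane → ℝ) (x : Plane) : ℝ :=
  fderiv ℝ φ x (EuclideanSpace.single j 1)

/-- Vertical derivative `∂_z φ` of a function of `(z, x)`. -/
def bdz (φ : ℝ × Plane → ℝ) (p : ℝ × Plane) : ℝ :=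
  fderiv ℝ φ p ((1 : ℝ), (0 : Plane))

/-- Horizontal partial derivative `∂_{x_j} φ` of a function of `(z, x)`. -/
def bdx (j : Fin 2) (φ : ℝ × Plane → ℝ) (p : ℝ × Plane) : ℝ :=
  fderiv ℝ φ p ((0 : ℝ), EuclideanSpace.single j 1)

/-- Test functions in `ℝ₊ × Ω`: smooth, vanishing for `z` outside a compact subset of `(0, ∞)`,
and periodic in `x` (torus) or compactly supported in `Ω` (bounded domain). -/
def IsBulkTest (φ : ℝ × Plane → ℝ) : Prop :=
  ContDiff ℝ ∞ φ ∧
    (∃ K : Set ℝ, IsCompact K ∧ K ⊆ Ioi 0 ∧ ∀ z ∉ K, ∀ x, φ (z, x) = 0) ∧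
    D.IsLocalised (fun z x => φ (z, x))

/-- Smooth functions on `Ω` satisfying the lateral condition (A): smooth periodic functions of
zero mean (torus), `C_c^∞(Ω)` (bounded domain). -/
def IsLateralTest (φ : Plane → ℝ) : Prop :=
  ContDiff ℝ ∞ φ ∧ D.IsLocalised (fun _ : Unit => φ) ∧ D.MeanFree φ

/-- `v` lies in the closure `V` in `H¹(Ω)` of the smooth functions satisfying (A), and `g` is its
gradient. For a bounded domain `V = H¹₀(Ω)` (zero trace on `∂Ω`); for the torus `V` is the space
of periodic `H¹` functions of zero mean. -/
def HasLateralGrad (v : Plane → ℝ) (g : Fin 2 → Plane → ℝ) : Prop :=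
  MemLp v 2 D.meas ∧ (∀ j, MemLp (g j) 2 D.meas) ∧
    ∃ φ : ℕ → Plane → ℝ, (∀ n, IsLateralTest D (φ n)) ∧
      Tendsto (fun n => eLpNorm (φ n - v) 2 D.meas) atTop (𝓝 0) ∧
      ∀ j, Tendsto (fun n => eLpNorm (dx j (φ n) - g j) 2 D.meas) atTop (𝓝 0)

/-- Membership in `V`. -/
def MemV (v : Plane → ℝ) : Prop := ∃ g, HasLateralGrad D v g

/-- The optimal constant `C_p` of the Poincaré inequality
`‖v‖_{L²(Ω)} ≤ C_p ‖∇v‖_{L²(Ω)}`, `v ∈ V`. -/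
def poincareConst : ℝ :=
  sInf {C : ℝ | 0 ≤ C ∧ ∀ v g, HasLateralGrad D v g →
    ∫ x, v x ^ 2 ∂D.meas ≤ C ^ 2 * ∫ x, ∑ j, g j x ^ 2 ∂D.meas}

/-- `(e_i)` is an orthonormal basis of `L²(Ω)` (of its mean-zero subspace, for the torus)
made of eigenfunctions of `-Δ̄_Ω` with condition (A), `-Δ̄ e_i = k_i e_i`. -/
structure IsEigenbasis (e : ℕ → D.L2) (k : ℕ → ℝ) : Prop where
  orthonormal : Orthonormal ℝ e
  meanFree : ∀ i, D.MeanFree (e i)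
  complete : ∀ f : D.L2, D.MeanFree f → (∀ i, inner ℝ (e i) f = 0) → f = 0
  eigen : ∀ i, ∃ g, HasLateralGrad D (e i) g ∧ ∀ φ, IsLateralTest D φ →
    ∫ x, ∑ j, g j x * dx j φ x ∂D.meas = k i * ∫ x, e i x * φ x ∂D.meas

/-- `G = (√λ ∂_z u, ∂_{x₁} u, ∂_{x₂} u)` in the sense of distributions in `ℝ₊ × Ω`, where
`λ(z) = z ^ a`; that is, `∂_z u = z ^ (-a/2) G_z` and `∂_{x_j} u = G_j`. -/
def IsWeightedGrad (a : ℝ) (u : D.L2Bulk) (Gz : D.L2Bulk) (Gx : Fin 2 → D.L2Bulk) : Prop :=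
  ∀ φ, IsBulkTest D φ →
    (∫ p, u p * bdz φ p ∂D.bulk = - ∫ p, Gz p * (p.1 ^ (-a / 2) * φ p) ∂D.bulk) ∧
    ∀ j, ∫ p, u p * bdx j φ p ∂D.bulk = - ∫ p, Gx j p * φ p ∂D.bulk

/-- The lateral condition (A) for functions of `(z, x)`: `u(z, ·) ∈ V` for almost every `z > 0`. -/
def LateralCondition (u : D.L2Bulk) : Prop :=
  ∀ᵐ z ∂(volume.restrict (Ioi (0 : ℝ))), MemV D (fun x => u (z, x))

/-- `f = div (λ ∂_z u, ∂_{x₁} u, ∂_{x₂} u)` in the sense of distributions in `ℝ₊ × Ω`, where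
`(Gz, Gx)` is the weighted gradient of `u` (so that `λ ∂_z u = z ^ (a/2) Gz`). -/
def IsWeightedLaplacian (a : ℝ) (Gz : D.L2Bulk) (Gx : Fin 2 → D.L2Bulk) (f : D.L2Bulk) : Prop :=
  ∀ φ, IsBulkTest D φ →
    (∫ p, Gz p * (p.1 ^ (a / 2) * bdz φ p) ∂D.bulk) + ∑ j, ∫ p, Gx j p * bdx j φ p ∂D.bulk
      = - ∫ p, f p * φ p ∂D.bulk

/-! ### Auxiliary facts, needed to see that the spaces below are linear -/

theorem carrier_isBounded : Bornology.IsBounded D.carrier := by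
  cases D with
  | torus =>
    have h : IsCompact (WithLp.toLp 2 '' (Set.pi univ fun _ : Fin 2 => Icc (0 : ℝ) (2 * Real.pi))) :=
      (isCompact_univ_pi fun _ => isCompact_Icc).image (PiLp.continuous_toLp 2 _)
    refine h.isBounded.subset ?_
    intro x hx
    exact ⟨WithLp.ofLp x, fun j _ => hx j, rfl⟩
  | bounded Ω _ _ h _ => exact h

instance : IsFiniteMeasure D.meas :=
  ⟨by simpa [meas] using (carrier_isBounded D).measure_lt_top⟩

instance : SFinite D.bulk := by unfold bulk; infer_instance

/-- A function that is continuous in `z > 0` and vanishes for `z` outside a compact subset of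
`(0, ∞)` is square integrable on `ℝ₊ × Ω`. -/
theorem memLp_of_support {ψ : ℝ × Plane → ℝ} (hm : Measurable ψ)
    (hc : ContinuousOn ψ (Ioi 0 ×ˢ univ))
    {K : Set ℝ} (hK : IsCompact K) (hK0 : K ⊆ Ioi 0) (h0 : ∀ z ∉ K, ∀ x, ψ (z, x) = 0) :
    MemLp ψ 2 D.bulk := by
  have hcomp : IsCompact (K ×ˢ closure D.carrier) :=
    hK.prod (carrier_isBounded D).isCompact_closure
  obtain ⟨M, hM⟩ := hcomp.exists_bound_of_continuousOn
    (hc.mono (prod_mono hK0 (subset_univ _)))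
  have hcar : ∀ᵐ x ∂D.meas, x ∈ closure D.carrier :=
    (ae_restrict_of_ae_restrict_of_subset subset_closure
      (ae_restrict_mem isClosed_closure.measurableSet))
  have hcar2 : ∀ᵐ p ∂D.bulk, p.2 ∈ closure D.carrier := by
    unfold bulk
    exact Measure.quasiMeasurePreserving_snd.ae hcar
  have hind : MemLp ((K ×ˢ (univ : Set Plane)).indicator fun _ => M) 2 D.bulk := by
    refine memLp_indicator_const 2 (hK.measurableSet.prod MeasurableSet.univ) M (Or.inr ?_)
    unfold bulk
    rw [Measure.prod_prod]
    refine ENNReal.mul_ne_top ?_ (measure_ne_top _ _)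
    exact ((Measure.restrict_apply_le _ _).trans_lt hK.measure_lt_top).ne
  refine hind.mono hm.aestronglyMeasurable ?_
  filter_upwards [hcar2] with p hp
  by_cases hz : p.1 ∈ K
  · rw [indicator_of_mem (by exact ⟨hz, trivial⟩)]
    exact (hM p ⟨hz, hp⟩).trans (le_abs_self M)
  · have : ψ p = 0 := h0 p.1 hz p.2
    simp [this]

theorem IsBulkTest.fderiv_eq_zero {φ : ℝ × Plane → ℝ} {K : Set ℝ} (hK : IsCompact K)
    (h0 : ∀ z ∉ K, ∀ x, φ (z, x) = 0) {z : ℝ} (hz : z ∉ K) (x : Plane) :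
    fderiv ℝ φ (z, x) = 0 := by
  have : φ =ᶠ[𝓝 (z, x)] fun _ => (0 : ℝ) := by
    have ho : IsOpen ((Kᶜ : Set ℝ) ×ˢ (univ : Set Plane)) :=
      hK.isClosed.isOpen_compl.prod isOpen_univ
    filter_upwards [ho.mem_nhds (by exact ⟨hz, trivial⟩)] with p hp
    exact h0 p.1 hp.1 p.2
  rw [this.fderiv_eq]
  simp

theorem continuousOn_weight (b : ℝ) :
    ContinuousOn (fun p : ℝ × Plane => p.1 ^ b) (Ioi 0 ×ˢ univ) := fun p hp =>
  ((Real.continuousAt_rpow_const p.1 b (Or.inl (ne_of_gt hp.1))).comp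
    continuousAt_fst).continuousWithinAt

theorem measurable_weight (b : ℝ) : Measurable (fun p : ℝ × Plane => p.1 ^ b) :=
  measurable_fst.pow_const b

variable {D}

theorem IsBulkTest.memLp {φ : ℝ × Plane → ℝ} (h : IsBulkTest D φ) (b : ℝ) :
    MemLp (fun p => p.1 ^ b * φ p) 2 D.bulk := by
  obtain ⟨hs, ⟨K, hK, hK0, h0⟩, -⟩ := h
  exact memLp_of_support D ((measurable_weight b).mul hs.continuous.measurable)
    ((continuousOn_weight b).mul hs.continuous.continuousOn) hK hK0
    (fun z hz x => by simp [h0 z hz x])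

theorem IsBulkTest.memLp_fderiv {φ : ℝ × Plane → ℝ} (h : IsBulkTest D φ) (b : ℝ) (w : ℝ × Plane) :
    MemLp (fun p => p.1 ^ b * fderiv ℝ φ p w) 2 D.bulk := by
  obtain ⟨hs, ⟨K, hK, hK0, h0⟩, -⟩ := h
  have hc : Continuous fun p => fderiv ℝ φ p w :=
    (hs.continuous_fderiv (by simp)).clm_apply continuous_const
  exact memLp_of_support D ((measurable_weight b).mul hc.measurable)
    ((continuousOn_weight b).mul hc.continuousOn) hK hK0
    (fun z hz x => by simp [IsBulkTest.fderiv_eq_zero hK h0 hz x])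

theorem integral_add_mul {ψ : ℝ × Plane → ℝ} (hψ : MemLp ψ 2 D.bulk) (u v : D.L2Bulk) :
    ∫ p, (u + v) p * ψ p ∂D.bulk = (∫ p, u p * ψ p ∂D.bulk) + ∫ p, v p * ψ p ∂D.bulk := by
  have hu : Integrable (fun p => u p * ψ p) D.bulk := (Lp.memLp u).integrable_mul hψ
  have hv : Integrable (fun p => v p * ψ p) D.bulk := (Lp.memLp v).integrable_mul hψ
  rw [← integral_add hu hv]
  refine integral_congr_ae ?_
  filter_upwards [Lp.coeFn_add u v] with p hp
  rw [hp, Pi.add_apply, add_mul]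

theorem integral_smul_mul {ψ : ℝ × Plane → ℝ} (c : ℝ) (u : D.L2Bulk) :
    ∫ p, (c • u) p * ψ p ∂D.bulk = c * ∫ p, u p * ψ p ∂D.bulk := by
  rw [← integral_const_mul]
  refine integral_congr_ae ?_
  filter_upwards [Lp.coeFn_smul c u] with p hp
  rw [hp, Pi.smul_apply, smul_eq_mul, mul_assoc]

theorem integral_zero_mul {ψ : ℝ × Plane → ℝ} :
    ∫ p, (0 : D.L2Bulk) p * ψ p ∂D.bulk = 0 := by
  simpa using integral_smul_mul (D := D) (ψ := ψ) 0 0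

theorem IsBulkTest.memLp_bdz {φ : ℝ × Plane → ℝ} (h : IsBulkTest D φ) :
    MemLp (bdz φ) 2 D.bulk := by
  have := h.memLp_fderiv 0 ((1 : ℝ), (0 : Plane))
  simp only [Real.rpow_zero, one_mul] at this
  exact this

theorem IsBulkTest.memLp_bdx {φ : ℝ × Plane → ℝ} (h : IsBulkTest D φ) (j : Fin 2) :
    MemLp (bdx j φ) 2 D.bulk := by
  have := h.memLp_fderiv 0 ((0 : ℝ), EuclideanSpace.single j 1)
  simp only [Real.rpow_zero, one_mul] at this
  exact this

theorem IsBulkTest.memLp_self {φ : ℝ × Plane → ℝ} (h : IsBulkTest D φ) :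
    MemLp φ 2 D.bulk := by
  simpa using h.memLp 0

theorem IsWeightedGrad.add {a : ℝ} {u v Gz Hz : D.L2Bulk} {Gx Hx : Fin 2 → D.L2Bulk}
    (h : IsWeightedGrad D a u Gz Gx) (h' : IsWeightedGrad D a v Hz Hx) :
    IsWeightedGrad D a (u + v) (Gz + Hz) (Gx + Hx) := by
  intro φ hφ
  refine ⟨?_, fun j => ?_⟩
  · rw [integral_add_mul hφ.memLp_bdz, integral_add_mul (hφ.memLp _), (h φ hφ).1, (h' φ hφ).1]
    ring
  · rw [integral_add_mul (hφ.memLp_bdx j), Pi.add_apply, integral_add_mul hφ.memLp_self,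
      (h φ hφ).2 j, (h' φ hφ).2 j]
    ring

theorem IsWeightedGrad.smul {a : ℝ} {u Gz : D.L2Bulk} {Gx : Fin 2 → D.L2Bulk} (c : ℝ)
    (h : IsWeightedGrad D a u Gz Gx) : IsWeightedGrad D a (c • u) (c • Gz) (c • Gx) := by
  intro φ hφ
  refine ⟨?_, fun j => ?_⟩
  · rw [integral_smul_mul, integral_smul_mul, (h φ hφ).1]
    ring
  · rw [integral_smul_mul, Pi.smul_apply, integral_smul_mul, (h φ hφ).2 j]
    ring

theorem IsWeightedGrad.zero {a : ℝ} : IsWeightedGrad D a 0 0 0 := by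
  intro φ _
  refine ⟨?_, fun j => ?_⟩
  · rw [integral_zero_mul, integral_zero_mul, neg_zero]
  · rw [integral_zero_mul, Pi.zero_apply, integral_zero_mul, neg_zero]

theorem IsWeightedLaplacian.add {a : ℝ} {f g Gz Hz : D.L2Bulk} {Gx Hx : Fin 2 → D.L2Bulk}
    (h : IsWeightedLaplacian D a Gz Gx f) (h' : IsWeightedLaplacian D a Hz Hx g) :
    IsWeightedLaplacian D a (Gz + Hz) (Gx + Hx) (f + g) := by
  intro φ hφ
  have e1 := h φ hφ
  have e2 := h' φ hφ
  rw [integral_add_mul (ψ := fun p => p.1 ^ (a / 2) * bdz φ p) (hφ.memLp_fderiv _ _),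
    integral_add_mul hφ.memLp_self]
  simp only [Pi.add_apply, integral_add_mul (hφ.memLp_bdx _), Finset.sum_add_distrib]
  linarith

theorem IsWeightedLaplacian.smul {a : ℝ} {f Gz : D.L2Bulk} {Gx : Fin 2 → D.L2Bulk} (c : ℝ)
    (h : IsWeightedLaplacian D a Gz Gx f) :
    IsWeightedLaplacian D a (c • Gz) (c • Gx) (c • f) := by
  intro φ hφ
  have e1 := h φ hφ
  simp only [Pi.smul_apply, integral_smul_mul, ← Finset.mul_sum]
  rw [← mul_add, e1]
  ring

theorem IsWeightedLaplacian.zero {a : ℝ} : IsWeightedLaplacian D a 0 0 0 := by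
  intro φ _
  simp only [Pi.zero_apply, integral_zero_mul]
  simp

theorem IsLateralTest.memLp {φ : Plane → ℝ} {ψ : Plane → ℝ} (_ : IsLateralTest D φ)
    (hψ : Continuous ψ) : MemLp ψ 2 D.meas := by
  obtain ⟨M, hM⟩ := (carrier_isBounded D).isCompact_closure.exists_bound_of_continuousOn
    hψ.continuousOn
  have hcar : ∀ᵐ x ∂D.meas, x ∈ closure D.carrier :=
    (ae_restrict_of_ae_restrict_of_subset subset_closure
      (ae_restrict_mem isClosed_closure.measurableSet))
  exact MemLp.of_bound hψ.aestronglyMeasurable M (hcar.mono fun x hx => hM x hx)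

theorem IsLateralTest.memLp_self {φ : Plane → ℝ} (h : IsLateralTest D φ) : MemLp φ 2 D.meas :=
  h.memLp h.1.continuous

theorem IsLateralTest.memLp_dx {φ : Plane → ℝ} (h : IsLateralTest D φ) (j : Fin 2) :
    MemLp (dx j φ) 2 D.meas :=
  h.memLp ((h.1.continuous_fderiv (by simp)).clm_apply continuous_const)

theorem IsLateralTest.add {φ ψ : Plane → ℝ} (h : IsLateralTest D φ) (h' : IsLateralTest D ψ) :
    IsLateralTest D (φ + ψ) := by
  have i1 : Integrable φ D.meas := h.memLp_self.integrable (by norm_num)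
  have i2 : Integrable ψ D.meas := h'.memLp_self.integrable (by norm_num)
  refine ⟨h.1.add h'.1, ?_, ?_⟩
  · cases D with
    | torus =>
      intro z x j
      have e1 := h.2.1 z x j
      have e2 := h'.2.1 z x j
      simp only [Pi.add_apply] at *
      rw [e1, e2]
    | bounded Ω _ _ _ _ =>
      obtain ⟨K, hK, hKΩ, h0⟩ := h.2.1
      obtain ⟨K', hK', hKΩ', h0'⟩ := h'.2.1
      refine ⟨K ∪ K', hK.union hK', union_subset hKΩ hKΩ', fun z x hx => ?_⟩
      have e1 := h0 z x fun hx' => hx (Or.inl hx')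
      have e2 := h0' z x fun hx' => hx (Or.inr hx')
      simp only [Pi.add_apply] at *
      rw [e1, e2, add_zero]
  · cases D with
    | torus =>
      have e1 : ∫ x, φ x ∂(torus.meas) = 0 := h.2.2
      have e2 : ∫ x, ψ x ∂(torus.meas) = 0 := h'.2.2
      change ∫ x, (φ + ψ) x ∂(torus.meas) = 0
      simp only [Pi.add_apply]
      rw [integral_add i1 i2, e1, e2, add_zero]
    | bounded Ω _ _ _ _ => trivial

theorem IsLateralTest.smul {φ : Plane → ℝ} (c : ℝ) (h : IsLateralTest D φ) :
    IsLateralTest D (c • φ) := by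
  refine ⟨contDiff_const.smul h.1, ?_, ?_⟩
  · cases D with
    | torus =>
      intro z x j
      have e1 := h.2.1 z x j
      simp only [Pi.smul_apply] at *
      rw [e1]
    | bounded Ω _ _ _ _ =>
      obtain ⟨K, hK, hKΩ, h0⟩ := h.2.1
      refine ⟨K, hK, hKΩ, fun z x hx => ?_⟩
      have e1 := h0 z x hx
      simp only [Pi.smul_apply] at *
      rw [e1, smul_zero]
  · cases D with
    | torus =>
      have e1 : ∫ x, φ x ∂(torus.meas) = 0 := h.2.2
      change ∫ x, (c • φ) x ∂(torus.meas) = 0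
      simp only [Pi.smul_apply]
      rw [integral_smul, e1, smul_zero]
    | bounded Ω _ _ _ _ => trivial

theorem isLateralTest_zero : IsLateralTest D 0 := by
  refine ⟨contDiff_const, ?_, ?_⟩
  · cases D with
    | torus => intro z x j; rfl
    | bounded Ω _ _ _ _ => exact ⟨∅, isCompact_empty, empty_subset _, fun _ _ _ => rfl⟩
  · cases D with
    | torus => exact integral_zero _ _
    | bounded Ω _ _ _ _ => trivial

theorem dx_add (j : Fin 2) {φ ψ : Plane → ℝ} (h : IsLateralTest D φ) (h' : IsLateralTest D ψ) :
    dx j (φ + ψ) = dx j φ + dx j ψ := by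
  ext x
  simp only [dx, Pi.add_apply]
  rw [fderiv_add (h.1.differentiable (by simp) x) (h'.1.differentiable (by simp) x)]
  simp

theorem dx_smul (j : Fin 2) (c : ℝ) {φ : Plane → ℝ} (h : IsLateralTest D φ) :
    dx j (c • φ) = c • dx j φ := by
  ext x
  simp only [dx, Pi.smul_apply]
  rw [fderiv_const_smul (h.1.differentiable (by simp) x)]
  simp

theorem tendsto_eLpNorm_add {μ : Measure Plane} {F F' : ℕ → Plane → ℝ} {v v' : Plane → ℝ}
    (hF : ∀ n, MemLp (F n) 2 μ) (hF' : ∀ n, MemLp (F' n) 2 μ) (hv : MemLp v 2 μ)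
    (hv' : MemLp v' 2 μ) (h : Tendsto (fun n => eLpNorm (F n - v) 2 μ) atTop (𝓝 0))
    (h' : Tendsto (fun n => eLpNorm (F' n - v') 2 μ) atTop (𝓝 0)) :
    Tendsto (fun n => eLpNorm (F n + F' n - (v + v')) 2 μ) atTop (𝓝 0) := by
  have hs := h.add h'
  rw [add_zero] at hs
  refine tendsto_of_tendsto_of_tendsto_of_le_of_le tendsto_const_nhds hs (fun _ => zero_le) ?_
  intro n
  have : F n + F' n - (v + v') = (F n - v) + (F' n - v') := by abel
  simp only [this]
  exact eLpNorm_add_le ((hF n).sub hv).aestronglyMeasurable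
    ((hF' n).sub hv').aestronglyMeasurable (by norm_num)

theorem tendsto_eLpNorm_smul {μ : Measure Plane} (c : ℝ) {F : ℕ → Plane → ℝ} {v : Plane → ℝ}
    (h : Tendsto (fun n => eLpNorm (F n - v) 2 μ) atTop (𝓝 0)) :
    Tendsto (fun n => eLpNorm (c • F n - c • v) 2 μ) atTop (𝓝 0) := by
  have hs := ENNReal.Tendsto.const_mul (a := ‖c‖ₑ) h (Or.inr (by simp))
  rw [mul_zero] at hs
  refine hs.congr fun n => ?_
  rw [← smul_sub, eLpNorm_const_smul]

theorem HasLateralGrad.add {v v' : Plane → ℝ} {g g' : Fin 2 → Plane → ℝ}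
    (h : HasLateralGrad D v g) (h' : HasLateralGrad D v' g') :
    HasLateralGrad D (v + v') (g + g') := by
  obtain ⟨hv, hg, φ, hφ, h1, h2⟩ := h
  obtain ⟨hv', hg', φ', hφ', h1', h2'⟩ := h'
  refine ⟨hv.add hv', fun j => (hg j).add (hg' j), fun n => φ n + φ' n,
    fun n => (hφ n).add (hφ' n), ?_, fun j => ?_⟩
  · exact tendsto_eLpNorm_add (fun n => (hφ n).memLp_self) (fun n => (hφ' n).memLp_self)
      hv hv' h1 h1'
  · have := tendsto_eLpNorm_add (fun n => (hφ n).memLp_dx j) (fun n => (hφ' n).memLp_dx j)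
      (hg j) (hg' j) (h2 j) (h2' j)
    refine this.congr fun n => ?_
    rw [dx_add j (hφ n) (hφ' n)]
    rfl

theorem HasLateralGrad.smul (c : ℝ) {v : Plane → ℝ} {g : Fin 2 → Plane → ℝ}
    (h : HasLateralGrad D v g) : HasLateralGrad D (c • v) (c • g) := by
  obtain ⟨hv, hg, φ, hφ, h1, h2⟩ := h
  refine ⟨hv.const_smul c, fun j => (hg j).const_smul c, fun n => c • φ n,
    fun n => (hφ n).smul c, tendsto_eLpNorm_smul c h1, fun j => ?_⟩
  refine (tendsto_eLpNorm_smul c (h2 j)).congr fun n => ?_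
  rw [dx_smul j c (hφ n)]
  rfl

theorem hasLateralGrad_zero : HasLateralGrad D 0 0 := by
  refine ⟨MemLp.zero, fun _ => MemLp.zero, fun _ => 0, fun _ => isLateralTest_zero, ?_, ?_⟩
  · simp
  · intro j
    have : dx j (0 : Plane → ℝ) = 0 := by
      ext x
      simp [dx]
    simp [this]

theorem HasLateralGrad.congr {v v' : Plane → ℝ} {g : Fin 2 → Plane → ℝ}
    (h : HasLateralGrad D v g) (hvv : v =ᵐ[D.meas] v') : HasLateralGrad D v' g := by
  obtain ⟨hv, hg, φ, hφ, h1, h2⟩ := h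
  refine ⟨hv.ae_eq hvv, hg, φ, hφ, h1.congr fun n => ?_, h2⟩
  exact eLpNorm_congr_ae (EventuallyEq.rfl.sub hvv)

theorem ae_slice {P : ℝ × Plane → Prop} (h : ∀ᵐ p ∂D.bulk, P p) :
    ∀ᵐ z ∂(volume.restrict (Ioi (0 : ℝ))), ∀ᵐ x ∂D.meas, P (z, x) :=
  Measure.ae_ae_of_ae_prod h

theorem LateralCondition.add {u v : D.L2Bulk} (hu : LateralCondition D u)
    (hv : LateralCondition D v) : LateralCondition D (u + v) := by
  filter_upwards [hu, hv, ae_slice (Lp.coeFn_add u v)] with z ⟨g, hg⟩ ⟨g', hg'⟩ hz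
  refine ⟨_, (hg.add hg').congr ?_⟩
  filter_upwards [hz] with x hx
  exact hx.symm

theorem LateralCondition.smul {u : D.L2Bulk} (c : ℝ) (hu : LateralCondition D u) :
    LateralCondition D (c • u) := by
  filter_upwards [hu, ae_slice (Lp.coeFn_smul c u)] with z ⟨g, hg⟩ hz
  refine ⟨_, (hg.smul c).congr ?_⟩
  filter_upwards [hz] with x hx
  exact hx.symm

theorem LateralCondition.zero : LateralCondition D 0 := by
  filter_upwards [ae_slice (Lp.coeFn_zero ℝ 2 D.bulk)] with z hz
  refine ⟨_, hasLateralGrad_zero.congr ?_⟩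
  filter_upwards [hz] with x hx
  exact hx.symm

variable (D)

/-! ### The function spaces -/

/-- The space `𝓗` of all `u ∈ L²(ℝ₊ × Ω)` with `∇_{√λ} u ∈ L²(ℝ₊ × Ω)` and condition (A).
An element is recorded as the triple `(u, √λ ∂_z u, ∇̄ u)`. -/
def spaceH (a : ℝ) : Submodule ℝ (D.L2Bulk × D.L2Bulk × (Fin 2 → D.L2Bulk)) where
  carrier := {U | IsWeightedGrad D a U.1 U.2.1 U.2.2 ∧ LateralCondition D U.1}
  add_mem' h h' := ⟨h.1.add h'.1, h.2.add h'.2⟩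
  zero_mem' := ⟨IsWeightedGrad.zero, LateralCondition.zero⟩
  smul_mem' c _ h := ⟨h.1.smul c, h.2.smul c⟩

/-- The space `𝓗²` of all `v ∈ 𝓗` with `Δ_λ v ∈ L²(ℝ₊ × Ω)`.
An element is recorded as the pair `(v, Δ_λ v)`. -/
def spaceH2 (a : ℝ) : Submodule ℝ (spaceH D a × D.L2Bulk) where
  carrier := {V | IsWeightedLaplacian D a V.1.1.2.1 V.1.1.2.2 V.2}
  add_mem' h h' := IsWeightedLaplacian.add h h'
  zero_mem' := IsWeightedLaplacian.zero
  smul_mem' c _ h := IsWeightedLaplacian.smul c h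

variable {D}

/-- The function `u` itself. -/
def fnOf {a : ℝ} (u : spaceH D a) : D.L2Bulk := u.1.1

/-- `√λ ∂_z u`. -/
def gradz {a : ℝ} (u : spaceH D a) : D.L2Bulk := u.1.2.1

/-- `∂_{x_j} u`. -/
def gradx {a : ℝ} (u : spaceH D a) (j : Fin 2) : D.L2Bulk := u.1.2.2 j

/-- `‖∇_{√λ} u‖_{L²(ℝ₊ × Ω)}`. -/
def gradNorm {a : ℝ} (u : spaceH D a) : ℝ :=
  √(‖gradz u‖ ^ 2 + ∑ j, ‖gradx u j‖ ^ 2)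

/-- The element `v` of `𝓗` underlying an element of `𝓗²`. -/
def toH {a : ℝ} (v : spaceH2 D a) : spaceH D a := v.1.1

/-- `Δ_λ v`. -/
def lap {a : ℝ} (v : spaceH2 D a) : D.L2Bulk := v.1.2

/-- The homogeneous Sobolev space `Ḣ^s(Ω)`, `-1 < s < 1`: the formal series `θ = ∑ θ_i e_i` with
`∑ k_i ^ s θ_i² < ∞`, recorded as their coefficient sequences. -/
def HDot (k : ℕ → ℝ) (s : ℝ) : Submodule ℝ (ℕ → ℝ) where
  carrier := {θ | Summable fun i => k i ^ s * θ i ^ 2}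
  add_mem' {θ η} h h' := by
    refine Summable.of_norm_bounded ((h.norm.add h'.norm).mul_left 2) fun i => ?_
    simp only [Pi.add_apply, norm_mul, Real.norm_eq_abs, abs_pow, sq_abs]
    nlinarith [mul_nonneg (abs_nonneg (k i ^ s)) (sq_nonneg (θ i - η i))]
  zero_mem' := by simp
  smul_mem' c θ h := by
    refine (Summable.mul_left (c ^ 2) h).congr fun i => ?_
    simp only [Pi.smul_apply, smul_eq_mul]
    ring

/-- The norm `‖θ‖_{Ḣ^s(Ω)} = (∑ k_i ^ s θ_i²)^{1/2}`. -/
def hdotNorm {k : ℕ → ℝ} {s : ℝ} (θ : HDot k s) : ℝ :=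
  √(∑' i, k i ^ s * θ.1 i ^ 2)

/-- `g = lim_{z → 0} u(z, ·)`: convergence in `L²(Ω)` as `z → 0⁺` through almost every `z`
(an element of `L²(ℝ₊ × Ω)` only has slices for almost every `z`). -/
def IsDirichletTrace (u : D.L2Bulk) (g : D.L2) : Prop :=
  Tendsto (fun z : ℝ => eLpNorm (fun x => u (z, x) - g x) 2 D.meas)
    (𝓝[>] 0 ⊓ ae volume) (𝓝 0)

/-- `θ = - lim_{z → 0} λ ∂_z v (z, ·)`, where `λ ∂_z v = z ^ (a/2) Gz`: weak convergence against
all `φ = ∑ φ_i e_i ∈ V`, as `z → 0⁺` through almost every `z`; the limit is the duality pairing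
`∑ θ_i φ_i` of `θ` and `φ`. -/
def IsNeumannTrace (a : ℝ) (e : ℕ → D.L2) (Gz : D.L2Bulk) (θ : ℕ → ℝ) : Prop :=
  ∀ φ : D.L2, MemV D φ → ∃ L : ℝ, HasSum (fun i => θ i * inner ℝ (e i) φ) L ∧
    Tendsto (fun z : ℝ => - ∫ x, (z ^ (a / 2) * Gz (z, x)) * φ x ∂D.meas)
      (𝓝[>] 0 ⊓ ae volume) (𝓝 L)

end

end QGTrace

namespace QGTrace

noncomputable section

/-! ### Functions of one variable given as primitives -/

/-! Expanding in the eigenbasis reduces everything to ordinary functions of `z`. Almost every slice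
of `u ∈ 𝓗` lies in `V` (`ae_slice_mem_graphV`), so the equations can be tested with `χ(z) e_i(x)`.
Write `u_i`, `g_i`, `f_i` for the coefficients of `u`, `√λ ∂_z u`, `Δ_λ u`. Then `u_i' = z ^ (-a/2)
g_i`, and for `𝓗²` the flux `w_i = z ^ (a/2) g_i` satisfies `w_i' = k_i u_i + f_i`. Both right-hand
sides are integrable up to `z = 0`, the first because `a < 1`, so `u_i` and `w_i` are primitives
(`exists_ae_eq_prim`) and have boundary values `c_i` and `d_i`. The traces are `γ₀ u = ∑ c_i e_i`
and `γ_λ u = -∑ d_i e_i`.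

The bounds come from one-dimensional inequalities, `exists_dirichlet_trace_le` and
`exists_neumann_trace_le`: with `σ = (1-a)/(2-a)`, `k ^ σ c²` is at most a constant times `∫ (g² + k
u²)`, and `k ^ (-σ) d²` at most a constant times `∫ (g² + k⁻¹ (w')²)`. Each follows by integrating
`(p u²)'` or `(p w²)'` for a multiplier `p` satisfying a Riccati differential inequality; the
constant is `1 / p(0)` after the dilation that normalises `k` to `1`. Explicit multipliers with
`p(0) = 1` exist for `a ≤ 0` in the Dirichlet case and for `a ≥ 0` in the Neumann case. Summation
over `i` uses Bessel's inequality for functions and for horizontal gradients. In the Neumann case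
the source `k_i u_i + f_i` is split by Young's inequality, with `1 / k_i ≤ C_p²` and the Young
parameter optimised only after summation.

Convergence to the traces is uniform in `i` in the sense needed: the increments of `u_i` are
controlled by `z ^ (1-a) ∫ g_i²` and those of `w_i` by `z ∫ (w_i')²`, and these bounds can be
summed. Green's formula is integration by parts for `u_i w_i` on the half-line (`coef_green`),
summed by Parseval (`green`). Decay at infinity is never assumed: a quantity bounded by `z h(z)`
with `h` integrable cannot stay above a positive number, since `1 / z` is not integrable
(`nonpos_of_le_mul_integrable`). -/

/-- The primitive `z ↦ c + ∫₀ᶻ q` of `q` with value `c` at `0`. -/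
def prim (c : ℝ) (q : ℝ → ℝ) (z : ℝ) : ℝ := c + ∫ t in (0 : ℝ)..z, q t

@[simp] theorem prim_zero (c : ℝ) (q : ℝ → ℝ) : prim c q 0 = c := by simp [prim]

theorem prim_absolutelyContinuous {c Z : ℝ} {q : ℝ → ℝ} (hq : IntervalIntegrable q volume 0 Z) :
    AbsolutelyContinuousOnInterval (prim c q) 0 Z := by
  have h1 : AbsolutelyContinuousOnInterval (fun _ : ℝ => c) 0 Z :=
    (LipschitzOnWith.absolutelyContinuousOnInterval (K := 0)
      ((LipschitzWith.const c).lipschitzOnWith))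
  exact h1.add (hq.absolutelyContinuousOnInterval_intervalIntegral (by simp))

theorem ae_deriv_prim {c Z : ℝ} {q : ℝ → ℝ} (hq : IntervalIntegrable q volume 0 Z) :
    ∀ᵐ z, z ∈ uIcc 0 Z → deriv (prim c q) z = q z := by
  filter_upwards [hq.ae_hasDerivAt_integral] with z hz hm
  exact ((hz hm 0 (by simp)).const_add c).deriv

/-- The product rule for primitives, in integrated form. -/
theorem prim_mul_prim {c d Z : ℝ} {q r : ℝ → ℝ} (hq : IntervalIntegrable q volume 0 Z)
    (hr : IntervalIntegrable r volume 0 Z) :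
    prim c q Z * prim d r Z
      = c * d + ∫ z in (0 : ℝ)..Z, (q z * prim d r z + prim c q z * r z) := by
  have h := (prim_absolutelyContinuous (c := c) hq).integral_deriv_mul_eq_sub
    (prim_absolutelyContinuous (c := d) hr)
  rw [prim_zero, prim_zero] at h
  have h2 : ∫ z in (0 : ℝ)..Z, (q z * prim d r z + prim c q z * r z)
      = ∫ z in (0 : ℝ)..Z, deriv (prim c q) z * prim d r z + prim c q z * deriv (prim d r) z := by
    apply intervalIntegral.integral_congr_ae
    filter_upwards [ae_deriv_prim (c := c) hq, ae_deriv_prim (c := d) hr] with z h1 h2 hz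
    rw [h1 (uIoc_subset_uIcc hz), h2 (uIoc_subset_uIcc hz)]
  rw [h2, h]
  ring

theorem prim_continuousOn {c Z : ℝ} {q : ℝ → ℝ} (hq : IntervalIntegrable q volume 0 Z) :
    ContinuousOn (prim c q) (uIcc 0 Z) :=
  (prim_absolutelyContinuous hq).continuousOn

theorem prim_deriv_intervalIntegrable {c d Z : ℝ} {q r : ℝ → ℝ}
    (hq : IntervalIntegrable q volume 0 Z) (hr : IntervalIntegrable r volume 0 Z) :
    IntervalIntegrable (fun z => q z * prim d r z + prim c q z * r z) volume 0 Z :=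
  (hq.mul_continuousOn (prim_continuousOn hr)).add (hr.continuousOn_mul (prim_continuousOn hq))

/-- The product of two primitives is a primitive. -/
theorem prim_mul_prim_eq_prim {c d Z : ℝ} {q r : ℝ → ℝ} (hq : IntervalIntegrable q volume 0 Z)
    (hr : IntervalIntegrable r volume 0 Z) {z : ℝ} (hz : z ∈ uIcc 0 Z) :
    prim c q z * prim d r z
      = prim (c * d) (fun z => q z * prim d r z + prim c q z * r z) z := by
  have h0 : uIcc 0 z ⊆ uIcc 0 Z := uIcc_subset_uIcc left_mem_uIcc hz
  exact prim_mul_prim (hq.mono_set h0) (hr.mono_set h0)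

/-- Integration of a function supported in `[0, Z]`. -/
theorem setIntegral_Ioi_eq_intervalIntegral {F : ℝ → ℝ} {Z : ℝ} (hZ : 0 ≤ Z)
    (h : ∀ z, Z < z → F z = 0) : ∫ z in Ioi (0 : ℝ), F z = ∫ z in (0 : ℝ)..Z, F z := by
  rw [intervalIntegral.integral_of_le hZ]
  refine setIntegral_eq_of_subset_of_forall_sdiff_eq_zero measurableSet_Ioi Ioc_subset_Ioi_self ?_
  intro z hz
  refine h z ?_
  by_contra hc
  exact hz.2 ⟨hz.1, not_lt.1 hc⟩

/-- A smooth function of zero integral with compact support in `(0, ∞)` is the derivative of a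
smooth function with compact support in `(0, ∞)`. -/
theorem exists_primitive_compactSupport {m : ℝ → ℝ} (hm : ContDiff ℝ ∞ m)
    (hc : HasCompactSupport m) (hs : tsupport m ⊆ Ioi 0) (h0 : ∫ z in Ioi (0 : ℝ), m z = 0) :
    ∃ β : ℝ, 0 < β ∧ ContDiff ℝ ∞ (prim 0 m) ∧ HasCompactSupport (prim 0 m) ∧
      tsupport (prim 0 m) ⊆ Ioi 0 ∧ (∀ z, deriv (prim 0 m) z = m z) ∧
      (∀ z, β ≤ z → prim 0 m z = 0) ∧ ∀ z, β < z → m z = 0 := by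
  obtain ⟨α, β, hα, hsub⟩ : ∃ α β : ℝ, 0 < α ∧ tsupport m ⊆ Icc α β := by
    rcases (tsupport m).eq_empty_or_nonempty with he | hne
    · exact ⟨1, 1, one_pos, by simp [he]⟩
    · have hK : IsCompact (tsupport m) := hc
      refine ⟨sInf (tsupport m), sSup (tsupport m), hs (hK.sInf_mem hne), fun z hz => ?_⟩
      exact ⟨csInf_le hK.bddBelow hz, le_csSup hK.bddAbove hz⟩
  have hz1 : ∀ z, z < α → m z = 0 := fun z hz => by
    by_contra h
    exact absurd (hsub (subset_tsupport _ h)).1 (not_le.2 hz)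
  have hz2 : ∀ z, β < z → m z = 0 := fun z hz => by
    by_contra h
    exact absurd (hsub (subset_tsupport _ h)).2 (not_le.2 hz)
  have hd : ∀ z, HasDerivAt (prim 0 m) (m z) z := fun z => by
    have := (hm.continuous.integral_hasStrictDerivAt 0 z).hasDerivAt
    exact this.const_add 0
  have hder : deriv (prim 0 m) = m := funext fun z => (hd z).deriv
  have hlow : ∀ z, z ≤ α → prim 0 m z = 0 := fun z hz => by
    simp only [prim, zero_add]
    rw [intervalIntegral.integral_congr_ae (g := fun _ => (0 : ℝ))]
    · simp
    · filter_upwards [Measure.ae_ne volume α] with t ht htm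
      refine hz1 t (lt_of_le_of_ne ?_ ht)
      rcases le_total 0 z with h | h
      · rw [uIoc_of_le h] at htm; exact htm.2.trans hz
      · rw [uIoc_of_ge h] at htm; exact htm.2.trans hα.le
  have hhigh : ∀ z, max β 1 ≤ z → prim 0 m z = 0 := fun z hz => by
    have := setIntegral_Ioi_eq_intervalIntegral (F := m) (Z := z)
      (zero_le_one.trans ((le_max_right _ _).trans hz))
      (fun t ht => hz2 t (((le_max_left _ _).trans hz).trans_lt ht))
    simp only [prim, zero_add]
    rw [← this, h0]
  have hsupp : tsupport (prim 0 m) ⊆ Icc α (max β 1) := by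
    refine closure_minimal (fun z hz => ?_) isClosed_Icc
    by_contra hn
    rw [mem_Icc, not_and_or, not_le, not_le] at hn
    rcases hn with h | h
    · exact hz (hlow z h.le)
    · exact hz (hhigh z h.le)
  -- The maximum with `1` only serves to make the right endpoint visibly positive.
  refine ⟨max β 1, lt_max_of_lt_right one_pos, ?_, ?_, ?_, fun z => (hd z).deriv, hhigh,
    fun z hz => hz2 z ((le_max_left _ _).trans_lt hz)⟩
  · rw [contDiff_infty_iff_deriv, hder]
    exact ⟨fun z => (hd z).differentiableAt, hm⟩
  · exact isCompact_Icc.of_isClosed_subset (isClosed_tsupport _) hsupp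
  · exact hsupp.trans fun z hz => hα.trans_le hz.1

theorem exists_bump_Ioi : ∃ χ : ℝ → ℝ, ContDiff ℝ ∞ χ ∧ HasCompactSupport χ ∧
    tsupport χ ⊆ Ioi 0 ∧ ∫ z in Ioi (0 : ℝ), χ z = 1 := by
  let b : ContDiffBump (2 : ℝ) := ⟨1 / 2, 1, by norm_num, by norm_num⟩
  have hs : tsupport (b.normed volume) ⊆ Ioi 0 := by
    rw [b.tsupport_normed_eq, Real.closedBall_eq_Icc]
    intro z hz
    have := hz.1
    simp only [b] at this
    exact lt_of_lt_of_le (by norm_num) this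
  refine ⟨b.normed volume, b.contDiff_normed, b.hasCompactSupport_normed, hs, ?_⟩
  rw [setIntegral_eq_integral_of_forall_compl_eq_zero, b.integral_normed]
  intro z hz
  by_contra h
  exact hz (hs (subset_tsupport _ h))

/-- A function on `(0, ∞)` with a weak derivative that is integrable up to `0` is a primitive
of it. -/
theorem exists_ae_eq_prim {f q : ℝ → ℝ} (hf : LocallyIntegrableOn f (Ioi 0))
    (hq : ∀ Z, 0 ≤ Z → IntervalIntegrable q volume 0 Z)
    (h : ∀ χ : ℝ → ℝ, ContDiff ℝ ∞ χ → HasCompactSupport χ → tsupport χ ⊆ Ioi 0 →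
      ∫ z in Ioi (0 : ℝ), deriv χ z * f z = - ∫ z in Ioi (0 : ℝ), χ z * q z) :
    ∃ c, ∀ᵐ z ∂(volume.restrict (Ioi (0 : ℝ))), f z = prim c q z := by
  obtain ⟨χ₀, hχ₀, hχ₀c, hχ₀s, hχ₀i⟩ := exists_bump_Ioi
  have hQ : LocallyIntegrableOn (prim 0 q) (Ioi 0) := by
    refine ContinuousOn.locallyIntegrableOn (fun z hz => ?_) measurableSet_Ioi
    have hz' : (0 : ℝ) < z := hz
    have := prim_continuousOn (c := 0) (hq (z + 1) (by linarith)) 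
    rw [uIcc_of_le (by linarith)] at this
    exact (this.continuousAt (Icc_mem_nhds hz' (by linarith))).continuousWithinAt
  have hF : LocallyIntegrableOn (fun z => f z - prim 0 q z) (Ioi 0) := hf.sub hQ
  have hint : ∀ ψ : ℝ → ℝ, ContDiff ℝ ∞ ψ → HasCompactSupport ψ → tsupport ψ ⊆ Ioi 0 →
      ∀ g : ℝ → ℝ, LocallyIntegrableOn g (Ioi 0) →
      IntegrableOn (fun z => ψ z * g z) (Ioi 0) := by
    intro ψ hψ hψc hψs g hg
    have h1 : IntegrableOn g (tsupport ψ) :=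
      (hg.mono_set hψs).integrableOn_isCompact hψc
    have h2 : IntegrableOn (fun z => ψ z * g z) (tsupport ψ) :=
      h1.continuousOn_mul hψ.continuous.continuousOn hψc
    have h3 : Integrable (fun z => ψ z * g z) := by
      rwa [← integrableOn_iff_integrable_of_support_subset (s := tsupport ψ)]
      intro z hz
      refine subset_tsupport _ fun h => hz (by simp [h])
    exact h3.integrableOn
  -- The difference `f - prim 0 q` has zero weak derivative, so it should be constant; its average
  -- against the unit-mass bump `χ₀` identifies the constant.
  set c := ∫ z in Ioi (0 : ℝ), χ₀ z * (f z - prim 0 q z) with hcdef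
  refine ⟨c, ?_⟩
  have key := IsOpen.ae_eq_zero_of_integral_contDiff_smul_eq_zero (μ := volume.restrict (Ioi (0:ℝ)))
    (f := fun z => f z - prim 0 q z - c) isOpen_Ioi
    ((hF.sub (locallyIntegrableOn_const c)).mono_measure Measure.restrict_le_self) ?_
  · filter_upwards [key, ae_restrict_mem measurableSet_Ioi] with z hz hm
    have := hz hm
    simp only [prim, zero_add] at this ⊢
    linarith
  intro ψ hψ hψc hψs
  set I := ∫ z in Ioi (0 : ℝ), ψ z with hI
  have iψ : IntegrableOn ψ (Ioi 0) := (hψ.continuous.integrable_of_hasCompactSupport hψc).integrableOn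
  have iχ₀ : IntegrableOn χ₀ (Ioi 0) :=
    (hχ₀.continuous.integrable_of_hasCompactSupport hχ₀c).integrableOn
  -- Removing the right multiple of `χ₀` gives `ψ` zero mean, which makes its primitive an
  -- admissible test function.
  let m : ℝ → ℝ := fun z => ψ z - I * χ₀ z
  have hm : ContDiff ℝ ∞ m := hψ.sub (contDiff_const.mul hχ₀)
  have hmsub : tsupport m ⊆ tsupport ψ ∪ tsupport χ₀ := by
    refine closure_minimal (fun z hz => ?_) ((isClosed_tsupport _).union (isClosed_tsupport _))
    by_contra hn
    rw [mem_union, not_or] at hn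
    exact hz (by simp [m, image_eq_zero_of_notMem_tsupport hn.1, image_eq_zero_of_notMem_tsupport hn.2])
  have hmc : HasCompactSupport m :=
    (IsCompact.union hψc hχ₀c).of_isClosed_subset (isClosed_tsupport _) hmsub
  have hms : tsupport m ⊆ Ioi 0 := hmsub.trans (union_subset hψs hχ₀s)
  have hm0 : ∫ z in Ioi (0 : ℝ), m z = 0 := by
    simp only [m]
    rw [integral_sub iψ (iχ₀.const_mul I), integral_const_mul, hχ₀i, mul_one, sub_self]
  obtain ⟨β, hβ, h1, h2, h3, h4, h5, h6⟩ := exists_primitive_compactSupport hm hmc hms hm0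
  have e1 := h _ h1 h2 h3
  simp only [h4] at e1
  have hmi : IntervalIntegrable m volume 0 β := hm.continuous.intervalIntegrable _ _
  -- Integration by parts against the primitive of `q`; there is no boundary term, since the
  -- primitive of `m` vanishes at both ends.
  have e2 := prim_mul_prim (c := 0) (d := 0) hmi (hq β hβ.le)
  rw [h5 β le_rfl, zero_mul, zero_mul, zero_add, intervalIntegral.integral_add
    (hmi.mul_continuousOn (prim_continuousOn (hq β hβ.le)))
    ((hq β hβ.le).continuousOn_mul (prim_continuousOn hmi)),
    ← setIntegral_Ioi_eq_intervalIntegral hβ.le (fun z hz => by simp [h6 z hz]),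
    ← setIntegral_Ioi_eq_intervalIntegral hβ.le (fun z hz => by simp [h5 z hz.le])] at e2
  have e3 : ∫ z in Ioi (0 : ℝ), m z * (f z - prim 0 q z) = 0 := by
    simp only [mul_sub]
    rw [integral_sub (hint m hm hmc hms f hf) (hint m hm hmc hms _ hQ), e1]
    linarith
  have e4 : ∫ z in Ioi (0 : ℝ), m z * (f z - prim 0 q z)
      = (∫ z in Ioi (0 : ℝ), ψ z * (f z - prim 0 q z)) - I * c := by
    rw [hcdef, ← integral_const_mul, ← integral_sub (hint ψ hψ hψc hψs _ hF)
      ((hint χ₀ hχ₀ hχ₀c hχ₀s _ hF).const_mul I)]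
    refine integral_congr_ae (Eventually.of_forall fun z => ?_)
    simp only [m]
    ring
  simp only [smul_eq_mul, mul_sub _ _ c]
  rw [integral_sub (hint ψ hψ hψc hψs _ hF) (iψ.mul_const c), integral_mul_const, ← hI]
  linarith

/-- If `X ≤ z h(z)` for large `z` with `h` integrable, then `X ≤ 0`. -/
theorem nonpos_of_le_mul_integrable {h : ℝ → ℝ} (hh : IntegrableOn h (Ioi 0)) {X Z : ℝ}
    (hX : ∀ᵐ z ∂(volume.restrict (Ioi (0 : ℝ))), Z ≤ z → X ≤ z * h z) : X ≤ 0 := by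
  by_contra hX0
  push Not at hX0
  -- If `X > 0`, then `h` dominates `X / z` near infinity, and `1 / z` would be integrable there.
  have h1 : IntegrableOn (fun z : ℝ => X * z⁻¹) (Ioi (max Z 1)) := by
    have hsub : Ioi (max Z 1) ⊆ Ioi (0 : ℝ) :=
      Ioi_subset_Ioi (zero_le_one.trans (le_max_right _ _))
    refine Integrable.mono (hh.mono_set hsub) (by fun_prop) ?_
    have h2 := ae_restrict_of_ae_restrict_of_subset hsub hX
    filter_upwards [h2, ae_restrict_mem measurableSet_Ioi] with z hz hm
    have hz0 : 0 < z := hsub hm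
    have h3 := hz ((le_max_left _ _).trans (le_of_lt hm))
    have : X * z⁻¹ ≤ h z := by
      rw [← div_eq_mul_inv, div_le_iff₀ hz0]; linarith
    rw [Real.norm_of_nonneg (by positivity)]
    exact this.trans (le_abs_self _)
  have h2 : IntegrableOn (fun z : ℝ => z⁻¹) (Ioi (max Z 1)) := by
    refine (h1.const_mul X⁻¹).congr (Eventually.of_forall fun z => ?_)
    simp only
    rw [inv_mul_cancel_left₀ hX0.ne']
  exact not_integrableOn_Ioi_inv h2

/-! ### One-dimensional trace inequalities -/

theorem intervalIntegral_le_setIntegral_Ioi {E : ℝ → ℝ} (hE : IntegrableOn E (Ioi 0))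
    (hE0 : ∀ᵐ z ∂(volume.restrict (Ioi (0 : ℝ))), 0 ≤ E z) {Z : ℝ} (hZ : 0 ≤ Z) :
    ∫ z in (0 : ℝ)..Z, E z ≤ ∫ z in Ioi (0 : ℝ), E z := by
  rw [intervalIntegral.integral_of_le hZ]
  exact setIntegral_mono_set hE hE0 (LE.le.eventuallyLE Ioc_subset_Ioi_self)

theorem IntegrableOn.intervalIntegrable_zero {E : ℝ → ℝ} (hE : IntegrableOn E (Ioi 0)) {Z : ℝ}
    (hZ : 0 ≤ Z) : IntervalIntegrable E volume 0 Z := by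
  rw [intervalIntegrable_iff_integrableOn_Ioc_of_le hZ]
  exact hE.mono_set Ioc_subset_Ioi_self

/-- A trace inequality from a Riccati differential inequality for the multiplier `prim p₀ r`. -/
theorem trace_sq_le_of_multiplier {c p₀ X : ℝ} {q r E h : ℝ → ℝ}
    (hq : ∀ Z, 0 ≤ Z → IntervalIntegrable q volume 0 Z)
    (hr : ∀ Z, 0 ≤ Z → IntervalIntegrable r volume 0 Z)
    (hE : IntegrableOn E (Ioi 0)) (hE0 : ∀ᵐ z ∂(volume.restrict (Ioi (0 : ℝ))), 0 ≤ E z)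
    (hle : ∀ᵐ z ∂(volume.restrict (Ioi (0 : ℝ))),
      -(r z * prim c q z ^ 2 + 2 * prim p₀ r z * prim c q z * q z) ≤ E z)
    (hh : IntegrableOn h (Ioi 0))
    (hdec : ∀ᵐ z ∂(volume.restrict (Ioi (0 : ℝ))), X ≤ z →
      prim p₀ r z * prim c q z ^ 2 ≤ z * h z) :
    p₀ * c ^ 2 ≤ ∫ z in Ioi (0 : ℝ), E z := by
  -- With `y = prim c q` and `p = prim p₀ r`, integrating `(p y²)'` over `[0, Z]` gives `p₀ c² - ∫ E
  -- ≤ p(Z) y(Z)²`. The right-hand side is at most `Z h(Z)` for large `Z`, so the left-hand side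
  -- cannot be positive.
  rw [← sub_nonpos]
  refine nonpos_of_le_mul_integrable hh (Z := X) ?_
  filter_upwards [hdec, ae_restrict_mem measurableSet_Ioi] with Z hZ hZ0 hXZ
  have hZ0' : 0 ≤ Z := le_of_lt hZ0
  refine le_trans ?_ (hZ hXZ)
  have hyy := fun z (hz : z ∈ uIcc 0 Z) =>
    prim_mul_prim_eq_prim (c := c) (d := c) (hq Z hZ0') (hq Z hZ0') hz
  have hqq := prim_deriv_intervalIntegrable (c := c) (d := c) (hq Z hZ0') (hq Z hZ0')
  have e1 := prim_mul_prim (c := p₀) (d := c * c) (hr Z hZ0') hqq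
  have e1i := prim_deriv_intervalIntegrable (c := p₀) (d := c * c) (hr Z hZ0') hqq
  rw [← hyy Z right_mem_uIcc] at e1
  have e2 : -∫ z in (0 : ℝ)..Z, (r z * prim (c * c)
      (fun z => q z * prim c q z + prim c q z * q z) z
      + prim p₀ r z * (q z * prim c q z + prim c q z * q z)) ≤ ∫ z in (0 : ℝ)..Z, E z := by
    rw [← intervalIntegral.integral_neg]
    refine intervalIntegral.integral_mono_ae_restrict hZ0' e1i.neg
      (IntegrableOn.intervalIntegrable_zero hE hZ0') ?_
    rw [← restrict_Ioc_eq_restrict_Icc]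
    have h1 := ae_restrict_of_ae_restrict_of_subset (Ioc_subset_Ioi_self : Ioc 0 Z ⊆ Ioi 0) hle
    filter_upwards [h1, ae_restrict_mem measurableSet_Ioc] with z hz hm
    have hm' : z ∈ uIcc 0 Z := by
      rw [uIcc_of_le hZ0']; exact Ioc_subset_Icc_self hm
    rw [← hyy z hm']
    refine le_trans (le_of_eq ?_) hz
    ring
  have e3 := intervalIntegral_le_setIntegral_Ioi hE hE0 hZ0'
  have e4 : p₀ * c ^ 2 = p₀ * (c * c) := by ring
  have e5 : prim p₀ r Z * prim c q Z ^ 2 = prim p₀ r Z * (prim c q Z * prim c q Z) := by ring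
  rw [e4, e5]
  linarith

/-- Integration by parts on `(0, ∞)` for two primitives whose product is small at infinity. -/
theorem integral_prim_mul_prim {c d X : ℝ} {q r h : ℝ → ℝ}
    (hq : ∀ Z, 0 ≤ Z → IntervalIntegrable q volume 0 Z)
    (hr : ∀ Z, 0 ≤ Z → IntervalIntegrable r volume 0 Z)
    (hi : IntegrableOn (fun z => q z * prim d r z + prim c q z * r z) (Ioi 0))
    (hh : IntegrableOn h (Ioi 0))
    (hdec : ∀ᵐ z ∂(volume.restrict (Ioi (0 : ℝ))), X ≤ z →
      |prim c q z * prim d r z| ≤ z * h z) :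
    ∫ z in Ioi (0 : ℝ), (q z * prim d r z + prim c q z * r z) = -(c * d) := by
  have ht := (intervalIntegral_tendsto_integral_Ioi 0 hi tendsto_id).const_add (c * d)
  set I := c * d + ∫ z in Ioi (0 : ℝ), (q z * prim d r z + prim c q z * r z) with hI
  have ht2 : Tendsto (fun Z => |prim c q Z * prim d r Z|) atTop (𝓝 |I|) := by
    refine Tendsto.abs (ht.congr' ?_)
    filter_upwards [eventually_ge_atTop (0 : ℝ)] with Z hZ
    rw [prim_mul_prim (hq Z hZ) (hr Z hZ)]
    rfl
  -- The product of the primitives converges to `I` at infinity. If `I ≠ 0`, its absolute value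
  -- would eventually exceed `|I| / 2` while staying below `z h(z)`.
  have hI0 : I = 0 := by
    by_contra hne
    have hpos : 0 < |I| := abs_pos.2 hne
    obtain ⟨Z₀, hZ₀⟩ := eventually_atTop.1 (ht2.eventually (lt_mem_nhds (half_lt_self hpos)))
    have := nonpos_of_le_mul_integrable hh (X := |I| / 2) (Z := max X Z₀) (by
      filter_upwards [hdec] with z hz hm
      exact (hZ₀ z ((le_max_right _ _).trans hm)).le.trans (hz ((le_max_left _ _).trans hm)))
    linarith
  linarith

/-! ### Riccati multipliers and their dilations -/

/-- A multiplier `P` with derivative `R` away from the point `1`. -/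
structure IsProfile (P R : ℝ → ℝ) : Prop where
  cont : ContinuousOn P (Ici 0)
  deriv : ∀ y, 0 < y → y ≠ 1 → HasDerivAt P (R y) y
  int : ∀ Z, 0 ≤ Z → IntervalIntegrable R volume 0 Z

theorem IsProfile.eq_prim {P R : ℝ → ℝ} (h : IsProfile P R) {y : ℝ} (hy : 0 ≤ y) :
    P y = prim (P 0) R y := by
  have := integral_eq_of_hasDerivAt_off_countable_of_le P R hy (countable_singleton 1)
    (h.cont.mono Icc_subset_Ici_self) (fun x hx => h.deriv x hx.1.1 hx.2) (h.int y hy)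
  rw [prim, this]
  ring

theorem IsProfile.scaled_int {P R : ℝ → ℝ} (h : IsProfile P R) (κ : ℝ) {μ : ℝ} (hμ : 0 < μ)
    {Z : ℝ} (hZ : 0 ≤ Z) : IntervalIntegrable (fun z => κ / μ * R (z / μ)) volume 0 Z := by
  have := (h.int (Z / μ) (by positivity)).comp_mul_right (c := μ⁻¹)
  simp only [zero_mul, div_inv_eq_mul, div_mul_cancel₀ _ hμ.ne', ← div_eq_mul_inv] at this
  exact this.const_mul _

/-- Dilating a single profile by `μ` produces the multipliers for all eigenvalues, so the Riccati
inequality has to be checked only once. -/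
theorem IsProfile.scaled_eq_prim {P R : ℝ → ℝ} (h : IsProfile P R) (κ : ℝ) {μ : ℝ} (hμ : 0 < μ)
    {z : ℝ} (hz : 0 ≤ z) :
    κ * P (z / μ) = prim (κ * P 0) (fun z => κ / μ * R (z / μ)) z := by
  rw [h.eq_prim (div_nonneg hz hμ.le), prim, prim, intervalIntegral.integral_const_mul,
    intervalIntegral.integral_comp_div _ hμ.ne', zero_div, smul_eq_mul]
  field_simp

/-- The profiles are explicit on `[0, 1]` and continue as a power. Only continuity is needed at the
junction: the fundamental theorem of calculus tolerates one exceptional point. -/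
theorem isProfile_glue {P R : ℝ → ℝ} {c b : ℝ} (h1 : ContinuousOn P (Icc 0 1))
    (hd : ∀ y ∈ Ioo (0 : ℝ) 1, HasDerivAt P (R y) y) (hi : IntervalIntegrable R volume 0 1)
    (hc : P 1 = c) :
    IsProfile (fun y => if y ≤ 1 then P y else c * y ^ b)
      (fun y => if y ≤ 1 then R y else c * (b * y ^ (b - 1))) := by
  have hpow : ∀ d : ℝ, ContinuousOn (fun y : ℝ => y ^ d) (Ici 1) := fun d y hy =>
    (Real.continuousAt_rpow_const y d
      (Or.inl (ne_of_gt (lt_of_lt_of_le one_pos hy)))).continuousWithinAt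
  refine ⟨?_, ?_, ?_⟩
  · refine ContinuousOn.if (p := fun y : ℝ => y ≤ 1) ?_ ?_ ?_
    · rintro y ⟨_, hy⟩
      have : y = 1 := by
        have h2 : frontier {y : ℝ | y ≤ 1} = {1} := frontier_Iic
        rw [h2] at hy
        exact hy
      rw [this, hc, Real.one_rpow, mul_one]
    · refine h1.mono ?_
      rintro y ⟨hy0, hy⟩
      have h2 : closure {y : ℝ | y ≤ 1} = Iic 1 := closure_Iic 1
      rw [h2] at hy
      exact ⟨hy0, hy⟩
    · refine ((hpow b).const_mul c).mono ?_
      rintro y ⟨_, hy⟩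
      have h2 : closure {y : ℝ | ¬ y ≤ 1} = Ici 1 := by
        simp only [not_le]
        exact closure_Ioi 1
      rw [h2] at hy
      exact hy
  · intro y hy0 hy1
    rcases lt_or_gt_of_ne hy1 with hlt | hgt
    · simp only [hlt.le, if_true]
      refine (hd y ⟨hy0, hlt⟩).congr_of_eventuallyEq ?_
      filter_upwards [Iio_mem_nhds hlt] with t ht
      simp only [le_of_lt (mem_Iio.1 ht), if_true]
    · simp only [not_le.2 hgt, if_false]
      have h2 := ((Real.hasDerivAt_rpow_const (x := y) (p := b) (Or.inl hy0.ne')).const_mul c)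
      refine h2.congr_of_eventuallyEq ?_
      filter_upwards [Ioi_mem_nhds hgt] with t ht
      simp only [not_le.2 (mem_Ioi.1 ht), if_false]
  · intro Z hZ
    have i1 : IntervalIntegrable (fun y => if y ≤ 1 then R y else c * (b * y ^ (b - 1)))
        volume 0 1 := by
      refine hi.congr fun y hy => ?_
      rw [uIoc_of_le zero_le_one] at hy
      simp only [hy.2, if_true]
    rcases le_total Z 1 with h | h
    · refine i1.mono_set ?_
      rw [uIcc_of_le hZ, uIcc_of_le zero_le_one]
      exact Icc_subset_Icc_right h
    · refine i1.trans ?_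
      have i2 : IntervalIntegrable (fun y : ℝ => c * (b * y ^ (b - 1))) volume 1 Z := by
        refine ContinuousOn.intervalIntegrable ?_
        rw [uIcc_of_le h]
        exact (((hpow (b - 1)).const_mul b).const_mul c).mono Icc_subset_Ici_self
      refine i2.congr fun y hy => ?_
      rw [uIoc_of_le h] at hy
      simp only [not_le.2 hy.1, if_false]

/-- The square of the weight is `z ^ (-a)`, integrable at `0` exactly because `a < 1`. This is what
gives functions in `𝓗` a trace. -/
theorem memLp_weight {a : ℝ} (ha : a < 1) {Z : ℝ} (hZ : 0 ≤ Z) :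
    MemLp (fun z : ℝ => z ^ (-a / 2)) 2 (volume.restrict (Ioc 0 Z)) := by
  have hm : Measurable fun z : ℝ => z ^ (-a / 2) := by fun_prop
  rw [memLp_two_iff_integrable_sq hm.aestronglyMeasurable]
  have h1 := intervalIntegral.intervalIntegrable_rpow' (a := 0) (b := Z) (r := -a) (by linarith)
  rw [intervalIntegrable_iff_integrableOn_Ioc_of_le hZ] at h1
  refine h1.congr ?_
  filter_upwards [ae_restrict_mem measurableSet_Ioc] with z hz
  rw [← Real.rpow_natCast, ← Real.rpow_mul hz.1.le]
  congr 1
  push_cast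
  ring

theorem integral_weight_sq {a : ℝ} (ha : a < 1) {Z : ℝ} (hZ : 0 ≤ Z) :
    ∫ z in Ioc 0 Z, (z ^ (-a / 2)) ^ 2 = Z ^ (1 - a) / (1 - a) := by
  have h1 := integral_rpow (a := 0) (b := Z) (r := -a) (Or.inl (by linarith))
  rw [intervalIntegral.integral_of_le hZ] at h1
  rw [show (1 : ℝ) - a = -a + 1 by ring, show ∫ z in Ioc 0 Z, (z ^ (-a / 2)) ^ 2
    = ∫ z in Ioc 0 Z, z ^ (-a) from setIntegral_congr_fun measurableSet_Ioc fun z hz => ?_, h1,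
    Real.zero_rpow (by linarith), sub_zero]
  rw [← Real.rpow_natCast, ← Real.rpow_mul hz.1.le]
  congr 1
  push_cast
  ring

theorem weight_mul_intervalIntegrable {a : ℝ} (ha : a < 1) {g : ℝ → ℝ}
    (hg : MemLp g 2 (volume.restrict (Ioi 0))) {Z : ℝ} (hZ : 0 ≤ Z) :
    IntervalIntegrable (fun z => z ^ (-a / 2) * g z) volume 0 Z := by
  rw [intervalIntegrable_iff_integrableOn_Ioc_of_le hZ]
  exact (memLp_weight ha hZ).integrable_mul
    (hg.mono_measure (Measure.restrict_mono Ioc_subset_Ioi_self le_rfl))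

theorem memLp_intervalIntegrable {q : ℝ → ℝ}
    (hq : MemLp q 2 (volume.restrict (Ioi 0))) {Z : ℝ} (hZ : 0 ≤ Z) :
    IntervalIntegrable q volume 0 Z := by
  rw [intervalIntegrable_iff_integrableOn_Ioc_of_le hZ]
  exact (hq.mono_measure (Measure.restrict_mono Ioc_subset_Ioi_self le_rfl)).integrable
    (by norm_num)

theorem two_mul_le_of_sq {x y : ℝ} : -(2 * x * y) ≤ x ^ 2 + y ^ 2 := by nlinarith [sq_nonneg (x + y)]

theorem sq_rpow_half {z : ℝ} (hz : 0 < z) (b : ℝ) : (z ^ (b / 2)) ^ 2 = z ^ b := by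
  rw [← Real.rpow_natCast, ← Real.rpow_mul hz.le]
  congr 1
  push_cast
  ring

theorem scaled_sq {a μ z : ℝ} (hμ : 0 < μ) (hz : 0 < z) :
    (μ ^ (a - 1)) ^ 2 * z ^ (-a) = μ ^ (a - 2) * (z / μ) ^ (-a) := by
  rw [Real.div_rpow hz.le hμ.le, ← Real.rpow_natCast, ← Real.rpow_mul hμ.le, mul_div_assoc',
    mul_comm (μ ^ (a - 2)), mul_div_assoc, ← Real.rpow_sub hμ, mul_comm]
  congr 2
  push_cast
  ring

/-- The trace inequality for `u` with `z ^ (a / 2) u' = g`, from a multiplier. -/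
theorem dirichlet_le_of_profile {a μ : ℝ} (ha : a < 1) (hμ : 0 < μ) {P R : ℝ → ℝ}
    (hPR : IsProfile P R) {M : ℝ} (hM : ∀ y, 1 < y → P y ≤ M)
    (hRic : ∀ y, 0 < y → y ≠ 1 → P y ^ 2 * y ^ (-a) - R y ≤ 1) {c : ℝ} {g : ℝ → ℝ}
    (hg : MemLp g 2 (volume.restrict (Ioi 0)))
    (hu : MemLp (prim c fun z => z ^ (-a / 2) * g z) 2 (volume.restrict (Ioi 0))) :
    μ ^ (a - 1) * P 0 * c ^ 2
      ≤ ∫ z in Ioi (0 : ℝ), (g z ^ 2 + μ ^ (a - 2) * prim c (fun z => z ^ (-a / 2) * g z) z ^ 2) := by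
  have hκ : 0 < μ ^ (a - 1) := Real.rpow_pos_of_pos hμ _
  have hk : 0 < μ ^ (a - 2) := Real.rpow_pos_of_pos hμ _
  have hκk : μ ^ (a - 1) / μ = μ ^ (a - 2) := by
    rw [div_eq_iff hμ.ne', ← Real.rpow_add_one hμ.ne']
    congr 1
    ring
  have hM' : ∀ y, 1 < y → P y ≤ |M| := fun y hy => (hM y hy).trans (le_abs_self M)
  refine trace_sq_le_of_multiplier (X := max μ 1 + 1) (h := fun z => (μ ^ (a - 1) * |M|) *
      prim c (fun z => z ^ (-a / 2) * g z) z ^ 2)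
    (r := fun z => μ ^ (a - 1) / μ * R (z / μ))
    (fun Z hZ => weight_mul_intervalIntegrable ha hg hZ)
    (fun Z hZ => hPR.scaled_int _ hμ hZ) (hg.integrable_sq.add (hu.integrable_sq.const_mul _))
    (Eventually.of_forall fun z => by positivity) ?_ (hu.integrable_sq.const_mul _) ?_
  · filter_upwards [ae_restrict_mem measurableSet_Ioi, ae_restrict_of_ae (Measure.ae_ne volume μ)]
      with z hz hzμ
    have hz0 : 0 < z := hz
    rw [← hPR.scaled_eq_prim _ hμ hz0.le, hκk]
    set u := prim c (fun z => z ^ (-a / 2) * g z) z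
    have h1 := hRic (z / μ) (by positivity) (fun h => hzμ (by rwa [div_eq_one_iff_eq hμ.ne'] at h))
    -- Completing the square in `g + p u z ^ (-a/2)`, where `p(z) = μ ^ (a-1) P(z/μ)`. What remains
    -- is `p² z ^ (-a) - p'` times `u²`, which by scaling is `μ ^ (a-2)` times the Riccati
    -- expression of `P` at `z/μ`.
    have h2 := two_mul_le_of_sq (x := μ ^ (a - 1) * P (z / μ) * u * z ^ (-a / 2)) (y := g z)
    have h3 : (μ ^ (a - 1) * P (z / μ) * u * z ^ (-a / 2)) ^ 2
        = μ ^ (a - 2) * (P (z / μ) ^ 2 * (z / μ) ^ (-a)) * u ^ 2 := by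
      rw [mul_pow, sq_rpow_half hz0 (-a)]
      linear_combination P (z / μ) ^ 2 * u ^ 2 * scaled_sq (a := a) hμ hz0
    have h4 := mul_le_mul_of_nonneg_left h1 (mul_nonneg hk.le (sq_nonneg u))
    rw [h3] at h2
    linarith
  · filter_upwards [ae_restrict_mem measurableSet_Ioi] with z hz hX
    have hz0 : 0 < z := hz
    have hz1 : 1 ≤ z := by linarith [le_max_right μ 1]
    have hz2 : 1 < z / μ := by
      rw [one_lt_div hμ]; linarith [le_max_left μ 1]
    rw [← hPR.scaled_eq_prim _ hμ hz0.le]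
    have h1 := mul_le_mul_of_nonneg_right (mul_le_mul_of_nonneg_left (hM' _ hz2) hκ.le)
      (sq_nonneg (prim c (fun z => z ^ (-a / 2) * g z) z))
    refine h1.trans (le_mul_of_one_le_left (by positivity) hz1)

/-- The trace inequality for `w = z ^ (a / 2) g` with `w' = q`, from a multiplier. -/
theorem neumann_le_of_profile {a μ : ℝ} (ha : a < 1) (hμ : 0 < μ) {P R : ℝ → ℝ}
    (hPR : IsProfile P R) {M : ℝ} (hM0 : 0 ≤ M) (hM : ∀ y, 1 < y → P y ≤ M * y ^ (-a / 2))
    (hRic : ∀ y, 0 < y → y ≠ 1 → P y ^ 2 - R y ≤ y ^ (-a)) {c : ℝ} {g q : ℝ → ℝ}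
    (hg : MemLp g 2 (volume.restrict (Ioi 0))) (hq : MemLp q 2 (volume.restrict (Ioi 0)))
    (hgq : ∀ᵐ z ∂(volume.restrict (Ioi (0 : ℝ))), z ^ (a / 2) * g z = prim c q z) :
    μ ^ (1 - a) * P 0 * c ^ 2
      ≤ ∫ z in Ioi (0 : ℝ), (g z ^ 2 + (μ ^ (a - 2))⁻¹ * q z ^ 2) := by
  have hκ : 0 < μ ^ (1 - a) := Real.rpow_pos_of_pos hμ _
  have hk : 0 < μ ^ (a - 2) := Real.rpow_pos_of_pos hμ _
  have hb : 0 < μ ^ (-a) := Real.rpow_pos_of_pos hμ _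
  have hκk : μ ^ (1 - a) / μ = μ ^ (-a) := by
    rw [div_eq_iff hμ.ne', ← Real.rpow_add_one hμ.ne']
    congr 1
    ring
  have hkκ : μ ^ (a - 2) * (μ ^ (1 - a)) ^ 2 = μ ^ (-a) := by
    rw [← Real.rpow_natCast, ← Real.rpow_mul hμ.le, ← Real.rpow_add hμ]
    congr 1
    push_cast
    ring
  refine trace_sq_le_of_multiplier (X := max μ 1 + 1)
    (h := fun z => (μ ^ (1 - a) * M * (μ ^ (-a / 2))⁻¹) * g z ^ 2)
    (r := fun z => μ ^ (1 - a) / μ * R (z / μ))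
    (fun Z hZ => memLp_intervalIntegrable hq hZ)
    (fun Z hZ => hPR.scaled_int _ hμ hZ) (hg.integrable_sq.add (hq.integrable_sq.const_mul _))
    (Eventually.of_forall fun z => by positivity) ?_ (hg.integrable_sq.const_mul _) ?_
  · filter_upwards [ae_restrict_mem measurableSet_Ioi, ae_restrict_of_ae (Measure.ae_ne volume μ),
      hgq] with z hz hzμ hzg
    have hz0 : 0 < z := hz
    rw [← hPR.scaled_eq_prim _ hμ hz0.le, hκk, ← hzg]
    set w := z ^ (a / 2) * g z with hw
    have h1 := hRic (z / μ) (by positivity) (fun h => hzμ (by rwa [div_eq_one_iff_eq hμ.ne'] at h))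
    set k := μ ^ (a - 2)
    -- Here the square is weighted by `k = μ ^ (a-2)`, since `q` carries the factor `k⁻¹` in the
    -- energy.
    have h2 : -(2 * (μ ^ (1 - a) * P (z / μ)) * w * q z)
        ≤ k * (μ ^ (1 - a)) ^ 2 * P (z / μ) ^ 2 * w ^ 2 + k⁻¹ * q z ^ 2 := by
      have h3 : 0 ≤ k⁻¹ * (k * (μ ^ (1 - a) * P (z / μ) * w) + q z) ^ 2 := by positivity
      have h4 : k⁻¹ * (k * (μ ^ (1 - a) * P (z / μ) * w) + q z) ^ 2
        = k * (μ ^ (1 - a) * P (z / μ) * w) ^ 2 + 2 * (μ ^ (1 - a) * P (z / μ) * w) * q z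
          + k⁻¹ * q z ^ 2 := by
        field_simp
        ring
      rw [h4] at h3
      linarith
    have h5 : μ ^ (-a) * (z / μ) ^ (-a) * w ^ 2 = g z ^ 2 := by
      rw [← Real.mul_rpow hμ.le (by positivity), mul_div_cancel₀ _ hμ.ne', hw, mul_pow,
        sq_rpow_half hz0, ← mul_assoc, ← Real.rpow_add hz0]
      simp
    rw [hkκ] at h2
    have h6 := mul_le_mul_of_nonneg_left h1 (mul_nonneg hb.le (sq_nonneg w))
    linarith
  · filter_upwards [ae_restrict_mem measurableSet_Ioi, hgq] with z hz hzg hX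
    have hz0 : 0 < z := hz
    have hz1 : 1 ≤ z := by linarith [le_max_right μ 1]
    have hz2 : 1 < z / μ := by
      rw [one_lt_div hμ]; linarith [le_max_left μ 1]
    rw [← hPR.scaled_eq_prim _ hμ hz0.le, ← hzg]
    have h1 := mul_le_mul_of_nonneg_right (mul_le_mul_of_nonneg_left (hM _ hz2) hκ.le)
      (sq_nonneg (z ^ (a / 2) * g z))
    refine h1.trans ?_
    -- The boundary term at `z` is a multiple of `z ^ (a/2) g²`, and `a / 2 ≤ 1`; hence the growth
    -- allowed for the tail of `P`.
    have h2 : z ^ (-a / 2) * (z ^ (a / 2)) ^ 2 ≤ z := by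
      rw [sq_rpow_half hz0, ← Real.rpow_add hz0]
      calc z ^ (-a / 2 + a) ≤ z ^ (1 : ℝ) := Real.rpow_le_rpow_of_exponent_le hz1 (by linarith)
        _ = z := Real.rpow_one z
    have h3 : μ ^ (1 - a) * (M * (z / μ) ^ (-a / 2)) * (z ^ (a / 2) * g z) ^ 2
        = (z ^ (-a / 2) * (z ^ (a / 2)) ^ 2) * (μ ^ (1 - a) * M * (μ ^ (-a / 2))⁻¹ * g z ^ 2) := by
      rw [Real.div_rpow hz0.le hμ.le]
      ring
    rw [h3]
    exact mul_le_mul_of_nonneg_right h2 (by positivity)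

/-! ### Explicit multipliers and their constants -/

theorem rpow_le_self_of_le_one {y b : ℝ} (hy : 0 < y) (hy1 : y ≤ 1) (hb : 1 ≤ b) : y ^ b ≤ y := by
  calc y ^ b ≤ y ^ (1 : ℝ) := Real.rpow_le_rpow_of_exponent_ge hy hy1 hb
    _ = y := Real.rpow_one y

theorem self_le_rpow_of_le_one {y b : ℝ} (hy : 0 < y) (hy1 : y ≤ 1) (hb : b ≤ 1) : y ≤ y ^ b := by
  calc y = y ^ (1 : ℝ) := (Real.rpow_one y).symm
    _ ≤ y ^ b := Real.rpow_le_rpow_of_exponent_ge hy hy1 hb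

theorem hasDerivAt_affine_rpow {y A B C b : ℝ} (hy : 0 < y) :
    HasDerivAt (fun y : ℝ => A + B * y + C * y ^ b) (B + C * (b * y ^ (b - 1))) y := by
  have h1 : HasDerivAt (fun y : ℝ => A + B * y) B y := by
    simpa using ((hasDerivAt_id y).const_mul B).const_add A
  exact h1.add ((Real.hasDerivAt_rpow_const (Or.inl hy.ne')).const_mul C)

theorem continuousOn_affine_rpow {A B C b : ℝ} (hb : 0 ≤ b) :
    ContinuousOn (fun y : ℝ => A + B * y + C * y ^ b) (Icc 0 1) := by
  have : Continuous fun y : ℝ => y ^ b := Real.continuous_rpow_const hb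
  fun_prop

theorem isProfile_affine_rpow {A B C b c d : ℝ} (hb : 0 < b) (h1 : A + B + C = c) :
    IsProfile (fun y => if y ≤ 1 then A + B * y + C * y ^ b else c * y ^ d)
      (fun y => if y ≤ 1 then B + C * (b * y ^ (b - 1)) else c * (d * y ^ (d - 1))) := by
  refine isProfile_glue (continuousOn_affine_rpow hb.le)
    (fun y hy => hasDerivAt_affine_rpow hy.1) ?_ (by simp [h1])
  have := intervalIntegral.intervalIntegrable_rpow' (a := 0) (b := 1) (r := b - 1) (by linarith)
  exact intervalIntegrable_const.add ((this.const_mul b).const_mul C)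

/-- The length `μ = k ^ (-1/(2-a))` is the one at which the terms `g²` and `k u²` balance; it turns
the exponents of `μ` into `±σ` with `σ = (1-a)/(2-a)`. -/
theorem scale_rpow {a k : ℝ} (ha : a < 1) (hk : 0 < k) :
    (k ^ (-(1 / (2 - a)))) ^ (a - 2) = k ∧
    (k ^ (-(1 / (2 - a)))) ^ (a - 1) = k ^ ((1 - a) / (2 - a)) ∧
    (k ^ (-(1 / (2 - a)))) ^ (1 - a) = k ^ (-((1 - a) / (2 - a))) := by
  have h2 : 2 - a ≠ 0 := by linarith
  refine ⟨?_, ?_, ?_⟩ <;> rw [← Real.rpow_mul hk.le]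
  · rw [show -(1 / (2 - a)) * (a - 2) = 1 by field_simp; ring, Real.rpow_one]
  · congr 1
    field_simp
    ring
  · congr 1
    field_simp

/-- The one-dimensional Dirichlet trace inequality, with a multiplier equal to `δ` at `0`. -/
theorem dirichlet_trace_le_of_profile {a δ : ℝ} (ha : a < 1) (hδ : 0 < δ) {P R : ℝ → ℝ}
    (hPR : IsProfile P R) {M : ℝ} (hM : ∀ y, 1 < y → P y ≤ M) (hP0 : P 0 = δ)
    (hRic : ∀ y, 0 < y → y ≠ 1 → P y ^ 2 * y ^ (-a) - R y ≤ 1)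
    {k : ℝ} (hk : 0 < k) {c : ℝ} {g : ℝ → ℝ}
    (hg : MemLp g 2 (volume.restrict (Ioi 0)))
    (hu : MemLp (prim c fun z => z ^ (-a / 2) * g z) 2 (volume.restrict (Ioi 0))) :
    k ^ ((1 - a) / (2 - a)) * c ^ 2 ≤ δ⁻¹ *
      ∫ z in Ioi (0 : ℝ), (g z ^ 2 + k * prim c (fun z => z ^ (-a / 2) * g z) z ^ 2) := by
  obtain ⟨h1, h2, -⟩ := scale_rpow ha hk
  have := dirichlet_le_of_profile ha (Real.rpow_pos_of_pos hk (-(1 / (2 - a)))) hPR hM hRic hg hu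
  rw [h1, h2, hP0] at this
  rw [inv_mul_eq_div, le_div_iff₀ hδ]
  linarith

/-- The one-dimensional Neumann trace inequality, with a multiplier equal to `δ` at `0`. -/
theorem neumann_trace_le_of_profile {a δ : ℝ} (ha : a < 1) (hδ : 0 < δ) {P R : ℝ → ℝ}
    (hPR : IsProfile P R) {M : ℝ} (hM0 : 0 ≤ M) (hM : ∀ y, 1 < y → P y ≤ M * y ^ (-a / 2))
    (hP0 : P 0 = δ) (hRic : ∀ y, 0 < y → y ≠ 1 → P y ^ 2 - R y ≤ y ^ (-a))
    {k : ℝ} (hk : 0 < k) {c : ℝ} {g q : ℝ → ℝ}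
    (hg : MemLp g 2 (volume.restrict (Ioi 0))) (hq : MemLp q 2 (volume.restrict (Ioi 0)))
    (hgq : ∀ᵐ z ∂(volume.restrict (Ioi (0 : ℝ))), z ^ (a / 2) * g z = prim c q z) :
    k ^ (-((1 - a) / (2 - a))) * c ^ 2 ≤ δ⁻¹ *
      ∫ z in Ioi (0 : ℝ), (g z ^ 2 + k⁻¹ * q z ^ 2) := by
  obtain ⟨h1, -, h2⟩ := scale_rpow ha hk
  have := neumann_le_of_profile ha (Real.rpow_pos_of_pos hk (-(1 / (2 - a)))) hPR hM0 hM hRic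
    hg hq hgq
  rw [h1, h2, hP0] at this
  rw [inv_mul_eq_div, le_div_iff₀ hδ]
  linarith

/-- The one-dimensional Dirichlet trace inequality; the constant is `1` for `a ≤ 0`. -/
theorem exists_dirichlet_trace_le {a : ℝ} (ha : a < 1) : ∃ C : ℝ, 0 < C ∧ (a ≤ 0 → C = 1) ∧
    ∀ (k : ℝ), 0 < k → ∀ (c : ℝ) (g : ℝ → ℝ), MemLp g 2 (volume.restrict (Ioi 0)) →
    MemLp (prim c fun z => z ^ (-a / 2) * g z) 2 (volume.restrict (Ioi 0)) →
    k ^ ((1 - a) / (2 - a)) * c ^ 2 ≤ C *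
      ∫ z in Ioi (0 : ℝ), (g z ^ 2 + k * prim c (fun z => z ^ (-a / 2) * g z) z ^ 2) := by
  have h1a : 0 < 1 - a := by linarith
  rcases le_or_gt a 0 with h0 | h0
  · refine ⟨1⁻¹, by norm_num, fun _ => by norm_num, fun k hk c g hg hu => ?_⟩
    -- The profile is `1 - y + y ^ (1-a) / (1-a)` on `[0, 1]`, so that `R = y ^ (-a) - 1`; as `|P| ≤
    -- 1`, the Riccati inequality holds. The tail exponent `a / 2` makes `P² y ^ (-a)` constant.
    refine dirichlet_trace_le_of_profile (M := 1) ha one_pos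
      (isProfile_affine_rpow (A := 1) (B := -1) (C := 1 / (1 - a)) (c := 1 / (1 - a))
        (d := a / 2) h1a (by ring)) ?_ ?_ ?_ hk hg hu
    · intro y hy
      simp only [not_le.2 hy, if_false]
      have e1 : 1 / (1 - a) ≤ 1 := by rw [div_le_one h1a]; linarith
      have e2 : y ^ (a / 2) ≤ 1 := Real.rpow_le_one_of_one_le_of_nonpos hy.le (by linarith)
      exact mul_le_one₀ e1 (by positivity) e2
    · simp [Real.zero_rpow h1a.ne']
    · intro y hy hy1
      rcases lt_or_gt_of_ne hy1 with hlt | hgt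
      · simp only [hlt.le, if_true]
        have e1 := rpow_le_self_of_le_one hy hlt.le (b := 1 - a) (by linarith)
        have e2 : 0 ≤ y ^ (1 - a) := by positivity
        have e3 : 1 / (1 - a) * y ^ (1 - a) ≤ y := by
          refine le_trans (mul_le_of_le_one_left e2 ?_) e1
          rw [div_le_one h1a]; linarith
        have e4 : 0 ≤ 1 / (1 - a) * y ^ (1 - a) := by positivity
        have e5 : (1 + -1 * y + 1 / (1 - a) * y ^ (1 - a)) ^ 2 ≤ 1 := by
          rw [sq_le_one_iff_abs_le_one, abs_le]
          constructor <;> linarith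
        have e6 : 1 / (1 - a) * ((1 - a) * y ^ (1 - a - 1)) = y ^ (-a) := by
          rw [← mul_assoc, one_div_mul_cancel h1a.ne', one_mul]
          congr 1
          ring
        rw [e6]
        have e7 := mul_le_mul_of_nonneg_right e5 (Real.rpow_nonneg hy.le (-a))
        linarith
      · simp only [not_le.2 hgt, if_false]
        have e1 : (1 / (1 - a) * y ^ (a / 2)) ^ 2 * y ^ (-a) = (1 / (1 - a)) ^ 2 := by
          rw [mul_pow, sq_rpow_half hy, mul_assoc, ← Real.rpow_add hy]
          simp
        have e2 : y ^ (a / 2 - 1) ≤ 1 :=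
          Real.rpow_le_one_of_one_le_of_nonpos hgt.le (by linarith)
        have e3 : 1 / (1 - a) * (-(a / 2) * y ^ (a / 2 - 1)) ≤ 1 / (1 - a) * (-(a / 2) * 1) := by
          refine mul_le_mul_of_nonneg_left (mul_le_mul_of_nonneg_left e2 (by linarith))
            (by positivity)
        have e4 : (1 / (1 - a)) ^ 2 + 1 / (1 - a) * (-(a / 2) * 1) ≤ 1 := by
          rw [← sub_nonneg]
          have : 1 - ((1 / (1 - a)) ^ 2 + 1 / (1 - a) * (-(a / 2) * 1))
            = ((1 - a) ^ 2 - 1 + a / 2 * (1 - a)) / (1 - a) ^ 2 := by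
            field_simp
            ring
          rw [this]
          refine div_nonneg ?_ (sq_nonneg _)
          nlinarith
        rw [e1]
        linarith
  -- For `a > 0` the coefficient `y ^ (-a)` is singular at `0` and `R` must absorb it. With `P ≤ 2δ`
  -- it suffices that the `y ^ (1-a)` term contributes `(2δ)² y ^ (-a)` to `R`, that is `(1-a) δ / 2
  -- = 4δ²`, which fixes `δ`. The linear coefficient makes `P` vanish at `1`.
  · have hδ : 0 < (1 - a) / 8 := by positivity
    set δ := (1 - a) / 8 with hδd
    refine ⟨δ⁻¹, inv_pos.2 hδ, fun h => absurd h (not_le.2 h0), fun k hk c g hg hu => ?_⟩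
    have hd : δ / (1 - a) = 1 / 8 := by rw [hδd]; field_simp
    refine dirichlet_trace_le_of_profile (M := 0) ha hδ
      (isProfile_affine_rpow (A := δ) (B := -(3 / 2 * δ)) (C := 1 / 2 * δ) (c := 0)
        (d := 0) h1a (by ring)) ?_ ?_ ?_ hk hg hu
    · intro y hy
      simp [not_le.2 hy]
    · simp [Real.zero_rpow h1a.ne']
    · intro y hy hy1
      rcases lt_or_gt_of_ne hy1 with hlt | hgt
      · simp only [hlt.le, if_true]
        have e1 := self_le_rpow_of_le_one hy hlt.le (b := 1 - a) (by linarith)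
        have e2 : y ^ (1 - a) ≤ 1 := Real.rpow_le_one hy.le hlt.le h1a.le
        have e3 : 0 ≤ δ + -(3 / 2 * δ) * y + 1 / 2 * δ * y ^ (1 - a) := by nlinarith
        have e4 : δ + -(3 / 2 * δ) * y + 1 / 2 * δ * y ^ (1 - a) ≤ 2 * δ := by nlinarith
        have e5 : (δ + -(3 / 2 * δ) * y + 1 / 2 * δ * y ^ (1 - a)) ^ 2 ≤ (2 * δ) ^ 2 :=
          pow_le_pow_left₀ e3 e4 2
        have e6 : 1 / 2 * δ * ((1 - a) * y ^ (1 - a - 1)) = (2 * δ) ^ 2 * y ^ (-a) := by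
          rw [show 1 - a - 1 = -a by ring, show 1 - a = 8 * δ by rw [hδd]; ring]
          ring
        rw [e6]
        have e7 := mul_le_mul_of_nonneg_right e5 (Real.rpow_nonneg hy.le (-a))
        have e8 : δ ≤ 1 / 8 := by rw [hδd]; linarith
        linarith
      · simp [not_le.2 hgt]

/-- The one-dimensional Neumann trace inequality; the constant is `1` for `0 ≤ a`. -/
theorem exists_neumann_trace_le {a : ℝ} (ha : a < 1) : ∃ C : ℝ, 0 < C ∧ (0 ≤ a → C = 1) ∧
    ∀ (k : ℝ), 0 < k → ∀ (c : ℝ) (g q : ℝ → ℝ), MemLp g 2 (volume.restrict (Ioi 0)) →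
    MemLp q 2 (volume.restrict (Ioi 0)) →
    (∀ᵐ z ∂(volume.restrict (Ioi (0 : ℝ))), z ^ (a / 2) * g z = prim c q z) →
    k ^ (-((1 - a) / (2 - a))) * c ^ 2 ≤ C *
      ∫ z in Ioi (0 : ℝ), (g z ^ 2 + k⁻¹ * q z ^ 2) := by
  have h1a : 0 < 1 - a := by linarith
  rcases le_or_gt 0 a with h0 | h0
  · refine ⟨1⁻¹, by norm_num, fun _ => by norm_num, fun k hk c g q hg hq hgq => ?_⟩
    -- The profile `1 - a y` works because `(1 - a y)² + a ≤ 1 + a (1 - y)`, which is at most `y ^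
    -- (-a)` by Bernoulli's inequality for `y ^ a`. Beyond `1` the tail `y ^ (-a/2)` makes `P²`
    -- proportional to `y ^ (-a)`.
    refine neumann_trace_le_of_profile (M := 1 - a) ha one_pos
      (isProfile_affine_rpow (A := 1) (B := -a) (C := 0) (b := 1) (c := 1 - a)
        (d := -a / 2) one_pos (by ring)) h1a.le ?_ ?_ ?_ hk hg hq hgq
    · intro y hy
      simp only [not_le.2 hy, if_false]
      exact le_rfl
    · simp
    · intro y hy hy1
      rcases lt_or_gt_of_ne hy1 with hlt | hgt
      · simp only [hlt.le, if_true, zero_mul, add_zero]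
        have e1 : y ^ a ≤ 1 + a * (y - 1) := by
          have := _root_.rpow_one_add_le_one_add_mul_self (s := y - 1) (p := a) (by linarith) h0 ha.le
          simpa using this
        have e2 : (1 + -a * y) ^ 2 + a ≤ 1 + a * (1 - y) := by nlinarith [mul_pos hy h1a, mul_nonneg h0 hy.le, mul_nonneg (mul_nonneg h0 hy.le) (by nlinarith : (0 : ℝ) ≤ 1 - a * y)]
        have e3 : 0 < y ^ a := Real.rpow_pos_of_pos hy a
        have e4 : 1 + a * (1 - y) ≤ y ^ (-a) := by
          rw [Real.rpow_neg hy.le, ← one_div, le_div_iff₀ e3]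
          have e5 : 0 ≤ 1 + a * (1 - y) := by nlinarith
          nlinarith [mul_le_mul_of_nonneg_left e1 e5, sq_nonneg (a * (1 - y))]
        linarith
      · simp only [not_le.2 hgt, if_false]
        have e1 : ((1 - a) * y ^ (-a / 2)) ^ 2 = (1 - a) ^ 2 * y ^ (-a) := by
          rw [mul_pow, sq_rpow_half hy]
        have e2 : y ^ (-a / 2 - 1) ≤ y ^ (-a) :=
          Real.rpow_le_rpow_of_exponent_le hgt.le (by linarith)
        have e3 : 0 < y ^ (-a) := Real.rpow_pos_of_pos hy _
        have e4 : (1 - a) * (a / 2 * y ^ (-a / 2 - 1)) ≤ (1 - a) * (a / 2 * y ^ (-a)) :=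
          mul_le_mul_of_nonneg_left (mul_le_mul_of_nonneg_left e2 (by linarith)) h1a.le
        have e5 : 0 ≤ (1 - ((1 - a) ^ 2 + (1 - a) * (a / 2))) * y ^ (-a) := by
          refine mul_nonneg ?_ e3.le
          nlinarith
        rw [e1]
        linarith
  -- For `a < 0` the bound `y ^ (-a)` vanishes at `0`, so `P²` must be cancelled there by `R`. The
  -- slope `4δ²` does this because `P ≤ 2δ`; the power `y ^ (1-a)` brings `P` to zero at `1`, and
  -- this `δ` keeps its contribution `(1/4 + δ) y ^ (-a)` below `y ^ (-a)`.
  · have hδ : 0 < 1 / (4 * (1 - a)) := by positivity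
    set δ := 1 / (4 * (1 - a)) with hδd
    have hδ1 : δ * (1 - a) = 1 / 4 := by rw [hδd]; field_simp
    have hδ2 : δ ≤ 1 / 4 := by nlinarith
    refine ⟨δ⁻¹, inv_pos.2 hδ, fun h => absurd h (not_le.2 h0), fun k hk c g q hg hq hgq => ?_⟩
    refine neumann_trace_le_of_profile (M := 0) ha hδ
      (isProfile_affine_rpow (A := δ) (B := 4 * δ ^ 2) (C := -(δ + 4 * δ ^ 2)) (c := 0)
        (d := 0) h1a (by ring)) le_rfl ?_ ?_ ?_ hk hg hq hgq
    · intro y hy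
      simp [not_le.2 hy]
    · simp [Real.zero_rpow h1a.ne']
    · intro y hy hy1
      rcases lt_or_gt_of_ne hy1 with hlt | hgt
      · simp only [hlt.le, if_true]
        have e1 := rpow_le_self_of_le_one hy hlt.le (b := 1 - a) (by linarith)
        have e2 : 0 ≤ y ^ (1 - a) := by positivity
        have e0 : y ^ (1 - a) ≤ 1 := e1.trans hlt.le
        have e3 : 0 ≤ δ + 4 * δ ^ 2 * y + -(δ + 4 * δ ^ 2) * y ^ (1 - a) := by
          nlinarith [mul_le_mul_of_nonneg_left e0 hδ.le,
            mul_le_mul_of_nonneg_left e1 (sq_nonneg δ)]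
        have e4 : δ + 4 * δ ^ 2 * y + -(δ + 4 * δ ^ 2) * y ^ (1 - a) ≤ 2 * δ := by
          have e41 : 0 ≤ (δ + 4 * δ ^ 2) * y ^ (1 - a) := by positivity
          have e42 : 4 * δ ^ 2 * y ≤ 4 * δ ^ 2 * 1 :=
            mul_le_mul_of_nonneg_left hlt.le (by positivity)
          nlinarith
        have e5 : (δ + 4 * δ ^ 2 * y + -(δ + 4 * δ ^ 2) * y ^ (1 - a)) ^ 2 ≤ (2 * δ) ^ 2 :=
          pow_le_pow_left₀ e3 e4 2
        have e6 : -(δ + 4 * δ ^ 2) * ((1 - a) * y ^ (1 - a - 1))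
            = -((1 / 4 + δ) * y ^ (-a)) := by
          rw [show 1 - a - 1 = -a by ring]
          linear_combination (-(1 + 4 * δ) * y ^ (-a)) * hδ1
        have e7 : 0 ≤ y ^ (-a) := Real.rpow_nonneg hy.le _
        rw [e6]
        nlinarith
      · simp only [not_le.2 hgt, if_false]
        have : 0 ≤ y ^ (-a) := Real.rpow_nonneg hy.le _
        simpa using this

open HorizontalDomain

variable {D : HorizontalDomain}

/-! ### The horizontal domain and the space `V` -/

theorem carrier_convex (D : HorizontalDomain) : Convex ℝ D.carrier := by
  cases D with
  | torus =>
    intro x hx y hy s t hs ht hst j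
    exact convex_Icc (0 : ℝ) (2 * Real.pi) (hx j) (hy j) hs ht hst
  | bounded Ω _ h _ _ => exact h

theorem carrier_measurableSet (D : HorizontalDomain) : MeasurableSet D.carrier := by
  cases D with
  | torus =>
    have : {x : Plane | ∀ j, x j ∈ Icc (0 : ℝ) (2 * Real.pi)}
      = ⋂ j, (fun x : Plane => x j) ⁻¹' Icc (0 : ℝ) (2 * Real.pi) := by ext; simp
    change MeasurableSet {x : Plane | ∀ j, x j ∈ Icc (0 : ℝ) (2 * Real.pi)}
    rw [this]
    exact MeasurableSet.iInter fun j => measurableSet_Icc.preimage (by fun_prop)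
  | bounded Ω h _ _ _ => exact h.measurableSet

/-- A convex set has null frontier. This allows the closed periodic cell and the open domains to be
tested alike, with functions supported in the interior. -/
theorem meas_eq_restrict_interior (D : HorizontalDomain) :
    D.meas = volume.restrict (interior D.carrier) := by
  have h0 := (carrier_convex D).addHaar_frontier (μ := volume)
  exact (Measure.restrict_congr_set (interior_ae_eq_of_null_frontier h0)).symm

theorem ae_mem_carrier (D : HorizontalDomain) : ∀ᵐ x ∂D.meas, x ∈ D.carrier :=
  ae_restrict_mem (carrier_measurableSet D)

/-- Smooth functions with compact support in the interior of `Ω`. -/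
def IsInteriorTest (D : HorizontalDomain) (ψ : Plane → ℝ) : Prop :=
  ContDiff ℝ ∞ ψ ∧ HasCompactSupport ψ ∧ tsupport ψ ⊆ interior D.carrier

theorem memLp_of_continuous {ψ : Plane → ℝ} (hψ : Continuous ψ) : MemLp ψ 2 D.meas :=
  (isLateralTest_zero (D := D)).memLp hψ

theorem continuous_dx {ψ : Plane → ℝ} (hψ : ContDiff ℝ ∞ ψ) (j : Fin 2) : Continuous (dx j ψ) :=
  (hψ.continuous_fderiv (by simp)).clm_apply continuous_const

theorem integral_meas_eq {F : Plane → ℝ} (h : ∀ x, x ∉ interior D.carrier → F x = 0) :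
    ∫ x, F x ∂D.meas = ∫ x, F x := by
  rw [meas_eq_restrict_interior]
  exact setIntegral_eq_integral_of_forall_compl_eq_zero h

theorem IsInteriorTest.eq_zero {ψ : Plane → ℝ} (h : IsInteriorTest D ψ) {x : Plane}
    (hx : x ∉ interior D.carrier) : ψ x = 0 :=
  image_eq_zero_of_notMem_tsupport fun h' => hx (h.2.2 h')

theorem IsInteriorTest.dx_eq_zero {ψ : Plane → ℝ} (h : IsInteriorTest D ψ) (j : Fin 2) {x : Plane}
    (hx : x ∉ interior D.carrier) : dx j ψ x = 0 := by
  have : fderiv ℝ ψ x = 0 :=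
    image_eq_zero_of_notMem_tsupport fun h' => hx (h.2.2 (tsupport_fderiv_subset ℝ h'))
  simp [dx, this]

theorem integral_mul_dx_interior {φ ψ : Plane → ℝ} (hφ : ContDiff ℝ ∞ φ) (h : IsInteriorTest D ψ)
    (j : Fin 2) : ∫ x, φ x * dx j ψ x ∂D.meas = -∫ x, dx j φ x * ψ x ∂D.meas := by
  rw [integral_meas_eq (fun x hx => by rw [h.dx_eq_zero j hx, mul_zero]),
    integral_meas_eq (fun x hx => by rw [h.eq_zero hx, mul_zero])]
  have hc : HasCompactSupport (dx j ψ) := h.2.1.fderiv_apply (𝕜 := ℝ) _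
  refine integral_mul_fderiv_eq_neg_fderiv_mul_of_integrable ?_ ?_ ?_
    (fun x _ => hφ.differentiable (by simp) x) (fun x _ => h.1.differentiable (by simp) x)
  · exact ((continuous_dx hφ j).mul h.1.continuous).integrable_of_hasCompactSupport h.2.1.mul_left
  · exact (hφ.continuous.mul (continuous_dx h.1 j)).integrable_of_hasCompactSupport hc.mul_left
  · exact (hφ.continuous.mul h.1.continuous).integrable_of_hasCompactSupport h.2.1.mul_left

/-- A function in `L²(Ω)` that is orthogonal to the interior test functions vanishes. -/
theorem eq_zero_of_forall_interior {f : D.L2}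
    (h : ∀ ψ, IsInteriorTest D ψ → ∫ x, f x * ψ x ∂D.meas = 0) : f = 0 := by
  have hi : LocallyIntegrableOn f (interior D.carrier) (D.meas) :=
    (((Lp.memLp f).integrable (by norm_num)).locallyIntegrable).locallyIntegrableOn _
  have := IsOpen.ae_eq_zero_of_integral_contDiff_smul_eq_zero (μ := D.meas)
    isOpen_interior hi (fun ψ h1 h2 h3 => by
      simpa [mul_comm] using h ψ ⟨h1, h2, h3⟩)
  have hm : ∀ᵐ x ∂D.meas, x ∈ interior D.carrier := by
    rw [meas_eq_restrict_interior]
    exact ae_restrict_mem isOpen_interior.measurableSet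
  refine (Lp.eq_zero_iff_ae_eq_zero).2 ?_
  filter_upwards [this, hm] with x hx hxm using hx hxm

theorem inner_L2 (f g : D.L2) : inner ℝ f g = ∫ x, f x * g x ∂D.meas := by
  rw [L2.inner_def]
  simp [mul_comm]

theorem inner_toLp (f : D.L2) {ψ : Plane → ℝ} (hψ : MemLp ψ 2 D.meas) :
    inner ℝ f (hψ.toLp ψ) = ∫ x, f x * ψ x ∂D.meas := by
  rw [inner_L2]
  refine integral_congr_ae ?_
  filter_upwards [hψ.coeFn_toLp] with x hx
  rw [hx]

theorem toLp_inner_toLp {φ ψ : Plane → ℝ} (hφ : MemLp φ 2 D.meas) (hψ : MemLp ψ 2 D.meas) :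
    inner ℝ (hφ.toLp φ) (hψ.toLp ψ) = ∫ x, φ x * ψ x ∂D.meas := by
  rw [inner_toLp]
  refine integral_congr_ae ?_
  filter_upwards [hφ.coeFn_toLp] with x hx
  rw [hx]

/-! ### The closed graph of the horizontal gradient -/

variable (D) in
/-- Square integrable horizontal vector fields. -/
abbrev HGrad : Type := PiLp 2 (fun _ : Fin 2 => D.L2)

/-- A lateral test function together with its gradient. -/
def testPair {φ : Plane → ℝ} (h : IsLateralTest D φ) : D.L2 × HGrad D :=
  (h.memLp_self.toLp φ, WithLp.toLp 2 fun j => (h.memLp_dx j).toLp (dx j φ))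

theorem smul_toLp {μ : Measure Plane} {f g : Plane → ℝ} (c : ℝ) (hf : MemLp f 2 μ)
    (hg : MemLp g 2 μ) (h : g = c • f) : c • hf.toLp f = hg.toLp g := by
  subst h
  exact (MemLp.toLp_const_smul c hf).symm

theorem testPair_smul {φ : Plane → ℝ} (c : ℝ) (h : IsLateralTest D φ) :
    c • testPair h = testPair (h.smul c) := by
  refine Prod.ext (smul_toLp c h.memLp_self (h.smul c).memLp_self rfl) ?_
  refine PiLp.ext fun j => ?_
  exact smul_toLp c (h.memLp_dx j) ((h.smul c).memLp_dx j) (dx_smul j c h)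

theorem add_toLp {μ : Measure Plane} {f f' g : Plane → ℝ} (hf : MemLp f 2 μ)
    (hf' : MemLp f' 2 μ) (hg : MemLp g 2 μ) (h : g = f + f') :
    hf.toLp f + hf'.toLp f' = hg.toLp g := by
  subst h
  exact (MemLp.toLp_add hf hf').symm

theorem testPair_add {φ ψ : Plane → ℝ} (h : IsLateralTest D φ) (h' : IsLateralTest D ψ) :
    testPair h + testPair h' = testPair (h.add h') := by
  refine Prod.ext (add_toLp h.memLp_self h'.memLp_self (h.add h').memLp_self rfl) ?_
  refine PiLp.ext fun j => ?_
  exact add_toLp (h.memLp_dx j) (h'.memLp_dx j) ((h.add h').memLp_dx j) (dx_add j h h')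

variable (D) in
/-- The graph of the gradient on the space of lateral test functions. -/
def graphTest : Submodule ℝ (D.L2 × HGrad D) where
  carrier := {p | ∃ φ, ∃ h : IsLateralTest D φ, p = testPair h}
  add_mem' := by
    rintro _ _ ⟨φ, h, rfl⟩ ⟨ψ, h', rfl⟩
    exact ⟨_, _, testPair_add h h'⟩
  zero_mem' := by
    refine ⟨_, (isLateralTest_zero (D := D)).smul 0, ?_⟩
    rw [← testPair_smul 0 isLateralTest_zero, zero_smul]
  smul_mem' := by
    rintro c _ ⟨φ, h, rfl⟩
    exact ⟨_, _, testPair_smul c h⟩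

variable (D) in
/-- The graph of the gradient on the space `V`. -/
def graphV : Submodule ℝ (D.L2 × HGrad D) := (graphTest D).topologicalClosure

theorem testPair_mem {φ : Plane → ℝ} (h : IsLateralTest D φ) : testPair h ∈ graphV D :=
  subset_closure ⟨φ, h, rfl⟩

/-- Closed properties of lateral test functions extend to `V`. -/
theorem graphV_induction {P : D.L2 × HGrad D → Prop} (hc : IsClosed {p | P p})
    (ht : ∀ φ, ∀ h : IsLateralTest D φ, P (testPair h)) {p : D.L2 × HGrad D} (hp : p ∈ graphV D) :
    P p :=
  closure_minimal (t := {p | P p}) (by rintro _ ⟨φ, h, rfl⟩; exact ht φ h) hc hp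

theorem HasLateralGrad.mem_graphV {v : Plane → ℝ} {g : Fin 2 → Plane → ℝ}
    (h : HasLateralGrad D v g) :
    (h.1.toLp v, WithLp.toLp 2 fun j => (h.2.1 j).toLp (g j)) ∈ graphV D := by
  obtain ⟨hv, hg, φ, hφ, h1, h2⟩ := h
  refine mem_closure_of_tendsto (f := fun n => testPair (hφ n)) (b := atTop) ?_
    (Eventually.of_forall fun n => ⟨φ n, hφ n, rfl⟩)
  refine Tendsto.prodMk_nhds ?_ ?_
  · exact (Lp.tendsto_Lp_iff_tendsto_eLpNorm'' φ (fun n => (hφ n).memLp_self) v hv).2 h1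
  · refine ((PiLp.continuous_toLp 2 _).tendsto _).comp (tendsto_pi_nhds.2 fun j => ?_)
    exact (Lp.tendsto_Lp_iff_tendsto_eLpNorm'' _ (fun n => (hφ n).memLp_dx j) _ (hg j)).2 (h2 j)

/-- Closure in the metric space `L² × L²` is sequential, so the closed graph is the same notion as
approximation by lateral tests. The graph form turns density arguments into `graphV_induction`. -/
theorem hasLateralGrad_of_mem {p : D.L2 × HGrad D} (hp : p ∈ graphV D) :
    HasLateralGrad D p.1 (fun j => p.2 j) := by
  obtain ⟨s, hs, hlim⟩ := mem_closure_iff_seq_limit.1 hp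
  choose φ hφ heq using hs
  refine ⟨Lp.memLp _, fun j => Lp.memLp _, φ, hφ, ?_, fun j => ?_⟩
  · have h1 : Tendsto (fun n => (s n).1) atTop (𝓝 p.1) := (continuous_fst.tendsto p).comp hlim
    simp only [heq] at h1
    rw [← (Lp.tendsto_Lp_iff_tendsto_eLpNorm'' φ (fun n => (hφ n).memLp_self) p.1 (Lp.memLp _))]
    simpa [testPair] using h1
  · have h1 : Tendsto (fun n => (s n).2 j) atTop (𝓝 (p.2 j)) :=
      ((PiLp.continuous_apply 2 _ j).tendsto _).comp ((continuous_snd.tendsto p).comp hlim)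
    simp only [heq] at h1
    rw [← (Lp.tendsto_Lp_iff_tendsto_eLpNorm'' _ (fun n => (hφ n).memLp_dx j) _ (Lp.memLp _))]
    simpa [testPair] using h1

theorem memV_iff (w : D.L2) : MemV D w ↔ ∃ G, (w, G) ∈ graphV D := by
  constructor
  · rintro ⟨g, hg⟩
    have := hg.mem_graphV
    rw [Lp.toLp_coeFn] at this
    exact ⟨_, this⟩
  · rintro ⟨G, hG⟩
    exact ⟨_, hasLateralGrad_of_mem hG⟩

/-- Integration by parts against interior test functions, for elements of `V`. -/
theorem graphV_ibp {p : D.L2 × HGrad D} (hp : p ∈ graphV D) {ψ : Plane → ℝ}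
    (h : IsInteriorTest D ψ) (j : Fin 2) :
    ∫ x, p.1 x * dx j ψ x ∂D.meas = -∫ x, p.2 j x * ψ x ∂D.meas := by
  have m1 := memLp_of_continuous (D := D) (continuous_dx h.1 j)
  have m2 := memLp_of_continuous (D := D) h.1.continuous
  rw [← inner_toLp _ m1, ← inner_toLp _ m2]
  refine graphV_induction (P := fun p => inner ℝ p.1 (m1.toLp _) = -inner ℝ (p.2 j) (m2.toLp _))
    (isClosed_eq ?_ ?_) (fun φ hφ => ?_) hp
  · exact continuous_fst.inner continuous_const
  · exact (((PiLp.continuous_apply 2 _ j).comp continuous_snd).inner continuous_const).neg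
  · simp only [testPair, toLp_inner_toLp]
    exact integral_mul_dx_interior hφ.1 h j

/-- The gradient of an element of `V` is unique. -/
theorem graphV_eq_zero {G : HGrad D} (h : ((0 : D.L2), G) ∈ graphV D) : G = 0 := by
  ext1 j
  refine eq_zero_of_forall_interior fun ψ hψ => ?_
  have h1 := graphV_ibp h hψ j
  have h2 : ∫ x, (0 : D.L2) x * dx j ψ x ∂D.meas = 0 := by
    rw [← inner_toLp _ (memLp_of_continuous (D := D) (continuous_dx hψ.1 j)), inner_zero_left]
  simp only at h1
  linarith

/-- The mean-free functions in `L²(Ω)` form a closed subspace. -/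
theorem exists_meanFree_submodule (D : HorizontalDomain) :
    ∃ M : Submodule ℝ D.L2, IsClosed (M : Set D.L2) ∧ ∀ f, f ∈ M ↔ D.MeanFree f := by
  cases D with
  | torus =>
    have m1 : MemLp (fun _ : Plane => (1 : ℝ)) 2 (torus.meas) := memLp_const 1
    refine ⟨LinearMap.ker (innerSL ℝ (m1.toLp _)).toLinearMap, ?_, fun f => ?_⟩
    · exact ContinuousLinearMap.isClosed_ker (innerSL ℝ (m1.toLp _))
    · rw [LinearMap.mem_ker]
      change inner ℝ (m1.toLp _) f = 0 ↔ ∫ x, f x ∂(torus.meas) = 0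
      rw [real_inner_comm, inner_toLp]
      simp
  | bounded Ω h1 h2 h3 h4 => exact ⟨⊤, isClosed_univ, fun f => ⟨fun _ => trivial, fun _ => trivial⟩⟩

theorem meanFree_congr {v w : Plane → ℝ} (h : v =ᵐ[D.meas] w) (hv : D.MeanFree v) :
    D.MeanFree w := by
  cases D with
  | torus =>
    have hv' : ∫ x, v x ∂(torus.meas) = 0 := hv
    change ∫ x, w x ∂(torus.meas) = 0
    rw [← hv']
    exact integral_congr_ae h.symm
  | bounded Ω h1 h2 h3 h4 => trivial

theorem meanFree_of_mem_graphV {p : D.L2 × HGrad D} (hp : p ∈ graphV D) : D.MeanFree p.1 := by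
  obtain ⟨M, hM, hMf⟩ := exists_meanFree_submodule D
  rw [← hMf]
  refine graphV_induction (P := fun p => p.1 ∈ M) (hM.preimage continuous_fst) (fun φ hφ => ?_) hp
  rw [hMf]
  exact meanFree_congr hφ.memLp_self.coeFn_toLp.symm hφ.2.2

/-- The Cauchy–Schwarz inequality for integrals. -/
theorem sq_integral_mul_le {α : Type*} {m : MeasurableSpace α} {μ : Measure α} {f g : α → ℝ}
    (hf : MemLp f 2 μ) (hg : MemLp g 2 μ) :
    (∫ x, f x * g x ∂μ) ^ 2 ≤ (∫ x, f x ^ 2 ∂μ) * ∫ x, g x ^ 2 ∂μ := by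
  have key : ∀ {f g : α → ℝ} (hf : MemLp f 2 μ) (hg : MemLp g 2 μ),
      inner ℝ (hf.toLp f) (hg.toLp g) = ∫ x, f x * g x ∂μ := by
    intro f g hf hg
    rw [L2.inner_def]
    refine integral_congr_ae ?_
    filter_upwards [hf.coeFn_toLp, hg.coeFn_toLp] with x h1 h2
    rw [h1, h2]
    simp [mul_comm]
  have := real_inner_mul_inner_self_le (hf.toLp f) (hg.toLp g)
  rw [key, key, key] at this
  simpa only [sq] using this

/-! ### The Poincaré inequality -/

theorem IsLateralTest.isInteriorTest {Ω : Set Plane} {h1 : IsOpen Ω} {h2 : Convex ℝ Ω}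
    {h3 : Bornology.IsBounded Ω} {h4 : Ω.Nonempty} {φ : Plane → ℝ}
    (h : IsLateralTest (bounded Ω h1 h2 h3 h4) φ) : IsInteriorTest (bounded Ω h1 h2 h3 h4) φ := by
  obtain ⟨hs, ⟨K, hK, hKΩ, h0⟩, -⟩ := h
  have hsub : tsupport φ ⊆ K := closure_minimal (fun x hx => by
    by_contra hn
    exact hx (h0 () x hn)) hK.isClosed
  refine ⟨hs, hK.of_isClosed_subset (isClosed_tsupport _) hsub, (hsub.trans hKΩ).trans ?_⟩
  exact h1.interior_eq.symm.subset

/-- Since `∂₀ x₀ = 1`, integration by parts gives `∫ φ² = -∫ 2 x₀ φ ∂₀φ`. Absorbing half of `∫ φ²`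
and using `|x₀| ≤ r` on `Ω` yields the constant `2r`. -/
theorem poincare_bounded {Ω : Set Plane} {h1 : IsOpen Ω} {h2 : Convex ℝ Ω}
    {h3 : Bornology.IsBounded Ω} {h4 : Ω.Nonempty} :
    ∃ C : ℝ, 0 ≤ C ∧ ∀ φ, IsLateralTest (bounded Ω h1 h2 h3 h4) φ →
      ∫ x, φ x ^ 2 ∂(bounded Ω h1 h2 h3 h4).meas
        ≤ C ^ 2 * ∫ x, ∑ j, dx j φ x ^ 2 ∂(bounded Ω h1 h2 h3 h4).meas := by
  set D := bounded Ω h1 h2 h3 h4 with hD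
  obtain ⟨r, hr⟩ := h3.exists_norm_le
  obtain ⟨x₀, hx₀⟩ := h4
  have hr0 : 0 ≤ r := (norm_nonneg x₀).trans (hr x₀ hx₀)
  refine ⟨2 * r, by positivity, fun φ hφ => ?_⟩
  have hi := hφ.isInteriorTest
  have hd : ∀ x, DifferentiableAt ℝ φ x := fun x => hφ.1.differentiable (by simp) x
  have hsq : IsInteriorTest D (fun x => φ x ^ 2) := by
    refine ⟨hφ.1.pow 2, ?_, ?_⟩
    · exact hi.2.1.comp_left (g := fun y : ℝ => y ^ 2) (by simp)
    · refine (closure_mono fun x hx => ?_).trans hi.2.2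
      intro h
      exact hx (by simp [h])
  have hp : ContDiff ℝ ∞ fun x : Plane => x 0 := by fun_prop
  have e1 := integral_mul_dx_interior hp hsq 0
  have e2 : ∀ x, dx 0 (fun x => φ x ^ 2) x = 2 * φ x * dx 0 φ x := fun x => by
    simp only [dx]
    rw [fderiv_fun_pow 2 (hd x)]
    simp
  have e3 : ∀ x, dx 0 (fun x : Plane => x 0) x = 1 := fun x => by
    have : HasFDerivAt (fun x : Plane => x 0) (EuclideanSpace.proj (𝕜 := ℝ) (0 : Fin 2)) x :=
      (EuclideanSpace.proj (𝕜 := ℝ) (0 : Fin 2)).hasFDerivAt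
    simp [dx, this.fderiv]
  simp only [e2, e3, one_mul] at e1
  have m1 : MemLp φ 2 D.meas := hφ.memLp_self
  have m2 : ∀ j, MemLp (dx j φ) 2 D.meas := hφ.memLp_dx
  have e4 : ∫ x, φ x ^ 2 ∂D.meas
      ≤ ∫ x, (1 / 2 * φ x ^ 2 + 2 * r ^ 2 * ∑ j, dx j φ x ^ 2) ∂D.meas := by
    rw [show ∫ x, φ x ^ 2 ∂D.meas = ∫ x, -(x 0 * (2 * φ x * dx 0 φ x)) ∂D.meas by
      rw [integral_neg, e1, neg_neg]]
    have hc : MemLp (fun x : Plane => -(x 0 * (2 * φ x * dx 0 φ x))) 2 D.meas :=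
      memLp_of_continuous (by
        have := continuous_dx hφ.1 0
        have := hφ.1.continuous
        fun_prop)
    refine integral_mono_ae (hc.integrable (by norm_num)) ((m1.integrable_sq.const_mul _).add
      ((integrable_finsetSum _ fun j _ => (m2 j).integrable_sq).const_mul _)) ?_
    filter_upwards [ae_mem_carrier D] with x hx
    have hx0 : |x 0| ≤ r := (PiLp.norm_apply_le x 0).trans (hr x hx)
    have hx1 : x 0 ^ 2 ≤ r ^ 2 := sq_le_sq' (by linarith [neg_abs_le (x 0)])
      ((le_abs_self _).trans hx0)
    simp only [Fin.sum_univ_two]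
    have h5 : -(x 0 * (2 * φ x * dx 0 φ x)) ≤ 1 / 2 * φ x ^ 2 + 2 * x 0 ^ 2 * dx 0 φ x ^ 2 := by
      nlinarith [sq_nonneg (φ x + 2 * x 0 * dx 0 φ x)]
    have h6 : x 0 ^ 2 * dx 0 φ x ^ 2 ≤ r ^ 2 * dx 0 φ x ^ 2 :=
      mul_le_mul_of_nonneg_right hx1 (sq_nonneg _)
    have h7 : 0 ≤ r ^ 2 * dx 1 φ x ^ 2 := by positivity
    linarith
  rw [integral_add (m1.integrable_sq.const_mul _)
    ((integrable_finsetSum _ fun j _ => (m2 j).integrable_sq).const_mul _),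
    integral_const_mul, integral_const_mul] at e4
  linarith

/-- The measure on a side of the periodic cell. -/
def sideMeas : Measure ℝ := volume.restrict (Icc 0 (2 * Real.pi))

instance : IsFiniteMeasure sideMeas := by unfold sideMeas; infer_instance

theorem sideMeas_real_univ : sideMeas.real univ = 2 * Real.pi := by
  simp [sideMeas, Measure.real, Real.pi_pos.le]

/-- The point of the plane with given coordinates. -/
def pt (p : ℝ × ℝ) : Plane :=
  p.1 • EuclideanSpace.single 0 1 + p.2 • EuclideanSpace.single 1 1

theorem continuous_pt : Continuous pt := by unfold pt; fun_prop

theorem measurePreserving_pt : MeasurePreserving pt (sideMeas.prod sideMeas) torus.meas := by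
  have h1 := ((EuclideanSpace.volume_preserving_symm_measurableEquiv_toLp (Fin 2)).symm).comp
    (volume_preserving_finTwoArrow ℝ).symm
  have h2 : pt = (MeasurableEquiv.toLp 2 (Fin 2 → ℝ)) ∘ MeasurableEquiv.finTwoArrow.symm := by
    ext p j
    fin_cases j <;> simp [pt]
  have h3 : MeasurePreserving pt volume volume := by
    rw [h2]; exact h1
  have h4 := h3.restrict_preimage (carrier_measurableSet torus)
  have h5 : pt ⁻¹' (torus.carrier) = Icc 0 (2 * Real.pi) ×ˢ Icc 0 (2 * Real.pi) := by
    ext p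
    simp [carrier, pt, Fin.forall_fin_two, -Icc_prod_Icc]
  rw [h5, Measure.volume_eq_prod, ← Measure.prod_restrict] at h4
  exact h4

theorem hasDerivAt_pt_fst {φ : Plane → ℝ} (hφ : ContDiff ℝ ∞ φ) (s t : ℝ) :
    HasDerivAt (fun s => φ (pt (s, t))) (dx 0 φ (pt (s, t))) s := by
  have h1 : HasDerivAt (fun s => pt (s, t)) (EuclideanSpace.single 0 1) s := by
    simpa [pt] using ((hasDerivAt_id s).smul_const (EuclideanSpace.single (0 : Fin 2) (1 : ℝ))).add_const
      (t • EuclideanSpace.single (1 : Fin 2) (1 : ℝ))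
  exact (hφ.differentiable (by simp) (pt (s, t))).hasFDerivAt.comp_hasDerivAt s h1

theorem hasDerivAt_pt_snd {φ : Plane → ℝ} (hφ : ContDiff ℝ ∞ φ) (s t : ℝ) :
    HasDerivAt (fun t => φ (pt (s, t))) (dx 1 φ (pt (s, t))) t := by
  have h1 : HasDerivAt (fun t => pt (s, t)) (EuclideanSpace.single 1 1) t := by
    simpa [pt] using ((hasDerivAt_id t).smul_const (EuclideanSpace.single (1 : Fin 2) (1 : ℝ))).const_add
      (s • EuclideanSpace.single (0 : Fin 2) (1 : ℝ))
  exact (hφ.differentiable (by simp) (pt (s, t))).hasFDerivAt.comp_hasDerivAt t h1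

theorem memLp_sideMeas {h : ℝ → ℝ} (hc : Continuous h) : MemLp h 2 sideMeas := by
  obtain ⟨M, hM⟩ := (isCompact_Icc (a := (0 : ℝ)) (b := 2 * Real.pi)).exists_bound_of_continuousOn
    hc.continuousOn
  exact MemLp.of_bound hc.aestronglyMeasurable M
    ((ae_restrict_mem measurableSet_Icc).mono fun x hx => hM x hx)

/-- The fundamental theorem of calculus and the Cauchy–Schwarz inequality on an interval of length
`2π`. -/
theorem sq_sub_le_integral_deriv_sq {h h' : ℝ → ℝ} (hd : ∀ s, HasDerivAt h (h' s) s)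
    (hc : Continuous h') {s t : ℝ} (hs : s ∈ Icc 0 (2 * Real.pi)) (ht : t ∈ Icc 0 (2 * Real.pi)) :
    (h s - h t) ^ 2 ≤ 2 * Real.pi * ∫ r, h' r ^ 2 ∂sideMeas := by
  have m1 : MemLp h' 2 sideMeas := memLp_sideMeas hc
  have e1 : h s - h t = ∫ r in t..s, h' r :=
    (intervalIntegral.integral_eq_sub_of_hasDerivAt (fun x _ => hd x)
      (hc.intervalIntegrable _ _)).symm
  have e2 : |h s - h t| ≤ ∫ r, |h' r| ∂sideMeas := by
    rw [e1]
    refine (intervalIntegral.norm_integral_le_integral_norm_uIoc (f := h') (μ := volume)).trans ?_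
    refine setIntegral_mono_set (m1.integrable (by norm_num)).norm
      (Eventually.of_forall fun r => norm_nonneg _) (LE.le.eventuallyLE ?_)
    exact uIoc_subset_uIcc.trans (uIcc_subset_Icc ht hs)
  have e3 := sq_integral_mul_le (memLp_const (1 : ℝ)) m1.norm
  simp only [one_mul, one_pow, integral_const, smul_eq_mul, mul_one, sideMeas_real_univ,
    Real.norm_eq_abs, sq_abs] at e3
  refine le_trans ?_ e3
  rw [← sq_abs]
  exact pow_le_pow_left₀ (abs_nonneg _) e2 2

theorem integrable_sideMeas_prod {F : ℝ × ℝ → ℝ} (hF : Continuous F) :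
    Integrable F (sideMeas.prod sideMeas) := by
  unfold sideMeas
  rw [Measure.prod_restrict]
  exact hF.continuousOn.integrableOn_compact (isCompact_Icc.prod isCompact_Icc)

theorem ae_mem_side : ∀ᵐ s ∂sideMeas, s ∈ Icc 0 (2 * Real.pi) := ae_restrict_mem measurableSet_Icc

theorem ae_mem_side_prod : ∀ᵐ p ∂(sideMeas.prod sideMeas),
    p.1 ∈ Icc 0 (2 * Real.pi) ∧ p.2 ∈ Icc 0 (2 * Real.pi) := by
  filter_upwards [Measure.quasiMeasurePreserving_fst.ae ae_mem_side,
    Measure.quasiMeasurePreserving_snd.ae ae_mem_side] with p h1 h2 using ⟨h1, h2⟩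

/-- Two points of the cell are joined by a horizontal and a vertical segment, so `|φ(p) - φ(p')|²`
is controlled by line integrals of `|∂₀φ|²` and `|∂₁φ|²`. Averaging over both points removes the
cross term because `φ` has zero mean; periodicity plays no role. -/
theorem poincare_torus : ∃ C : ℝ, 0 ≤ C ∧ ∀ φ, IsLateralTest torus φ →
    ∫ x, φ x ^ 2 ∂torus.meas ≤ C ^ 2 * ∫ x, ∑ j, dx j φ x ^ 2 ∂torus.meas := by
  have hL : 0 < 2 * Real.pi := by positivity
  refine ⟨2 * (2 * Real.pi), by positivity, fun φ hφ => ?_⟩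
  set L := 2 * Real.pi with hLd
  have hu := sideMeas_real_univ
  have hc0 : Continuous fun p => φ (pt p) := hφ.1.continuous.comp continuous_pt
  have hc1 : ∀ j, Continuous fun p => dx j φ (pt p) := fun j =>
    (continuous_dx hφ.1 j).comp continuous_pt
  have htr : ∀ F : Plane → ℝ, Continuous F →
      ∫ x, F x ∂torus.meas = ∫ p, F (pt p) ∂(sideMeas.prod sideMeas) := fun F hF => by
    rw [← measurePreserving_pt.map_eq]
    exact integral_map continuous_pt.aemeasurable hF.aestronglyMeasurable
  have hmean : ∫ p, φ (pt p) ∂(sideMeas.prod sideMeas) = 0 := by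
    rw [← htr φ hφ.1.continuous]; exact hφ.2.2
  have ii : ∀ j, Integrable (fun p => dx j φ (pt p) ^ 2) (sideMeas.prod sideMeas) := fun j =>
    integrable_sideMeas_prod ((hc1 j).pow 2)
  set I : Fin 2 → ℝ := fun j => ∫ p, dx j φ (pt p) ^ 2 ∂(sideMeas.prod sideMeas) with hI
  set A : ℝ → ℝ := fun t => L * ∫ r, dx 0 φ (pt (r, t)) ^ 2 ∂sideMeas with hA
  set B : ℝ → ℝ := fun s => L * ∫ r, dx 1 φ (pt (s, r)) ^ 2 ∂sideMeas with hB
  have iA : Integrable A sideMeas := ((ii 0).integral_prod_right).const_mul L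
  have iB : Integrable B sideMeas := ((ii 1).integral_prod_left).const_mul L
  have eA : ∫ t, A t ∂sideMeas = L * I 0 := by
    rw [hA, integral_const_mul]
    simp only [hI]
    rw [integral_prod_symm _ (ii 0)]
  have eB : ∫ s, B s ∂sideMeas = L * I 1 := by
    rw [hB, integral_const_mul]
    simp only [hI]
    rw [integral_prod _ (ii 1)]
  have hdiff : ∀ s t s' t', s ∈ Icc 0 L → t ∈ Icc 0 L → s' ∈ Icc 0 L → t' ∈ Icc 0 L →
      (φ (pt (s, t)) - φ (pt (s', t'))) ^ 2 ≤ 2 * A t + 2 * B s' := by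
    intro s t s' t' hs ht hs' ht'
    have e1 : (φ (pt (s, t)) - φ (pt (s', t))) ^ 2 ≤ A t :=
      sq_sub_le_integral_deriv_sq (fun s => hasDerivAt_pt_fst hφ.1 s t)
        ((hc1 0).comp (by fun_prop : Continuous fun s : ℝ => (s, t))) hs hs'
    have e2 : (φ (pt (s', t)) - φ (pt (s', t'))) ^ 2 ≤ B s' :=
      sq_sub_le_integral_deriv_sq (fun t => hasDerivAt_pt_snd hφ.1 s' t)
        ((hc1 1).comp (by fun_prop : Continuous fun t : ℝ => (s', t))) ht ht'
    nlinarith [sq_nonneg ((φ (pt (s, t)) - φ (pt (s', t))) - (φ (pt (s', t)) - φ (pt (s', t'))))]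
  have hu2 : (sideMeas.prod sideMeas).real univ = L * L := by
    rw [← univ_prod_univ, measureReal_prod_prod, hu]
  have iΦ : Integrable (fun p => φ (pt p)) (sideMeas.prod sideMeas) := integrable_sideMeas_prod hc0
  have iΦ2 : Integrable (fun p => φ (pt p) ^ 2) (sideMeas.prod sideMeas) :=
    integrable_sideMeas_prod (hc0.pow 2)
  have iB' : Integrable (fun p : ℝ × ℝ => B p.1) (sideMeas.prod sideMeas) := iB.comp_fst _
  have iA' : Integrable (fun p : ℝ × ℝ => A p.2) (sideMeas.prod sideMeas) := iA.comp_snd _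
  have eB' : ∫ p : ℝ × ℝ, B p.1 ∂(sideMeas.prod sideMeas) = L * (L * I 1) := by
    rw [integral_fun_fst, eB, hu, smul_eq_mul]
  have eA' : ∫ p : ℝ × ℝ, A p.2 ∂(sideMeas.prod sideMeas) = L * (L * I 0) := by
    rw [integral_fun_snd, eA, hu, smul_eq_mul]
  -- Integration over the second point `p'`: the cross term vanishes by zero mean, and the
  -- nonnegative `∫ φ²` is dropped.
  have step1 : ∀ p : ℝ × ℝ, p.1 ∈ Icc 0 L → p.2 ∈ Icc 0 L →
      L * L * φ (pt p) ^ 2 ≤ L * L * (2 * A p.2) + 2 * (L * (L * I 1)) := by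
    intro p hp1 hp2
    have i1 : Integrable (fun p' => φ (pt p) ^ 2 - 2 * φ (pt p) * φ (pt p'))
        (sideMeas.prod sideMeas) := (integrable_const _).sub (iΦ.const_mul _)
    have h := integral_mono_ae (i1.add iΦ2) ((integrable_const (2 * A p.2)).add (iB'.const_mul 2))
      (by
        filter_upwards [ae_mem_side_prod] with p' hp'
        have := hdiff p.1 p.2 p'.1 p'.2 hp1 hp2 hp'.1 hp'.2
        simp only [Pi.add_apply]
        simp only [Prod.mk.eta] at this
        linarith)
    simp only [Pi.add_apply] at h
    rw [integral_add i1 iΦ2, integral_sub (integrable_const _) (iΦ.const_mul _),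
      integral_add (integrable_const _) (iB'.const_mul 2)] at h
    simp only [integral_const_mul, integral_const, hu2, hmean, eB'] at h
    have h0 : 0 ≤ ∫ p, φ (pt p) ^ 2 ∂(sideMeas.prod sideMeas) :=
      integral_nonneg fun p => sq_nonneg _
    simp only [smul_eq_mul] at h
    linarith
  have step2 := integral_mono_ae (iΦ2.const_mul (L * L))
    (((iA'.const_mul 2).const_mul (L * L)).add (integrable_const (2 * (L * (L * I 1))))) (by
      filter_upwards [ae_mem_side_prod] with p hp using step1 p hp.1 hp.2)
  simp only [Pi.add_apply] at step2
  rw [integral_add ((iA'.const_mul 2).const_mul (L * L)) (integrable_const _),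
    integral_const_mul, integral_const_mul, integral_const_mul, integral_const, hu2, eA',
    smul_eq_mul] at step2
  have hLL : 0 < L * L := by positivity
  have step3 : ∫ p, φ (pt p) ^ 2 ∂(sideMeas.prod sideMeas) ≤ 2 * (L * L) * (I 0 + I 1) := by
    refine le_of_mul_le_mul_left ?_ hLL
    linarith
  rw [htr (fun x => φ x ^ 2) (hφ.1.continuous.pow 2), htr (fun x => ∑ j, dx j φ x ^ 2)
    (continuous_finsetSum _ fun j _ => (continuous_dx hφ.1 j).pow 2)]
  simp only [Fin.sum_univ_two]
  rw [integral_add (ii 0) (ii 1)]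
  have hI0 : 0 ≤ I 0 + I 1 :=
    add_nonneg (integral_nonneg fun p => sq_nonneg _) (integral_nonneg fun p => sq_nonneg _)
  refine step3.trans ?_
  change 2 * (L * L) * (I 0 + I 1) ≤ (2 * L) ^ 2 * (I 0 + I 1)
  nlinarith [mul_nonneg hLL.le hI0]

theorem exists_poincare_test (D : HorizontalDomain) : ∃ C : ℝ, 0 ≤ C ∧ ∀ φ, IsLateralTest D φ →
    ∫ x, φ x ^ 2 ∂D.meas ≤ C ^ 2 * ∫ x, ∑ j, dx j φ x ^ 2 ∂D.meas := by
  cases D with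
  | torus => exact poincare_torus
  | bounded Ω h1 h2 h3 h4 => exact poincare_bounded

/-- The Poincaré inequality on `V`. -/
theorem exists_poincare (D : HorizontalDomain) : ∃ C : ℝ, 0 ≤ C ∧ ∀ p ∈ graphV D,
    ‖p.1‖ ^ 2 ≤ C ^ 2 * ‖p.2‖ ^ 2 := by
  obtain ⟨C, hC, h⟩ := exists_poincare_test D
  refine ⟨C, hC, fun p hp => ?_⟩
  refine graphV_induction (P := fun p => ‖p.1‖ ^ 2 ≤ C ^ 2 * ‖p.2‖ ^ 2)
    (isClosed_le (by fun_prop) (by fun_prop)) (fun φ hφ => ?_) hp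
  have e1 := h φ hφ
  simp only [testPair, ← real_inner_self_eq_norm_sq, PiLp.inner_apply, toLp_inner_toLp, ← sq]
  rwa [← integral_finsetSum _ fun j _ => (hφ.memLp_dx j).integrable_sq]

/-! ### Expansions in eigenfunctions -/

theorem summable_smul_of_orthonormal {E : Type*} [NormedAddCommGroup E] [InnerProductSpace ℝ E]
    [CompleteSpace E] {v : ℕ → E} (hv : Orthonormal ℝ v) {c : ℕ → ℝ}
    (hc : Summable fun i => c i ^ 2) : Summable fun i => c i • v i := by
  refine (hv.orthogonalFamily.summable_iff_norm_sq_summable c).2 ?_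
  simpa using hc

theorem summable_inner_sq {E : Type*} [NormedAddCommGroup E] [InnerProductSpace ℝ E]
    {v : ℕ → E} (hv : Orthonormal ℝ v) (x : E) : Summable fun i => inner ℝ (v i) x ^ 2 := by
  simpa using hv.inner_products_summable x

theorem inner_hasSum_smul {E : Type*} [NormedAddCommGroup E] [InnerProductSpace ℝ E]
    {v : ℕ → E} (hv : Orthonormal ℝ v) {c : ℕ → ℝ} {y : E} (h : HasSum (fun i => c i • v i) y)
    (i : ℕ) : inner ℝ (v i) y = c i := by
  have h1 := h.mapL (innerSL ℝ (v i))
  refine h1.unique ?_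
  simp only [innerSL_apply_apply, inner_smul_right, orthonormal_iff_ite.1 hv]
  refine (hasSum_ite_eq i (c i)).congr_fun fun j => ?_
  rcases eq_or_ne i j with rfl | h <;> simp_all [eq_comm]

section Eigen

variable {e : ℕ → D.L2} {k : ℕ → ℝ}

/-- The eigenvalue equation is given against smooth tests only; both sides are continuous for the
graph norm, so it extends to all of `V`, in particular to the eigenfunctions themselves. -/
theorem IsEigenbasis.exists_grad (hE : IsEigenbasis D e k) (i : ℕ) : ∃ G : HGrad D,
    (e i, G) ∈ graphV D ∧ ∀ p ∈ graphV D, inner ℝ G p.2 = k i * inner ℝ (e i) p.1 := by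
  obtain ⟨g, hg, heig⟩ := hE.eigen i
  have hm := hg.mem_graphV
  rw [Lp.toLp_coeFn] at hm
  refine ⟨_, hm, fun p hp => ?_⟩
  refine graphV_induction (P := fun p => inner ℝ (WithLp.toLp 2 fun j => (hg.2.1 j).toLp (g j)) p.2
    = k i * inner ℝ (e i) p.1) (isClosed_eq ?_ ?_) (fun φ hφ => ?_) hp
  · exact continuous_const.inner continuous_snd
  · exact (continuous_const.inner continuous_fst).const_smul (k i)
  · have h1 : ∑ j, inner ℝ ((hg.2.1 j).toLp (g j)) ((hφ.memLp_dx j).toLp (dx j φ))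
        = ∑ j, ∫ x, g j x * dx j φ x ∂D.meas :=
      Finset.sum_congr rfl fun j _ => toLp_inner_toLp _ _
    simp only [testPair, PiLp.inner_apply]
    rw [h1, inner_toLp, ← heig φ hφ, integral_finsetSum]
    exact fun j _ => (hg.2.1 j).integrable_mul (hφ.memLp_dx j)

/-- The gradients of the eigenfunctions. -/
def IsEigenbasis.grad (hE : IsEigenbasis D e k) (i : ℕ) : HGrad D := (hE.exists_grad i).choose

theorem IsEigenbasis.grad_mem (hE : IsEigenbasis D e k) (i : ℕ) :
    (e i, hE.grad i) ∈ graphV D := (hE.exists_grad i).choose_spec.1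

theorem IsEigenbasis.inner_grad (hE : IsEigenbasis D e k) (i : ℕ) {p : D.L2 × HGrad D}
    (hp : p ∈ graphV D) : inner ℝ (hE.grad i) p.2 = k i * inner ℝ (e i) p.1 :=
  (hE.exists_grad i).choose_spec.2 p hp

theorem IsEigenbasis.norm_grad_sq (hE : IsEigenbasis D e k) (i : ℕ) :
    ‖hE.grad i‖ ^ 2 = k i := by
  have h1 := hE.inner_grad i (hE.grad_mem i)
  rw [← real_inner_self_eq_norm_sq, h1, real_inner_self_eq_norm_sq, hE.orthonormal.1 i]
  ring

/-- Poincaré's inequality for `e_i` reads `1 ≤ C² k_i`. -/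
theorem IsEigenbasis.k_pos (hE : IsEigenbasis D e k) (i : ℕ) : 0 < k i := by
  obtain ⟨C, hC, h⟩ := exists_poincare D
  have h1 := h _ (hE.grad_mem i)
  simp only [hE.orthonormal.1 i, hE.norm_grad_sq] at h1
  by_contra hn
  nlinarith [mul_nonneg (sq_nonneg C) (sub_nonneg.2 (not_lt.1 hn))]

theorem sq_norm_toLp {v : Plane → ℝ} (hv : MemLp v 2 D.meas) :
    ‖hv.toLp v‖ ^ 2 = ∫ x, v x ^ 2 ∂D.meas := by
  rw [← real_inner_self_eq_norm_sq, toLp_inner_toLp]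
  simp [sq]

theorem sq_norm_grad_toLp {g : Fin 2 → Plane → ℝ} (hg : ∀ j, MemLp (g j) 2 D.meas) :
    ‖(WithLp.toLp 2 fun j => (hg j).toLp (g j) : HGrad D)‖ ^ 2 = ∫ x, ∑ j, g j x ^ 2 ∂D.meas := by
  rw [← real_inner_self_eq_norm_sq]
  simp only [PiLp.inner_apply, toLp_inner_toLp, ← sq]
  rw [integral_finsetSum _ fun j _ => (hg j).integrable_sq]

theorem poincareConst_nonneg (D : HorizontalDomain) : 0 ≤ poincareConst D :=
  Real.sInf_nonneg fun _ h => h.1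

/-- Testing with `e_i` shows that every admissible Poincaré constant is at least `k_i ^ (-1/2)`.
Passing to the infimum requires some admissible constant to exist, which is the content of
`exists_poincare`. -/
theorem IsEigenbasis.inv_k_le (hE : IsEigenbasis D e k) (i : ℕ) :
    (k i)⁻¹ ≤ poincareConst D ^ 2 := by
  have hk := hE.k_pos i
  have h1 : √((k i)⁻¹) ≤ poincareConst D := by
    refine le_csInf ?_ ?_
    · obtain ⟨C, hC, h⟩ := exists_poincare D
      refine ⟨C, hC, fun v g hvg => ?_⟩
      have := h _ hvg.mem_graphV
      simp only [sq_norm_toLp, sq_norm_grad_toLp] at this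
      exact this
    · rintro C ⟨hC, h⟩
      rw [Real.sqrt_le_left hC, inv_le_iff_one_le_mul₀ hk]
      have h2 := hasLateralGrad_of_mem (hE.grad_mem i)
      have h3 := h _ _ h2
      rw [← sq_norm_toLp h2.1, ← sq_norm_grad_toLp h2.2.1] at h3
      simp only [Lp.toLp_coeFn, hE.orthonormal.1 i] at h3
      have h4 : ‖(WithLp.toLp 2 fun j => (hE.grad i) j : HGrad D)‖ ^ 2 = k i := hE.norm_grad_sq i
      rw [h4] at h3
      linarith
  calc (k i)⁻¹ = √((k i)⁻¹) ^ 2 := (Real.sq_sqrt (by positivity)).symm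
    _ ≤ poincareConst D ^ 2 := pow_le_pow_left₀ (Real.sqrt_nonneg _) h1 2

/-- Bessel's inequality makes the series converge. Its sum is again mean-free, as these functions
form a closed subspace, so completeness applies to the remainder. -/
theorem IsEigenbasis.hasSum (hE : IsEigenbasis D e k) {f : D.L2} (hf : D.MeanFree f) :
    HasSum (fun i => inner ℝ (e i) f • e i) f := by
  obtain ⟨M, hM, hMf⟩ := exists_meanFree_submodule D
  obtain ⟨y, hy⟩ := summable_smul_of_orthonormal hE.orthonormal
    (summable_inner_sq hE.orthonormal f)
  have hyM : y ∈ M := hM.mem_of_tendsto hy (Eventually.of_forall fun s =>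
    M.sum_mem fun i _ => M.smul_mem _ ((hMf _).2 (hE.meanFree i)))
  have h0 : y = f := by
    refine (sub_eq_zero.1 ?_).symm
    refine hE.complete _ ((hMf _).1 (M.sub_mem ((hMf _).2 hf) hyM)) fun i => ?_
    rw [inner_sub_right, inner_hasSum_smul hE.orthonormal hy, sub_self]
  rwa [h0] at hy

/-- Parseval's identity in `L²(Ω)`. -/
theorem IsEigenbasis.hasSum_inner (hE : IsEigenbasis D e k) {f : D.L2} (hf : D.MeanFree f)
    (g : D.L2) : HasSum (fun i => inner ℝ (e i) f * inner ℝ (e i) g) (inner ℝ f g) := by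
  have h := (hE.hasSum hf).mapL (innerSL ℝ g)
  simp only [innerSL_apply_apply, inner_smul_right] at h
  rw [real_inner_comm]
  refine h.congr_fun fun i => ?_
  rw [real_inner_comm g]

/-- The normalised gradients of the eigenfunctions. -/
def IsEigenbasis.ngrad (hE : IsEigenbasis D e k) (i : ℕ) : HGrad D := (√(k i))⁻¹ • hE.grad i

theorem IsEigenbasis.orthonormal_ngrad (hE : IsEigenbasis D e k) : Orthonormal ℝ hE.ngrad := by
  rw [orthonormal_iff_ite]
  intro i j
  have h1 := hE.inner_grad i (hE.grad_mem j)
  simp only [orthonormal_iff_ite.1 hE.orthonormal] at h1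
  simp only [ngrad, inner_smul_left, inner_smul_right, h1]
  split_ifs with h
  · subst h
    have hk := hE.k_pos i
    have h2 := Real.mul_self_sqrt hk.le
    have h3 : √(k i) ≠ 0 := (Real.sqrt_pos.2 hk).ne'
    simp only [conj_trivial]
    field_simp
    rw [sq, h2]
  · simp

theorem IsEigenbasis.inner_ngrad_smul (hE : IsEigenbasis D e k) (i : ℕ) {p : D.L2 × HGrad D}
    (hp : p ∈ graphV D) :
    inner ℝ (hE.ngrad i) p.2 • hE.ngrad i = inner ℝ (e i) p.1 • hE.grad i := by
  have hk := hE.k_pos i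
  have h2 := Real.mul_self_sqrt hk.le
  have h3 : √(k i) ≠ 0 := (Real.sqrt_pos.2 hk).ne'
  simp only [ngrad, inner_smul_left, hE.inner_grad i hp, smul_smul, conj_trivial]
  congr 1
  field_simp
  rw [sq, h2]

/-- No completeness of the gradients is needed. The normalised gradients are orthonormal, so the
series converges to some `G`; as the graph is closed, `G` is a gradient of `p.1`, and gradients are
unique. -/
theorem IsEigenbasis.hasSum_grad (hE : IsEigenbasis D e k) {p : D.L2 × HGrad D}
    (hp : p ∈ graphV D) : HasSum (fun i => inner ℝ (e i) p.1 • hE.grad i) p.2 := by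
  obtain ⟨G, hG⟩ := summable_smul_of_orthonormal hE.orthonormal_ngrad
    (summable_inner_sq hE.orthonormal_ngrad p.2)
  simp only [hE.inner_ngrad_smul _ hp] at hG
  have h1 := (hE.hasSum (meanFree_of_mem_graphV hp)).prodMk hG
  have h2 : (p.1, G) ∈ graphV D := by
    refine (graphTest D).isClosed_topologicalClosure.mem_of_tendsto h1
      (Eventually.of_forall fun s => ?_)
    refine (graphV D).sum_mem fun i _ => ?_
    exact (graphV D).smul_mem (inner ℝ (e i) p.1) (hE.grad_mem i)
  have h3 := (graphV D).sub_mem hp h2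
  have h4 : p - (p.1, G) = (0, p.2 - G) := Prod.ext (sub_self _) rfl
  rw [h4] at h3
  rwa [sub_eq_zero.1 (graphV_eq_zero h3)]

/-- Parseval's identity for gradients. -/
theorem IsEigenbasis.hasSum_inner_grad (hE : IsEigenbasis D e k) {p p' : D.L2 × HGrad D}
    (hp : p ∈ graphV D) (hp' : p' ∈ graphV D) :
    HasSum (fun i => k i * (inner ℝ (e i) p.1 * inner ℝ (e i) p'.1)) (inner ℝ p.2 p'.2) := by
  have h := (hE.hasSum_grad hp).mapL (innerSL ℝ p'.2)
  simp only [innerSL_apply_apply, inner_smul_right] at h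
  rw [real_inner_comm]
  refine h.congr_fun fun i => ?_
  rw [real_inner_comm (hE.grad i) p'.2, hE.inner_grad i hp']
  ring

end Eigen

/-! ### Localised extensions of interior test functions -/

theorem mem_interior_torus {x : Plane} (hx : x ∈ interior torus.carrier) (j : Fin 2) :
    x j ∈ Ioo (0 : ℝ) (2 * Real.pi) := by
  let P : Plane →L[ℝ] ℝ := EuclideanSpace.proj j
  have hsurj : Function.Surjective P := fun c => ⟨EuclideanSpace.single j c, by simp [P]⟩
  have hsub : (torus.carrier : Set Plane) ⊆ P ⁻¹' Icc 0 (2 * Real.pi) := fun y hy => hy j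
  have h1 := interior_mono hsub hx
  rw [← (P.isOpenMap hsurj).preimage_interior_eq_interior_preimage P.continuous, interior_Icc] at h1
  exact h1

/-- The vector of the period lattice with given integer coordinates. -/
def period (n : Fin 2 → ℤ) : Plane := WithLp.toLp 2 fun j => 2 * Real.pi * n j

/-- The periodic extension of a function supported in the cell. -/
def periodize (ψ : Plane → ℝ) (x : Plane) : ℝ := ∑ᶠ n : Fin 2 → ℤ, ψ (x - period n)

/-- A bounded set meets only finitely many lattice translates of the cell, so the smoothness of the
periodic extension can be checked term by term. -/
theorem locallyFinite_period {ψ : Plane → ℝ} (h : IsInteriorTest torus ψ) :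
    LocallyFinite fun n : Fin 2 → ℤ => Function.support fun x => ψ (x - period n) := by
  intro x₀
  refine ⟨Metric.ball x₀ 1, Metric.ball_mem_nhds _ one_pos, ?_⟩
  have hpi := Real.pi_gt_three
  obtain ⟨N, hN⟩ := exists_nat_ge (‖x₀‖ + 1)
  refine (Set.finite_Icc (fun _ : Fin 2 => -((N : ℤ) + 2)) (fun _ => (N : ℤ) + 2)).subset ?_
  rintro n ⟨x, hx, hxb⟩
  have hx' : x - period n ∈ interior torus.carrier := by
    by_contra hn
    exact hx (h.eq_zero hn)
  have hj : ∀ j, |(n j : ℝ)| ≤ N + 2 := by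
    intro j
    have h1 := mem_interior_torus hx' j
    simp only [period, PiLp.sub_apply] at h1
    have h2 : |x j| ≤ ‖x₀‖ + 1 := by
      have h3 : |x j| ≤ ‖x‖ := PiLp.norm_apply_le x j
      have h4 : ‖x‖ ≤ ‖x₀‖ + ‖x - x₀‖ := by
        simpa using norm_add_le x₀ (x - x₀)
      have h5 : ‖x - x₀‖ < 1 := by simpa [dist_eq_norm] using hxb
      linarith
    obtain ⟨h6, h7⟩ := abs_le.1 h2
    have h0 : (0 : ℝ) ≤ N := Nat.cast_nonneg N
    rw [abs_le]
    constructor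
    · by_contra hc
      nlinarith [h1.1, h1.2]
    · by_contra hc
      nlinarith [h1.1, h1.2]
  constructor
  · intro j
    have := (abs_le.1 (hj j)).1
    exact_mod_cast this
  · intro j
    have := (abs_le.1 (hj j)).2
    exact_mod_cast this

theorem contDiff_periodize {ψ : Plane → ℝ} (h : IsInteriorTest torus ψ) :
    ContDiff ℝ ∞ (periodize ψ) := by
  rw [← contMDiff_iff_contDiff]
  refine contMDiff_finsum (fun n => ?_) (locallyFinite_period h)
  rw [contMDiff_iff_contDiff]
  exact h.1.comp (contDiff_id.sub contDiff_const)

theorem periodize_add {ψ : Plane → ℝ} (x : Plane) (j : Fin 2) :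
    periodize ψ (x + EuclideanSpace.single j (2 * Real.pi)) = periodize ψ x := by
  unfold periodize
  rw [← finsum_comp_equiv (Equiv.addRight (Pi.single j (1 : ℤ)))]
  congr 1
  ext n
  congr 1
  ext i
  by_cases hi : i = j
  · subst hi
    simp [period]
    ring
  · simp [period, hi]

theorem periodize_eq {ψ : Plane → ℝ} (h : IsInteriorTest torus ψ) {x : Plane}
    (hx : x ∈ interior torus.carrier) : periodize ψ x = ψ x := by
  unfold periodize
  rw [finsum_eq_single _ 0]
  · congr 1
    ext j
    simp [period]
  · intro n hn
    refine h.eq_zero fun hc => hn ?_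
    ext j
    have h1 := mem_interior_torus hx j
    have h2 := mem_interior_torus hc j
    simp only [period, PiLp.sub_apply] at h2
    have hpi := Real.pi_pos
    have h3 : (n j : ℝ) < 1 := by
      by_contra hge
      nlinarith [h1.2, h2.1]
    have h4 : (-1 : ℝ) < n j := by
      by_contra hge
      nlinarith [h1.1, h2.2]
    have h5 : n j < 1 := by exact_mod_cast h3
    have h6 : -1 < n j := by exact_mod_cast h4
    simp only [Pi.zero_apply]
    omega

/-- Every interior test function agrees in `Ω` with a smooth localised function. -/
theorem IsInteriorTest.exists_localised {ψ : Plane → ℝ} (h : IsInteriorTest D ψ) :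
    ∃ ψ' : Plane → ℝ, ContDiff ℝ ∞ ψ' ∧ D.IsLocalised (fun _ : Unit => ψ') ∧
      ψ' =ᵐ[D.meas] ψ ∧ ∀ j, dx j ψ' =ᵐ[D.meas] dx j ψ := by
  cases D with
  | torus =>
    have hm : ∀ᵐ x ∂torus.meas, x ∈ interior torus.carrier := by
      rw [meas_eq_restrict_interior]
      exact ae_restrict_mem isOpen_interior.measurableSet
    refine ⟨periodize ψ, contDiff_periodize h, fun _ x j => periodize_add x j, ?_, fun j => ?_⟩
    · filter_upwards [hm] with x hx using periodize_eq h hx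
    · filter_upwards [hm] with x hx
      have : periodize ψ =ᶠ[𝓝 x] ψ := by
        filter_upwards [isOpen_interior.mem_nhds hx] with y hy using periodize_eq h hy
      simp only [dx, this.fderiv_eq]
  | bounded Ω h1 h2 h3 h4 =>
    refine ⟨ψ, h.1, ⟨tsupport ψ, h.2.1, h.2.2.trans interior_subset, fun _ x hx => ?_⟩,
      EventuallyEq.rfl, fun j => EventuallyEq.rfl⟩
    exact image_eq_zero_of_notMem_tsupport hx

/-! ### Slices of functions on `ℝ₊ × Ω` -/

/-- Lebesgue measure on the half-line `z > 0`. -/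
abbrev halfLine : Measure ℝ := volume.restrict (Ioi (0 : ℝ))

theorem ae_memLp_slice (u : D.L2Bulk) :
    ∀ᵐ z ∂halfLine, MemLp (fun x => u (z, x)) 2 D.meas := by
  have hm := Lp.memLp u
  have h1 : Integrable (fun p => u p ^ 2) (halfLine.prod D.meas) := hm.integrable_sq
  have h2 : AEStronglyMeasurable u (halfLine.prod D.meas) := hm.aestronglyMeasurable
  filter_upwards [h1.prod_right_ae, h2.prodMk_left] with z hz1 hz2
  exact (memLp_two_iff_integrable_sq hz2).2 hz1

open Classical in
/-- The slice `u(z, ·)` as an element of `L²(Ω)`. -/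
def slice (u : D.L2Bulk) (z : ℝ) : D.L2 :=
  if h : MemLp (fun x => u (z, x)) 2 D.meas then h.toLp _ else 0

theorem ae_slice_eq (u : D.L2Bulk) :
    ∀ᵐ z ∂halfLine, ∃ h : MemLp (fun x => u (z, x)) 2 D.meas, slice u z = h.toLp _ := by
  filter_upwards [ae_memLp_slice u] with z hz
  exact ⟨hz, by simp [slice, hz]⟩

theorem coeFn_slice (u : D.L2Bulk) :
    ∀ᵐ z ∂halfLine, slice u z =ᵐ[D.meas] fun x => u (z, x) := by
  filter_upwards [ae_slice_eq u] with z ⟨hz, h⟩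
  rw [h]
  exact hz.coeFn_toLp

theorem slice_add (u v : D.L2Bulk) : ∀ᵐ z ∂halfLine, slice (u + v) z = slice u z + slice v z := by
  filter_upwards [coeFn_slice u, coeFn_slice v, coeFn_slice (u + v), ae_slice (Lp.coeFn_add u v)]
    with z h1 h2 h3 h4
  refine Lp.ext ?_
  filter_upwards [h1, h2, h3, h4, Lp.coeFn_add (slice u z) (slice v z)] with x k1 k2 k3 k4 k5
  rw [k3, k4, k5, Pi.add_apply, Pi.add_apply, k1, k2]

theorem slice_smul (c : ℝ) (u : D.L2Bulk) : ∀ᵐ z ∂halfLine, slice (c • u) z = c • slice u z := by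
  filter_upwards [coeFn_slice u, coeFn_slice (c • u), ae_slice (Lp.coeFn_smul c u)]
    with z h1 h3 h4
  refine Lp.ext ?_
  filter_upwards [h1, h3, h4, Lp.coeFn_smul c (slice u z)] with x k1 k3 k4 k5
  rw [k3, k4, k5, Pi.smul_apply, Pi.smul_apply, k1]

theorem inner_slice (u : D.L2Bulk) : ∀ᵐ z ∂halfLine, ∀ w : D.L2,
    inner ℝ (slice u z) w = ∫ x, u (z, x) * w x ∂D.meas := by
  filter_upwards [coeFn_slice u] with z hz w
  rw [inner_L2]
  refine integral_congr_ae ?_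
  filter_upwards [hz] with x hx
  rw [hx]

theorem integrable_bulk_mul (u v : D.L2Bulk) : Integrable (fun p => u p * v p) D.bulk :=
  (Lp.memLp u).integrable_mul (Lp.memLp v)

theorem ae_inner_slice_slice (u v : D.L2Bulk) : ∀ᵐ z ∂halfLine,
    ∫ x, u (z, x) * v (z, x) ∂D.meas = inner ℝ (slice u z) (slice v z) := by
  filter_upwards [coeFn_slice u, coeFn_slice v] with z h1 h2
  rw [inner_L2]
  refine integral_congr_ae ?_
  filter_upwards [h1, h2] with x k1 k2
  rw [k1, k2]

theorem integrable_inner_slice (u v : D.L2Bulk) :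
    Integrable (fun z => inner ℝ (slice u z) (slice v z)) halfLine := by
  have h : Integrable (fun p => u p * v p) (halfLine.prod D.meas) := integrable_bulk_mul u v
  exact h.integral_prod_left.congr (ae_inner_slice_slice u v)

theorem integral_bulk_mul (u v : D.L2Bulk) :
    ∫ p, u p * v p ∂D.bulk = ∫ z, inner ℝ (slice u z) (slice v z) ∂halfLine := by
  have h : Integrable (fun p => u p * v p) (halfLine.prod D.meas) := integrable_bulk_mul u v
  rw [← integral_congr_ae (ae_inner_slice_slice u v)]
  exact integral_prod _ h

theorem sq_norm_bulk (u : D.L2Bulk) : ‖u‖ ^ 2 = ∫ z, ‖slice u z‖ ^ 2 ∂halfLine := by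
  rw [← real_inner_self_eq_norm_sq, L2.inner_def]
  simp only [← real_inner_self_eq_norm_sq]
  rw [← integral_bulk_mul]
  simp [sq]

theorem integrable_sq_norm_slice (u : D.L2Bulk) :
    Integrable (fun z => ‖slice u z‖ ^ 2) halfLine := by
  simp only [← real_inner_self_eq_norm_sq]
  exact integrable_inner_slice u u

/-- The map `z ↦ slice u z` is defined by cases and is not claimed measurable. Its coefficients are,
because almost everywhere they equal partial integrals of a measurable function of `(z, x)`. -/
theorem aestronglyMeasurable_coef (u : D.L2Bulk) (w : D.L2) :
    AEStronglyMeasurable (fun z => inner ℝ (slice u z) w) halfLine := by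
  have h1 : AEStronglyMeasurable (fun p : ℝ × Plane => u p * w p.2) (halfLine.prod D.meas) :=
    (Lp.aestronglyMeasurable u).mul (Lp.aestronglyMeasurable w).comp_snd
  refine h1.integral_prod_right'.congr ?_
  filter_upwards [inner_slice u] with z hz
  rw [hz]

theorem memLp_coef (u : D.L2Bulk) (w : D.L2) :
    MemLp (fun z => inner ℝ (slice u z) w) 2 halfLine := by
  have hm := aestronglyMeasurable_coef u w
  rw [memLp_two_iff_integrable_sq hm]
  refine ((integrable_sq_norm_slice u).mul_const (‖w‖ ^ 2)).mono' (hm.pow 2) ?_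
  refine Eventually.of_forall fun z => ?_
  rw [norm_pow, ← mul_pow]
  exact pow_le_pow_left₀ (norm_nonneg _) (norm_inner_le_norm _ _) 2

theorem memLp_norm_slice (u : D.L2Bulk) : ∃ n : ℝ → ℝ, MemLp n 2 halfLine ∧
    ∀ᵐ z ∂halfLine, n z = ‖slice u z‖ := by
  have h := integrable_sq_norm_slice u
  have hm : AEStronglyMeasurable (fun z => √(‖slice u z‖ ^ 2)) halfLine :=
    Real.continuous_sqrt.comp_aestronglyMeasurable h.aestronglyMeasurable
  refine ⟨_, ?_, Eventually.of_forall fun z => Real.sqrt_sq (norm_nonneg _)⟩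
  rw [memLp_two_iff_integrable_sq hm]
  simpa using h

/-- Integration against a function of `z` is continuous in the horizontal factor. -/
theorem exists_clm_coef (u : D.L2Bulk) {h : ℝ → ℝ} (hh : MemLp h 2 halfLine) :
    ∃ L : D.L2 →L[ℝ] ℝ, ∀ w, L w = ∫ z, h z * inner ℝ (slice u z) w ∂halfLine := by
  have hi : ∀ w : D.L2, Integrable (fun z => h z * inner ℝ (slice u z) w) halfLine := fun w =>
    hh.integrable_mul (memLp_coef u w)
  obtain ⟨n, hn, hns⟩ := memLp_norm_slice u
  let L : D.L2 →ₗ[ℝ] ℝ :=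
    { toFun := fun w => ∫ z, h z * inner ℝ (slice u z) w ∂halfLine
      map_add' := fun w w' => by
        rw [← integral_add (hi w) (hi w')]
        simp only [inner_add_right, mul_add]
      map_smul' := fun c w => by
        simp only [inner_smul_right, RingHom.id_apply, smul_eq_mul, ← integral_const_mul]
        refine integral_congr_ae (Eventually.of_forall fun z => ?_)
        simp only
        ring }
  refine ⟨L.mkContinuous (∫ z, |h z| * n z ∂halfLine) fun w => ?_, fun w => rfl⟩
  have hin : Integrable (fun z => |h z| * n z) halfLine := hh.norm.integrable_mul hn
  rw [← integral_mul_const]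
  refine norm_integral_le_of_norm_le (hin.mul_const _) ?_
  filter_upwards [hns] with z hz
  rw [norm_mul, hz, mul_assoc]
  exact mul_le_mul_of_nonneg_left (norm_inner_le_norm _ _) (abs_nonneg _)

theorem integral_bulk_tensor (u : D.L2Bulk) {h : ℝ → ℝ} (hh : MemLp h 2 halfLine)
    {ψ : Plane → ℝ} (hψ : MemLp ψ 2 D.meas) :
    ∫ p, u p * (h p.1 * ψ p.2) ∂D.bulk
      = ∫ z, h z * inner ℝ (slice u z) (hψ.toLp ψ) ∂halfLine := by
  have m1 : MemLp (fun p : ℝ × Plane => h p.1 * ψ p.2) 2 (halfLine.prod D.meas) := by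
    have hm : AEStronglyMeasurable (fun p : ℝ × Plane => h p.1 * ψ p.2) (halfLine.prod D.meas) :=
      hh.aestronglyMeasurable.comp_fst.mul hψ.aestronglyMeasurable.comp_snd
    rw [memLp_two_iff_integrable_sq hm]
    simp only [mul_pow]
    exact hh.integrable_sq.mul_prod hψ.integrable_sq
  have h1 : Integrable (fun p => u p * (h p.1 * ψ p.2)) (halfLine.prod D.meas) :=
    (Lp.memLp u).integrable_mul m1
  refine (integral_prod _ h1).trans (integral_congr_ae ?_)
  filter_upwards [coeFn_slice u] with z hz
  rw [inner_toLp, ← integral_const_mul]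
  refine integral_congr_ae ?_
  filter_upwards [hz] with x hx
  rw [hx]
  ring

/-! ### Weak equations for the coefficients -/

/-- Smooth functions with compact support in `(0, ∞)`. -/
structure IsVertTest (χ : ℝ → ℝ) : Prop where
  smooth : ContDiff ℝ ∞ χ
  compact : HasCompactSupport χ
  supp : tsupport χ ⊆ Ioi 0

theorem IsVertTest.memLp {χ : ℝ → ℝ} (h : IsVertTest χ) (b : ℝ) :
    MemLp (fun z => z ^ b * χ z) 2 halfLine := by
  have hc : Continuous fun z => z ^ b * χ z := by
    rw [continuous_iff_continuousAt]
    intro z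
    by_cases hz : z ∈ tsupport χ
    · exact (Real.continuousAt_rpow_const z b (Or.inl (ne_of_gt (h.supp hz)))).mul
        h.smooth.continuous.continuousAt
    · have : (fun z => z ^ b * χ z) =ᶠ[𝓝 z] fun _ => 0 := by
        filter_upwards [(isClosed_tsupport χ).isOpen_compl.mem_nhds hz] with y hy
        rw [image_eq_zero_of_notMem_tsupport hy, mul_zero]
      exact continuousAt_const.congr this.symm
  exact (hc.memLp_of_hasCompactSupport h.compact.mul_left).restrict _

theorem IsVertTest.deriv {χ : ℝ → ℝ} (h : IsVertTest χ) : IsVertTest (deriv χ) :=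
  ⟨(contDiff_infty_iff_deriv.1 h.smooth).2, h.compact.deriv,
    (closure_minimal (support_deriv_subset) (isClosed_tsupport χ)).trans h.supp⟩

theorem IsVertTest.memLp_self {χ : ℝ → ℝ} (h : IsVertTest χ) : MemLp χ 2 halfLine := by
  simpa using h.memLp 0

theorem isBulkTest_tensor {χ : ℝ → ℝ} (h : IsVertTest χ) {ψ : Plane → ℝ} (hψ : ContDiff ℝ ∞ ψ)
    (hl : D.IsLocalised (fun _ : Unit => ψ)) : IsBulkTest D (fun p => χ p.1 * ψ p.2) := by
  refine ⟨(h.smooth.comp contDiff_fst).mul (hψ.comp contDiff_snd),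
    ⟨tsupport χ, h.compact, h.supp, fun z hz x => ?_⟩, ?_⟩
  · simp [image_eq_zero_of_notMem_tsupport hz]
  · cases D with
    | torus =>
      intro z x j
      have := hl () x j
      simp only at this ⊢
      rw [this]
    | bounded Ω h1 h2 h3 h4 =>
      obtain ⟨K, hK, hKΩ, h0⟩ := hl
      refine ⟨K, hK, hKΩ, fun z x hx => ?_⟩
      have := h0 () x hx
      simp only at this ⊢
      rw [this, mul_zero]

theorem bdz_tensor {χ : ℝ → ℝ} (h : IsVertTest χ) {ψ : Plane → ℝ} (hψ : ContDiff ℝ ∞ ψ)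
    (p : ℝ × Plane) : bdz (fun p => χ p.1 * ψ p.2) p = deriv χ p.1 * ψ p.2 := by
  have h1 : HasFDerivAt (fun p : ℝ × Plane => χ p.1) _ p :=
    ((h.smooth.differentiable (by simp) p.1).hasFDerivAt).comp p hasFDerivAt_fst
  have h2 : HasFDerivAt (fun p : ℝ × Plane => ψ p.2) _ p :=
    ((hψ.differentiable (by simp) p.2).hasFDerivAt).comp p hasFDerivAt_snd
  rw [bdz, (h1.fun_mul h2).fderiv]
  simp [mul_comm]

theorem bdx_tensor {χ : ℝ → ℝ} (h : IsVertTest χ) {ψ : Plane → ℝ} (hψ : ContDiff ℝ ∞ ψ)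
    (j : Fin 2) (p : ℝ × Plane) : bdx j (fun p => χ p.1 * ψ p.2) p = χ p.1 * dx j ψ p.2 := by
  have h1 : HasFDerivAt (fun p : ℝ × Plane => χ p.1) _ p :=
    ((h.smooth.differentiable (by simp) p.1).hasFDerivAt).comp p hasFDerivAt_fst
  have h2 : HasFDerivAt (fun p : ℝ × Plane => ψ p.2) _ p :=
    ((hψ.differentiable (by simp) p.2).hasFDerivAt).comp p hasFDerivAt_snd
  rw [bdx, (h1.fun_mul h2).fderiv]
  simp [dx]

theorem IsWeightedGrad.weak_z {a : ℝ} {u Gz : D.L2Bulk} {Gx : Fin 2 → D.L2Bulk}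
    (h : IsWeightedGrad D a u Gz Gx) {χ : ℝ → ℝ} (hχ : IsVertTest χ) {ψ : Plane → ℝ}
    (hψ : ContDiff ℝ ∞ ψ) (hl : D.IsLocalised (fun _ : Unit => ψ)) (hm : MemLp ψ 2 D.meas) :
    ∫ z, deriv χ z * inner ℝ (slice u z) (hm.toLp ψ) ∂halfLine
      = -∫ z, (z ^ (-a / 2) * χ z) * inner ℝ (slice Gz z) (hm.toLp ψ) ∂halfLine := by
  have h1 := (h _ (isBulkTest_tensor hχ hψ hl)).1
  simp only [bdz_tensor hχ hψ, ← mul_assoc (_ ^ (-a / 2))] at h1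
  rwa [integral_bulk_tensor u hχ.deriv.memLp_self hm,
    integral_bulk_tensor Gz (hχ.memLp (-a / 2)) hm] at h1

theorem IsWeightedGrad.weak_x {a : ℝ} {u Gz : D.L2Bulk} {Gx : Fin 2 → D.L2Bulk}
    (h : IsWeightedGrad D a u Gz Gx) {χ : ℝ → ℝ} (hχ : IsVertTest χ) {ψ : Plane → ℝ}
    (hψ : ContDiff ℝ ∞ ψ) (hl : D.IsLocalised (fun _ : Unit => ψ)) (hm : MemLp ψ 2 D.meas)
    (j : Fin 2) (hmj : MemLp (dx j ψ) 2 D.meas) :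
    ∫ z, χ z * inner ℝ (slice u z) (hmj.toLp (dx j ψ)) ∂halfLine
      = -∫ z, χ z * inner ℝ (slice (Gx j) z) (hm.toLp ψ) ∂halfLine := by
  have h1 := (h _ (isBulkTest_tensor hχ hψ hl)).2 j
  simp only [bdx_tensor hχ hψ] at h1
  rwa [integral_bulk_tensor u hχ.memLp_self hmj, integral_bulk_tensor _ hχ.memLp_self hm] at h1

/-- The slice of the horizontal gradient. -/
def sliceG (Gx : Fin 2 → D.L2Bulk) (z : ℝ) : HGrad D := WithLp.toLp 2 fun j => slice (Gx j) z

theorem inner_sliceG (Gx : Fin 2 → D.L2Bulk) (z : ℝ) (G : HGrad D) :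
    inner ℝ (sliceG Gx z) G = ∑ j, inner ℝ (slice (Gx j) z) (G j) := by
  simp [sliceG, PiLp.inner_apply]

/-- Tensor products `χ(z) φ(x)` with `φ` a lateral test are bulk tests; both sides are continuous in
the horizontal factor, so the equation passes to `V` and eigenfunctions become admissible. -/
theorem IsWeightedGrad.weak_V {a : ℝ} {u Gz : D.L2Bulk} {Gx : Fin 2 → D.L2Bulk}
    (h : IsWeightedGrad D a u Gz Gx) {χ : ℝ → ℝ} (hχ : IsVertTest χ) {p : D.L2 × HGrad D}
    (hp : p ∈ graphV D) :
    ∫ z, deriv χ z * inner ℝ (slice u z) p.1 ∂halfLine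
      = -∫ z, (z ^ (-a / 2) * χ z) * inner ℝ (slice Gz z) p.1 ∂halfLine := by
  obtain ⟨L1, hL1⟩ := exists_clm_coef u hχ.deriv.memLp_self
  obtain ⟨L2, hL2⟩ := exists_clm_coef Gz (hχ.memLp (-a / 2))
  rw [← hL1, ← hL2]
  refine graphV_induction (P := fun p => L1 p.1 = -L2 p.1)
    (isClosed_eq (by fun_prop) (by fun_prop)) (fun φ hφ => ?_) hp
  rw [hL1, hL2]
  exact h.weak_z hχ hφ.1 hφ.2.1 hφ.memLp_self

theorem IsWeightedLaplacian.weak_V {a : ℝ} {Gz f : D.L2Bulk} {Gx : Fin 2 → D.L2Bulk}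
    (h : IsWeightedLaplacian D a Gz Gx f) {χ : ℝ → ℝ} (hχ : IsVertTest χ) {p : D.L2 × HGrad D}
    (hp : p ∈ graphV D) :
    (∫ z, (z ^ (a / 2) * deriv χ z) * inner ℝ (slice Gz z) p.1 ∂halfLine)
      + ∫ z, χ z * inner ℝ (sliceG Gx z) p.2 ∂halfLine
      = -∫ z, χ z * inner ℝ (slice f z) p.1 ∂halfLine := by
  obtain ⟨L1, hL1⟩ := exists_clm_coef Gz (hχ.deriv.memLp (a / 2))
  obtain ⟨L2, hL2⟩ := exists_clm_coef f hχ.memLp_self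
  choose L3 hL3 using fun j => exists_clm_coef (Gx j) hχ.memLp_self
  have e3 : ∫ z, χ z * inner ℝ (sliceG Gx z) p.2 ∂halfLine = ∑ j, L3 j (p.2 j) := by
    simp only [hL3, inner_sliceG, Finset.mul_sum]
    exact integral_finsetSum _ fun j _ => hχ.memLp_self.integrable_mul (memLp_coef (Gx j) _)
  rw [e3, ← hL1, ← hL2]
  refine graphV_induction (P := fun p => L1 p.1 + ∑ j, L3 j (p.2 j) = -L2 p.1)
    (isClosed_eq (by fun_prop) (by fun_prop)) (fun φ hφ => ?_) hp
  have h1 := h _ (isBulkTest_tensor hχ hφ.1 hφ.2.1)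
  simp only [bdz_tensor hχ hφ.1, bdx_tensor hχ hφ.1, ← mul_assoc (_ ^ (a / 2))] at h1
  rw [integral_bulk_tensor Gz (hχ.deriv.memLp (a / 2)) hφ.memLp_self,
    integral_bulk_tensor f hχ.memLp_self hφ.memLp_self] at h1
  simp only [fun j => integral_bulk_tensor (Gx j) hχ.memLp_self (hφ.memLp_dx j)] at h1
  simp only [testPair, hL1, hL2, hL3]
  exact h1

theorem locallyIntegrableOn_weight_mul {g : ℝ → ℝ} (hg : MemLp g 2 halfLine) (b : ℝ) :
    LocallyIntegrableOn (fun z => z ^ b * g z) (Ioi 0) := by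
  have h1 := locallyIntegrableOn_of_locallyIntegrable_restrict
    (hg.locallyIntegrable (by norm_num))
  refine h1.continuousOn_mul (fun z hz => ?_) isOpen_Ioi.isLocallyClosed
  exact (Real.continuousAt_rpow_const z _ (Or.inl (ne_of_gt hz))).continuousWithinAt

/-- A locally integrable function on the half-line with vanishing test integrals is zero. -/
theorem ae_eq_zero_of_forall_vert {F : ℝ → ℝ} (hF : LocallyIntegrableOn F (Ioi 0))
    (h : ∀ χ, IsVertTest χ → ∫ z, χ z * F z ∂halfLine = 0) : ∀ᵐ z ∂halfLine, F z = 0 := by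
  have := IsOpen.ae_eq_zero_of_integral_contDiff_smul_eq_zero (μ := halfLine) (f := F)
    (isOpen_Ioi (a := 0)) (hF.mono_measure Measure.restrict_le_self)
    (fun χ h1 h2 h3 => h χ ⟨h1, h2, h3⟩)
  filter_upwards [this, ae_restrict_mem measurableSet_Ioi] with z hz hm using hz hm

/-- On the torus an interior test is not periodic, so it is replaced by its periodic extension,
which agrees with it almost everywhere in the cell. The exceptional set of `z` still depends on `ψ`.
-/
theorem ae_slice_ibp {a : ℝ} {u Gz : D.L2Bulk} {Gx : Fin 2 → D.L2Bulk}
    (h : IsWeightedGrad D a u Gz Gx) {ψ : Plane → ℝ} (hψ : IsInteriorTest D ψ) (j : Fin 2) :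
    ∀ᵐ z ∂halfLine, inner ℝ (slice u z)
        ((memLp_of_continuous (D := D) (continuous_dx hψ.1 j)).toLp (dx j ψ))
      = -inner ℝ (slice (Gx j) z)
        ((memLp_of_continuous (D := D) hψ.1.continuous).toLp ψ) := by
  obtain ⟨ψ', hs, hl, he, hej⟩ := hψ.exists_localised
  have m := memLp_of_continuous (D := D) hs.continuous
  have mj := memLp_of_continuous (D := D) (continuous_dx hs j)
  have m0 := memLp_of_continuous (D := D) hψ.1.continuous
  have mj0 := memLp_of_continuous (D := D) (continuous_dx hψ.1 j)
  rw [← MemLp.toLp_congr m m0 he, ← MemLp.toLp_congr mj mj0 (hej j)]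
  have hF := (memLp_coef u (mj.toLp _)).add (memLp_coef (Gx j) (m.toLp _))
  have hF' := locallyIntegrableOn_of_locallyIntegrable_restrict
    (hF.locallyIntegrable (by norm_num))
  have := ae_eq_zero_of_forall_vert hF' fun χ hχ => by
    simp only [Pi.add_apply, mul_add]
    have i1 : Integrable (fun z => χ z * inner ℝ (slice u z) (mj.toLp (dx j ψ'))) halfLine :=
      hχ.memLp_self.integrable_mul (memLp_coef u (mj.toLp _))
    have i2 : Integrable (fun z => χ z * inner ℝ (slice (Gx j) z) (m.toLp ψ')) halfLine :=
      hχ.memLp_self.integrable_mul (memLp_coef (Gx j) (m.toLp _))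
    rw [integral_add i1 i2, h.weak_x hχ hs hl m j mj, neg_add_cancel]
  filter_upwards [this] with z hz
  simp only [Pi.add_apply] at hz
  linarith

variable (D) in
/-- A countable family of interior test functions that is dense among all of them. -/
theorem exists_countable_interior : ∃ T : Set (Plane → ℝ), T.Countable ∧
    (∀ ψ ∈ T, IsInteriorTest D ψ) ∧ ∀ f : D.L2,
      (∀ ψ ∈ T, ∫ x, f x * ψ x ∂D.meas = 0) → f = 0 := by
  have : Fact ((2 : ℝ≥0∞) ≠ ⊤) := ⟨by norm_num⟩
  let S : Set D.L2 := {w | ∃ ψ, ∃ h : IsInteriorTest D ψ,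
    w = (memLp_of_continuous (D := D) h.1.continuous).toLp ψ}
  obtain ⟨T, hTS, hTc, hST⟩ :=
    (TopologicalSpace.IsSeparable.of_separableSpace S).exists_countable_dense_subset
  choose! F hF hFeq using hTS
  refine ⟨F '' T, hTc.image F, ?_, fun f hf => ?_⟩
  · rintro _ ⟨w, hw, rfl⟩
    exact hF hw
  · refine eq_zero_of_forall_interior fun ψ hψ => ?_
    have m := memLp_of_continuous (D := D) hψ.1.continuous
    rw [← inner_toLp f m]
    have h1 : m.toLp ψ ∈ closure T := hST ⟨ψ, hψ, rfl⟩
    refine closure_minimal (t := {w | inner ℝ f w = 0}) (fun w hw => ?_)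
      (isClosed_eq (by fun_prop) (by fun_prop)) h1
    have h2 := hf _ ⟨w, hw, rfl⟩
    rw [← inner_toLp f (memLp_of_continuous (D := D) (hF hw).1.continuous), ← hFeq hw] at h2
    exact h2

/-- Almost every slice of an element of `𝓗` lies in `V`, with the expected gradient. -/
theorem ae_slice_mem_graphV {a : ℝ} {u Gz : D.L2Bulk} {Gx : Fin 2 → D.L2Bulk}
    (h : IsWeightedGrad D a u Gz Gx) (hlat : LateralCondition D u) :
    ∀ᵐ z ∂halfLine, (slice u z, sliceG Gx z) ∈ graphV D := by
  obtain ⟨T, hTc, hT, hT0⟩ := exists_countable_interior D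
  -- Only countably many tests are used, so that one null set of `z` serves them all; the family
  -- still separates `L²(Ω)`. The lateral condition supplies a gradient of the slice, and these
  -- tests identify it with the slice of the distributional one.
  have h1 : ∀ᵐ z ∂halfLine, ∀ ψ (hψ : ψ ∈ T), ∀ j, inner ℝ (slice u z)
        ((memLp_of_continuous (D := D) (continuous_dx (hT ψ hψ).1 j)).toLp (dx j ψ))
      = -inner ℝ (slice (Gx j) z)
        ((memLp_of_continuous (D := D) (hT ψ hψ).1.continuous).toLp ψ) := by
    rw [ae_ball_iff hTc]
    intro ψ hψ
    rw [ae_all_iff]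
    intro j
    exact ae_slice_ibp h (hT ψ hψ) j
  filter_upwards [h1, hlat, coeFn_slice u] with z hz ⟨g, hg⟩ hzu
  obtain ⟨G, hG⟩ := (memV_iff (slice u z)).1 ⟨g, hg.congr hzu.symm⟩
  suffices hs : sliceG Gx z = G by rwa [hs]
  refine PiLp.ext fun j => ?_
  rw [← sub_eq_zero]
  refine hT0 _ fun ψ hψ => ?_
  have m := memLp_of_continuous (D := D) (hT ψ hψ).1.continuous
  have mj := memLp_of_continuous (D := D) (continuous_dx (hT ψ hψ).1 j)
  rw [← inner_toLp _ m, inner_sub_left]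
  have e1 := hz ψ hψ j
  have e2 := graphV_ibp hG (hT ψ hψ) j
  rw [← inner_toLp _ m, ← inner_toLp _ mj] at e2
  change inner ℝ (slice (Gx j) z) _ - _ = 0
  simp only at e2
  linarith

/-! ### Limits through almost every `z` -/

/-- The filter of `z → 0⁺` through almost every `z`. -/
abbrev zeroAE : Filter ℝ := 𝓝[>] 0 ⊓ ae volume

theorem eventually_zeroAE {P : ℝ → Prop} (h : ∀ᵐ z ∂halfLine, P z) : ∀ᶠ z in zeroAE, P z := by
  rw [ae_restrict_iff' measurableSet_Ioi] at h
  have h1 : ∀ᶠ z in zeroAE, z ∈ Ioi (0 : ℝ) := inf_le_left (a := 𝓝[>] (0 : ℝ)) self_mem_nhdsWithin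
  have h2 : ∀ᶠ z in zeroAE, z ∈ Ioi (0 : ℝ) → P z := inf_le_right (a := 𝓝[>] (0 : ℝ)) h
  filter_upwards [h1, h2] with z hz1 hz2 using hz2 hz1

/-- A null set cannot contain an interval `(0, ε)`. This makes limits through almost every `z`
unique, and it is the source of the good values of `z` picked below. -/
instance : NeBot zeroAE := by
  rw [inf_neBot_iff]
  intro U hU A hA
  obtain ⟨ε, hε, hsub⟩ := mem_nhdsGT_iff_exists_Ioo_subset.1 hU
  by_contra hne
  rw [not_nonempty_iff_eq_empty] at hne
  have h1 : Ioo 0 ε ⊆ Aᶜ := fun z hz hzA => by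
    have : z ∈ U ∩ A := ⟨hsub hz, hzA⟩
    rw [hne] at this
    exact this
  have h2 : volume (Ioo 0 ε) ≤ volume Aᶜ := measure_mono h1
  have h3 : volume Aᶜ = 0 := hA
  rw [h3, Real.volume_Ioo] at h2
  have h4 : (0 : ℝ) < ε := hε
  simp only [sub_zero, nonpos_iff_eq_zero, ENNReal.ofReal_eq_zero] at h2
  linarith

theorem tendsto_prim_zeroAE {c : ℝ} {q : ℝ → ℝ} (hq : IntervalIntegrable q volume 0 1) :
    Tendsto (prim c q) zeroAE (𝓝 c) := by
  have h1 := (prim_continuousOn (c := c) hq) 0 left_mem_uIcc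
  rw [uIcc_of_le zero_le_one, ContinuousWithinAt, prim_zero] at h1
  refine h1.mono_left (inf_le_left.trans ?_)
  rw [← nhdsWithin_Ioo_eq_nhdsGT (zero_lt_one' ℝ)]
  exact nhdsWithin_mono _ Ioo_subset_Icc_self

theorem tendsto_rpow_zeroAE {b : ℝ} (hb : 0 < b) :
    Tendsto (fun z : ℝ => z ^ b) zeroAE (𝓝 0) := by
  have h := (Real.continuousAt_rpow_const 0 b (Or.inr hb.le)).tendsto
  rw [Real.zero_rpow hb.ne'] at h
  exact h.mono_left (inf_le_left.trans nhdsWithin_le_nhds)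

/-- The size of the increment of a primitive of a square integrable function with a weight. -/
theorem sq_prim_sub_le {a : ℝ} (ha : a < 1) {c : ℝ} {g : ℝ → ℝ} (hg : MemLp g 2 halfLine) {z : ℝ}
    (hz : 0 ≤ z) : (prim c (fun z => z ^ (-a / 2) * g z) z - c) ^ 2
      ≤ z ^ (1 - a) / (1 - a) * ∫ z, g z ^ 2 ∂halfLine := by
  have h1 := sq_integral_mul_le (memLp_weight ha hz)
    (hg.mono_measure (Measure.restrict_mono (Ioc_subset_Ioi_self : Ioc 0 z ⊆ Ioi 0) le_rfl))
  rw [integral_weight_sq ha hz] at h1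
  simp only [prim, add_sub_cancel_left, intervalIntegral.integral_of_le hz]
  refine h1.trans (mul_le_mul_of_nonneg_left ?_ ?_)
  · exact setIntegral_mono_set hg.integrable_sq (Eventually.of_forall fun t => sq_nonneg _)
      (LE.le.eventuallyLE Ioc_subset_Ioi_self)
  · exact div_nonneg (Real.rpow_nonneg hz _) (by linarith)

/-! ### Expansions of functions on `ℝ₊ × Ω` -/

section Eigen

variable {e : ℕ → D.L2} {k : ℕ → ℝ}

/-- Bessel's inequality in each slice, integrated in `z`. -/
theorem sum_integral_coef_sq_le (he : Orthonormal ℝ e) (u : D.L2Bulk) (s : Finset ℕ) :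
    ∑ i ∈ s, ∫ z, inner ℝ (slice u z) (e i) ^ 2 ∂halfLine ≤ ‖u‖ ^ 2 := by
  rw [← integral_finsetSum _ fun i _ => (memLp_coef u (e i)).integrable_sq, sq_norm_bulk]
  refine integral_mono (integrable_finsetSum _ fun i _ => (memLp_coef u (e i)).integrable_sq)
    (integrable_sq_norm_slice u) fun z => ?_
  have := he.sum_inner_products_le (s := s) (slice u z)
  simpa [real_inner_comm] using this

theorem summable_integral_coef_sq (he : Orthonormal ℝ e) (u : D.L2Bulk) :
    Summable fun i => ∫ z, inner ℝ (slice u z) (e i) ^ 2 ∂halfLine :=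
  summable_of_sum_le (fun _ => integral_nonneg fun _ => sq_nonneg _)
    (sum_integral_coef_sq_le he u)

theorem tsum_integral_coef_sq_le (he : Orthonormal ℝ e) (u : D.L2Bulk) :
    ∑' i, ∫ z, inner ℝ (slice u z) (e i) ^ 2 ∂halfLine ≤ ‖u‖ ^ 2 :=
  Real.tsum_le_of_sum_le (fun _ => integral_nonneg fun _ => sq_nonneg _)
    (sum_integral_coef_sq_le he u)

theorem integral_abs_mul_le {α : Type*} {m : MeasurableSpace α} {μ : Measure α} {f g : α → ℝ}
    (hf : MemLp f 2 μ) (hg : MemLp g 2 μ) :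
    ∫ x, ‖f x * g x‖ ∂μ ≤ (∫ x, f x ^ 2 ∂μ) + ∫ x, g x ^ 2 ∂μ := by
  rw [← integral_add hf.integrable_sq hg.integrable_sq]
  refine integral_mono (hf.integrable_mul hg).norm (hf.integrable_sq.add hg.integrable_sq)
    fun x => ?_
  simp only [norm_mul, Real.norm_eq_abs]
  nlinarith [sq_nonneg (|f x| - |g x|), sq_abs (f x), sq_abs (g x), abs_nonneg (f x),
    abs_nonneg (g x)]

/-- Parseval's identity on `ℝ₊ × Ω`. -/
theorem IsEigenbasis.hasSum_bulk (hE : IsEigenbasis D e k) {u : D.L2Bulk}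
    (hu : ∀ᵐ z ∂halfLine, D.MeanFree (slice u z)) (w : D.L2Bulk) :
    HasSum (fun i => ∫ z, inner ℝ (slice u z) (e i) * inner ℝ (slice w z) (e i) ∂halfLine)
      (∫ p, u p * w p ∂D.bulk) := by
  rw [integral_bulk_mul]
  -- Sum and integral are exchanged by absolute convergence, from `|x y| ≤ x² + y²`. Only one factor
  -- need be mean-free for the Parseval identity in the slices.
  have h := hasSum_integral_of_summable_integral_norm (μ := halfLine)
    (F := fun i z => inner ℝ (slice u z) (e i) * inner ℝ (slice w z) (e i))
    (fun i => (memLp_coef u (e i)).integrable_mul (memLp_coef w (e i)))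
    (((summable_integral_coef_sq hE.orthonormal u).add
      (summable_integral_coef_sq hE.orthonormal w)).of_nonneg_of_le
      (fun i => integral_nonneg fun z => norm_nonneg _)
      (fun i => integral_abs_mul_le (memLp_coef u (e i)) (memLp_coef w (e i))))
  have heq : ∫ z, inner ℝ (slice u z) (slice w z) ∂halfLine
      = ∫ z, ∑' i, inner ℝ (slice u z) (e i) * inner ℝ (slice w z) (e i) ∂halfLine := by
    refine integral_congr_ae ?_
    filter_upwards [hu] with z hz
    rw [← (hE.hasSum_inner hz (slice w z)).tsum_eq]
    refine tsum_congr fun i => ?_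
    rw [real_inner_comm, real_inner_comm (slice w z)]
  rw [heq]
  exact h

theorem sq_norm_sliceG (Gx : Fin 2 → D.L2Bulk) (z : ℝ) :
    ‖sliceG Gx z‖ ^ 2 = ∑ j, ‖slice (Gx j) z‖ ^ 2 := by
  rw [PiLp.norm_sq_eq_of_L2]
  rfl

theorem integrable_sq_norm_sliceG (Gx : Fin 2 → D.L2Bulk) :
    Integrable (fun z => ‖sliceG Gx z‖ ^ 2) halfLine := by
  simp only [sq_norm_sliceG]
  exact integrable_finsetSum _ fun j _ => integrable_sq_norm_slice _

theorem integral_sq_norm_sliceG (Gx : Fin 2 → D.L2Bulk) :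
    ∫ z, ‖sliceG Gx z‖ ^ 2 ∂halfLine = ∑ j, ‖Gx j‖ ^ 2 := by
  simp only [sq_norm_sliceG, sq_norm_bulk]
  exact integral_finsetSum _ fun j _ => integrable_sq_norm_slice _

theorem IsEigenbasis.sum_k_coef_sq_le (hE : IsEigenbasis D e k) {u : D.L2Bulk}
    {Gx : Fin 2 → D.L2Bulk} (hu : ∀ᵐ z ∂halfLine, (slice u z, sliceG Gx z) ∈ graphV D)
    (s : Finset ℕ) :
    ∑ i ∈ s, k i * ∫ z, inner ℝ (slice u z) (e i) ^ 2 ∂halfLine ≤ ∑ j, ‖Gx j‖ ^ 2 := by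
  have hi : ∀ i, Integrable (fun z => k i * inner ℝ (slice u z) (e i) ^ 2) halfLine := fun i =>
    (memLp_coef u (e i)).integrable_sq.const_mul _
  simp only [← integral_const_mul]
  rw [← integral_finsetSum _ fun i _ => hi i, ← integral_sq_norm_sliceG]
  refine integral_mono_ae (integrable_finsetSum _ fun i _ => hi i)
    (integrable_sq_norm_sliceG Gx) ?_
  filter_upwards [hu] with z hz
  have h := hE.hasSum_inner_grad hz hz
  rw [real_inner_self_eq_norm_sq] at h
  refine sum_le_hasSum s (fun i _ => mul_nonneg (hE.k_pos i).le (sq_nonneg _))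
    (h.congr_fun fun i => ?_)
  rw [sq, real_inner_comm]

/-- Parseval's identity for horizontal gradients on `ℝ₊ × Ω`. -/
theorem IsEigenbasis.hasSum_bulk_grad (hE : IsEigenbasis D e k) {u v : D.L2Bulk}
    {Gx Hx : Fin 2 → D.L2Bulk} (hu : ∀ᵐ z ∂halfLine, (slice u z, sliceG Gx z) ∈ graphV D)
    (hv : ∀ᵐ z ∂halfLine, (slice v z, sliceG Hx z) ∈ graphV D) :
    HasSum (fun i => k i * ∫ z, inner ℝ (slice u z) (e i) * inner ℝ (slice v z) (e i) ∂halfLine)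
      (∫ p, ∑ j, Gx j p * Hx j p ∂D.bulk) := by
  have hsum : ∀ {u : D.L2Bulk} {Gx : Fin 2 → D.L2Bulk},
      (∀ᵐ z ∂halfLine, (slice u z, sliceG Gx z) ∈ graphV D) →
      Summable fun i => k i * ∫ z, inner ℝ (slice u z) (e i) ^ 2 ∂halfLine := fun hu =>
    summable_of_sum_le (fun i => mul_nonneg (hE.k_pos i).le
      (integral_nonneg fun _ => sq_nonneg _)) (hE.sum_k_coef_sq_le hu)
  have h := hasSum_integral_of_summable_integral_norm (μ := halfLine)
    (F := fun i z => k i * (inner ℝ (slice u z) (e i) * inner ℝ (slice v z) (e i)))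
    (fun i => ((memLp_coef u (e i)).integrable_mul (memLp_coef v (e i))).const_mul _)
    (((hsum hu).add (hsum hv)).of_nonneg_of_le
      (fun i => integral_nonneg fun z => norm_nonneg _)
      (fun i => by
        simp only [norm_mul (k i), integral_const_mul, Real.norm_of_nonneg (hE.k_pos i).le]
        rw [← mul_add]
        exact mul_le_mul_of_nonneg_left
          (integral_abs_mul_le (memLp_coef u (e i)) (memLp_coef v (e i))) (hE.k_pos i).le))
  simp only [integral_const_mul] at h
  rw [integral_finsetSum _ fun j _ => integrable_bulk_mul (Gx j) (Hx j)]
  simp only [integral_bulk_mul]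
  rw [← integral_finsetSum _ fun j _ => integrable_inner_slice (Gx j) (Hx j)]
  have heq : ∫ z, ∑ j, inner ℝ (slice (Gx j) z) (slice (Hx j) z) ∂halfLine
      = ∫ z, ∑' i, k i * (inner ℝ (slice u z) (e i) * inner ℝ (slice v z) (e i)) ∂halfLine := by
    refine integral_congr_ae ?_
    filter_upwards [hu, hv] with z hz hz'
    have h1 := (hE.hasSum_inner_grad hz hz').tsum_eq
    rw [PiLp.inner_apply] at h1
    refine h1.symm.trans (tsum_congr fun i => ?_)
    rw [real_inner_comm, real_inner_comm (slice v z)]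
  rw [heq]
  exact h

/-! ### The coefficients of elements of `𝓗` and `𝓗²` are primitives -/

theorem ae_mem_graphV {a : ℝ} (u : spaceH D a) :
    ∀ᵐ z ∂halfLine, (slice (fnOf u) z, sliceG (gradx u) z) ∈ graphV D :=
  ae_slice_mem_graphV u.2.1 u.2.2

/-- Testing with `χ(z) e_i(x)` gives the weak equation `u_i' = z ^ (-a/2) g_i`, whose right-hand
side is integrable up to `0`. -/
theorem IsEigenbasis.exists_coef_eq_prim (hE : IsEigenbasis D e k) {a : ℝ} (ha : a < 1)
    (u : spaceH D a) (i : ℕ) : ∃ c : ℝ, ∀ᵐ z ∂halfLine, inner ℝ (slice (fnOf u) z) (e i)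
      = prim c (fun z => z ^ (-a / 2) * inner ℝ (slice (gradz u) z) (e i)) z := by
  refine exists_ae_eq_prim
    ((locallyIntegrableOn_of_locallyIntegrable_restrict
      ((memLp_coef (fnOf u) (e i)).locallyIntegrable (by norm_num))))
    (fun Z hZ => weight_mul_intervalIntegrable ha (memLp_coef (gradz u) (e i)) hZ)
    fun χ h1 h2 h3 => ?_
  have h := IsWeightedGrad.weak_V u.2.1 ⟨h1, h2, h3⟩ (hE.grad_mem i)
  refine h.trans ?_
  congr 1
  refine integral_congr_ae (Eventually.of_forall fun z => ?_)
  simp only [gradz]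
  ring

theorem memLp_source (k : ℕ → ℝ) (e : ℕ → D.L2) {a : ℝ} (v : spaceH2 D a) (i : ℕ) :
    MemLp (fun z => k i * inner ℝ (slice (fnOf (toH v)) z) (e i)
      + inner ℝ (slice (lap v) z) (e i)) 2 halfLine :=
  ((memLp_coef (fnOf (toH v)) (e i)).const_mul (k i)).add (memLp_coef (lap v) (e i))

/-- In the weak equation tested with `χ(z) e_i(x)`, the eigenvalue relation turns the horizontal
term into `k_i v_i`. Hence the flux has weak derivative `k_i v_i + f_i`, which lies in `L²`. -/
theorem IsEigenbasis.exists_flux_eq_prim (hE : IsEigenbasis D e k) {a : ℝ}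
    (v : spaceH2 D a) (i : ℕ) : ∃ d : ℝ, ∀ᵐ z ∂halfLine,
      z ^ (a / 2) * inner ℝ (slice (gradz (toH v)) z) (e i)
      = prim d (fun z => k i * inner ℝ (slice (fnOf (toH v)) z) (e i)
        + inner ℝ (slice (lap v) z) (e i)) z := by
  refine exists_ae_eq_prim (locallyIntegrableOn_weight_mul (memLp_coef (gradz (toH v)) (e i)) _)
    (fun Z hZ => memLp_intervalIntegrable (memLp_source k e v i) hZ)
    fun χ h1 h2 h3 => ?_
  have hχ : IsVertTest χ := ⟨h1, h2, h3⟩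
  have h := IsWeightedLaplacian.weak_V v.2 hχ (hE.grad_mem i)
  have e1 : ∫ z, χ z * inner ℝ (sliceG v.1.1.1.2.2 z) (hE.grad i) ∂halfLine
      = ∫ z, χ z * (k i * inner ℝ (slice (fnOf (toH v)) z) (e i)) ∂halfLine := by
    refine integral_congr_ae ?_
    filter_upwards [ae_mem_graphV (toH v)] with z hz
    have h4 := hE.inner_grad i hz
    simp only at h4
    rw [real_inner_comm] at h4
    rw [real_inner_comm (e i)]
    congr 1
  simp only at h
  rw [e1] at h
  have e2 : ∫ z, deriv χ z * (z ^ (a / 2) * inner ℝ (slice (gradz (toH v)) z) (e i)) ∂halfLine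
      = ∫ z, z ^ (a / 2) * deriv χ z * inner ℝ (slice v.1.1.1.2.1 z) (e i) ∂halfLine := by
    refine integral_congr_ae (Eventually.of_forall fun z => ?_)
    simp only [gradz, toH]
    ring
  have i1 : Integrable (fun z => χ z * (k i * inner ℝ (slice (fnOf (toH v)) z) (e i)))
      halfLine := hχ.memLp_self.integrable_mul ((memLp_coef (fnOf (toH v)) (e i)).const_mul (k i))
  have i2 : Integrable (fun z => χ z * inner ℝ (slice (lap v) z) (e i)) halfLine :=
    hχ.memLp_self.integrable_mul (memLp_coef (lap v) (e i))
  simp only [mul_add]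
  rw [integral_add i1 i2, e2]
  have e3 : ∫ z, χ z * inner ℝ (slice (lap v) z) (e i) ∂halfLine
    = ∫ z, χ z * inner ℝ (slice v.1.2 z) (e i) ∂halfLine := rfl
  rw [e3]
  linarith

end Eigen

/-! ### Traces -/

theorem ae_meanFree_slice {a : ℝ} (u : spaceH D a) :
    ∀ᵐ z ∂halfLine, D.MeanFree (slice (fnOf u) z) := by
  filter_upwards [ae_mem_graphV u] with z hz using meanFree_of_mem_graphV hz

/-- Needed for Parseval, since on the torus the basis spans mean-zero functions only. The constant
`1` is not a lateral test but is localised on the torus; testing with it kills the left-hand side,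
because the slices of `u` have zero mean. -/
theorem ae_meanFree_slice_gradz {a : ℝ} (u : spaceH D a) :
    ∀ᵐ z ∂halfLine, D.MeanFree (slice (gradz u) z) := by
  cases D with
  | torus =>
    have m : MemLp (fun _ : Plane => (1 : ℝ)) 2 torus.meas := memLp_const 1
    have hmf : ∀ f : torus.L2, torus.MeanFree f ↔ inner ℝ f (m.toLp _) = 0 := fun f => by
      rw [inner_toLp]
      simp only [mul_one]
      rfl
    have h := ae_eq_zero_of_forall_vert
      (locallyIntegrableOn_weight_mul (memLp_coef (gradz u) (m.toLp _)) (-a / 2)) fun χ hχ => by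
        have h1 := IsWeightedGrad.weak_z u.2.1 hχ contDiff_const
          (show torus.IsLocalised (fun _ : Unit => fun _ : Plane => (1 : ℝ)) from
            fun _ _ _ => rfl) m
        have h2 : ∫ z, deriv χ z * inner ℝ (slice u.1.1 z) (m.toLp _) ∂halfLine = 0 := by
          rw [← integral_zero ℝ ℝ (μ := halfLine)]
          refine integral_congr_ae ?_
          filter_upwards [ae_meanFree_slice u] with z hz
          have h3 : inner ℝ (slice u.1.1 z) (m.toLp _) = 0 := (hmf _).1 hz
          rw [h3, mul_zero]
        rw [h2, zero_eq_neg] at h1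
        rw [← h1]
        refine integral_congr_ae (Eventually.of_forall fun z => ?_)
        simp only [gradz]
        ring
    filter_upwards [h, ae_restrict_mem measurableSet_Ioi] with z hz hz0
    rw [hmf]
    exact (mul_eq_zero.1 hz).resolve_left (Real.rpow_pos_of_pos hz0 _).ne'
  | bounded Ω h1 h2 h3 h4 => exact Eventually.of_forall fun z => trivial

theorem sq_norm_hasSum {E : Type*} [NormedAddCommGroup E] [InnerProductSpace ℝ E]
    {v : ℕ → E} (hv : Orthonormal ℝ v) {c : ℕ → ℝ} {y : E} (h : HasSum (fun i => c i • v i) y) :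
    HasSum (fun i => c i ^ 2) (‖y‖ ^ 2) := by
  have h1 := h.mapL (innerSL ℝ y)
  rw [innerSL_apply_apply, real_inner_self_eq_norm_sq] at h1
  refine h1.congr_fun fun i => ?_
  rw [innerSL_apply_apply, inner_smul_right, real_inner_comm, inner_hasSum_smul hv h, sq]

theorem eLpNorm_slice_sub (u : D.L2Bulk) (g : D.L2) : ∀ᵐ z ∂halfLine,
    eLpNorm (fun x => u (z, x) - g x) 2 D.meas = ENNReal.ofReal ‖slice u z - g‖ := by
  filter_upwards [coeFn_slice u] with z hz
  rw [ofReal_norm, Lp.enorm_def]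
  refine eLpNorm_congr_ae ?_
  filter_upwards [hz, Lp.coeFn_sub (slice u z) g] with x h1 h2
  rw [h2, Pi.sub_apply, h1]

theorem isDirichletTrace_iff (u : D.L2Bulk) (g : D.L2) :
    IsDirichletTrace u g ↔ Tendsto (fun z => ‖slice u z - g‖) zeroAE (𝓝 0) := by
  have h1 : IsDirichletTrace u g
      ↔ Tendsto (fun z => ENNReal.ofReal ‖slice u z - g‖) zeroAE (𝓝 0) :=
    tendsto_congr' (eventually_zeroAE (eLpNorm_slice_sub u g))
  rw [h1]
  constructor
  · intro h
    have := (ENNReal.tendsto_toReal ENNReal.zero_ne_top).comp h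
    simpa [Function.comp_def, ENNReal.toReal_ofReal] using this
  · intro h
    have := ENNReal.tendsto_ofReal h
    rwa [ENNReal.ofReal_zero] at this

theorem eventually_lt_zeroAE {ε : ℝ} (hε : 0 < ε) : ∀ᶠ z in zeroAE, 0 < z ∧ z < ε :=
  inf_le_left (a := 𝓝[>] (0 : ℝ)) (Ioo_mem_nhdsGT hε)

/-- The trace of a function that is continuous up to `z = 0` is its restriction. -/
theorem IsDirichletTrace.ae_eq_of_continuousOn {u : D.L2Bulk} {g : D.L2}
    (h : IsDirichletTrace u g) {f : ℝ × Plane → ℝ} (hf : ContinuousOn f (Ici 0 ×ˢ D.carrier))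
    (huf : u =ᵐ[D.bulk] f) : g =ᵐ[D.meas] fun x => f (0, x) := by
  have hev := eventually_zeroAE (ae_slice huf)
  -- Good values `z_n → 0` are selected along which the slices converge to `g` in `L²`. A
  -- subsequence converges almost everywhere, while continuity gives the pointwise limit `f(0, x)`.
  have hz : ∀ n : ℕ, ∃ z : ℝ, (0 < z ∧ z < 1 / ((n : ℝ) + 1)) ∧
      (∀ᵐ x ∂D.meas, u (z, x) = f (z, x)) ∧
      eLpNorm (fun x => u (z, x) - g x) 2 D.meas ≤ ENNReal.ofReal (1 / ((n : ℝ) + 1)) := by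
    intro n
    have hn : (0 : ℝ) < 1 / ((n : ℝ) + 1) := by positivity
    exact ((eventually_lt_zeroAE hn).and (hev.and
      (h.eventually (ge_mem_nhds (ENNReal.ofReal_pos.2 hn))))).exists
  choose z hz1 hz2 hz3 using hz
  have hz0 : Tendsto z atTop (𝓝 0) :=
    squeeze_zero (fun n => (hz1 n).1.le) (fun n => (hz1 n).2.le) tendsto_one_div_add_atTop_nhds_zero_nat
  have hslice : ∀ n, AEStronglyMeasurable (fun x => f (z n, x)) D.meas := fun n => by
    refine ContinuousOn.aestronglyMeasurable ?_ (carrier_measurableSet D)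
    exact hf.comp (by fun_prop) fun x hx => ⟨(hz1 n).1.le, hx⟩
  have hlim : Tendsto (fun n => eLpNorm ((fun x => f (z n, x)) - (g : Plane → ℝ)) 2 D.meas) atTop (𝓝 0) := by
    have h1 : Tendsto (fun n : ℕ => ENNReal.ofReal (1 / ((n : ℝ) + 1))) atTop (𝓝 0) := by
      simpa using ENNReal.tendsto_ofReal (tendsto_one_div_add_atTop_nhds_zero_nat (𝕜 := ℝ))
    refine tendsto_of_tendsto_of_tendsto_of_le_of_le tendsto_const_nhds h1 (fun _ => zero_le)
      fun n => ?_
    refine le_trans (le_of_eq (eLpNorm_congr_ae ?_)) (hz3 n)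
    filter_upwards [hz2 n] with x hx
    rw [Pi.sub_apply, hx]
  obtain ⟨ns, hns, hae⟩ := (tendstoInMeasure_of_tendsto_eLpNorm (by norm_num) hslice
    (Lp.aestronglyMeasurable g) hlim).exists_seq_tendsto_ae
  filter_upwards [hae, ae_mem_carrier D] with x hx hxc
  refine tendsto_nhds_unique hx ?_
  have h1 : ContinuousWithinAt f (Ici 0 ×ˢ D.carrier) (0, x) := hf _ ⟨le_refl (0 : ℝ), hxc⟩
  refine h1.tendsto.comp (tendsto_nhdsWithin_iff.2 ⟨?_, Eventually.of_forall fun n =>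
    ⟨(hz1 _).1.le, hxc⟩⟩)
  exact (hz0.comp hns.tendsto_atTop).prodMk_nhds tendsto_const_nhds

section Eigen

variable {e : ℕ → D.L2} {k : ℕ → ℝ}

/-- The coefficients of the Dirichlet trace. -/
def IsEigenbasis.dcoef (hE : IsEigenbasis D e k) {a : ℝ} (ha : a < 1) (u : spaceH D a) (i : ℕ) :
    ℝ := (hE.exists_coef_eq_prim ha u i).choose

theorem IsEigenbasis.dcoef_spec (hE : IsEigenbasis D e k) {a : ℝ} (ha : a < 1) (u : spaceH D a)
    (i : ℕ) : ∀ᵐ z ∂halfLine, inner ℝ (slice (fnOf u) z) (e i)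
      = prim (hE.dcoef ha u i) (fun z => z ^ (-a / 2) * inner ℝ (slice (gradz u) z) (e i)) z :=
  (hE.exists_coef_eq_prim ha u i).choose_spec

theorem IsEigenbasis.tendsto_dcoef (hE : IsEigenbasis D e k) {a : ℝ} (ha : a < 1)
    (u : spaceH D a) (i : ℕ) :
    Tendsto (fun z => inner ℝ (slice (fnOf u) z) (e i)) zeroAE (𝓝 (hE.dcoef ha u i)) :=
  (tendsto_prim_zeroAE (weight_mul_intervalIntegrable ha (memLp_coef (gradz u) (e i))
    zero_le_one)).congr' ((eventually_zeroAE (hE.dcoef_spec ha u i)).mono fun _ h => h.symm)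

theorem IsEigenbasis.dcoef_add (hE : IsEigenbasis D e k) {a : ℝ} (ha : a < 1)
    (u v : spaceH D a) (i : ℕ) :
    hE.dcoef ha (u + v) i = hE.dcoef ha u i + hE.dcoef ha v i := by
  refine tendsto_nhds_unique (hE.tendsto_dcoef ha (u + v) i)
    (((hE.tendsto_dcoef ha u i).add (hE.tendsto_dcoef ha v i)).congr' ?_)
  filter_upwards [eventually_zeroAE (slice_add (fnOf u) (fnOf v))] with z hz
  rw [← inner_add_left, ← hz]
  rfl

theorem IsEigenbasis.dcoef_smul (hE : IsEigenbasis D e k) {a : ℝ} (ha : a < 1)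
    (c : ℝ) (u : spaceH D a) (i : ℕ) :
    hE.dcoef ha (c • u) i = c * hE.dcoef ha u i := by
  refine tendsto_nhds_unique (hE.tendsto_dcoef ha (c • u) i)
    (((hE.tendsto_dcoef ha u i).const_mul c).congr' ?_)
  filter_upwards [eventually_zeroAE (slice_smul c (fnOf u))] with z hz
  rw [← real_inner_smul_left, ← hz]
  rfl

/-- The coefficients of the Neumann trace, up to the sign. -/
def IsEigenbasis.ncoef (hE : IsEigenbasis D e k) {a : ℝ} (v : spaceH2 D a) (i : ℕ) :
    ℝ := (hE.exists_flux_eq_prim v i).choose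

theorem IsEigenbasis.ncoef_spec (hE : IsEigenbasis D e k) {a : ℝ} (v : spaceH2 D a) (i : ℕ) :
    ∀ᵐ z ∂halfLine, z ^ (a / 2) * inner ℝ (slice (gradz (toH v)) z) (e i)
      = prim (hE.ncoef v i) (fun z => k i * inner ℝ (slice (fnOf (toH v)) z) (e i)
        + inner ℝ (slice (lap v) z) (e i)) z :=
  (hE.exists_flux_eq_prim v i).choose_spec

theorem IsEigenbasis.tendsto_ncoef (hE : IsEigenbasis D e k) {a : ℝ}
    (v : spaceH2 D a) (i : ℕ) :
    Tendsto (fun z => z ^ (a / 2) * inner ℝ (slice (gradz (toH v)) z) (e i)) zeroAE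
      (𝓝 (hE.ncoef v i)) :=
  (tendsto_prim_zeroAE (memLp_intervalIntegrable (memLp_source k e v i)
    zero_le_one)).congr' ((eventually_zeroAE (hE.ncoef_spec v i)).mono fun _ h => h.symm)

theorem IsEigenbasis.ncoef_add (hE : IsEigenbasis D e k) {a : ℝ}
    (u v : spaceH2 D a) (i : ℕ) :
    hE.ncoef (u + v) i = hE.ncoef u i + hE.ncoef v i := by
  refine tendsto_nhds_unique (hE.tendsto_ncoef (u + v) i)
    (((hE.tendsto_ncoef u i).add (hE.tendsto_ncoef v i)).congr' ?_)
  filter_upwards [eventually_zeroAE (slice_add (gradz (toH u)) (gradz (toH v)))] with z hz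
  rw [← mul_add, ← inner_add_left, ← hz]
  rfl

theorem IsEigenbasis.ncoef_smul (hE : IsEigenbasis D e k) {a : ℝ}
    (c : ℝ) (v : spaceH2 D a) (i : ℕ) :
    hE.ncoef (c • v) i = c * hE.ncoef v i := by
  refine tendsto_nhds_unique (hE.tendsto_ncoef (c • v) i)
    (((hE.tendsto_ncoef v i).const_mul c).congr' ?_)
  filter_upwards [eventually_zeroAE (slice_smul c (gradz (toH v)))] with z hz
  rw [mul_left_comm, ← real_inner_smul_left, ← hz]
  rfl

theorem IsEigenbasis.sq_coef_sub_dcoef_le (hE : IsEigenbasis D e k) {a : ℝ} (ha : a < 1)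
    (u : spaceH D a) : ∀ᵐ z ∂halfLine, ∀ i,
      (inner ℝ (slice (fnOf u) z) (e i) - hE.dcoef ha u i) ^ 2
        ≤ z ^ (1 - a) / (1 - a) * ∫ z, inner ℝ (slice (gradz u) z) (e i) ^ 2 ∂halfLine := by
  rw [ae_all_iff]
  intro i
  filter_upwards [hE.dcoef_spec ha u i, ae_restrict_mem measurableSet_Ioi] with z hz hz0
  rw [hz]
  exact sq_prim_sub_le ha (memLp_coef (gradz u) (e i)) (le_of_lt hz0)

/-- The increments `u_i(z) - c_i` have squares bounded by `z ^ (1-a) / (1-a) · ∫ g_i²`, summable in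
`i`; this yields strong `L²` convergence with a rate, independently of the `Ḣ^σ` bound. -/
theorem IsEigenbasis.exists_dirichlet_trace (hE : IsEigenbasis D e k) {a : ℝ} (ha : a < 1)
    (u : spaceH D a) : ∃ g : D.L2, HasSum (fun i => hE.dcoef ha u i • e i) g ∧
      IsDirichletTrace (fnOf u) g := by
  have hgood : ∀ᵐ z ∂halfLine, ∃ y : D.L2,
      HasSum (fun i => (inner ℝ (slice (fnOf u) z) (e i) - hE.dcoef ha u i) • e i) y ∧
      ‖y‖ ^ 2 ≤ z ^ (1 - a) / (1 - a) * ‖gradz u‖ ^ 2 ∧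
      HasSum (fun i => inner ℝ (slice (fnOf u) z) (e i) • e i) (slice (fnOf u) z) := by
    filter_upwards [hE.sq_coef_sub_dcoef_le ha u, ae_meanFree_slice u,
      ae_restrict_mem measurableSet_Ioi] with z hz hmf hz0
    have hW : 0 ≤ z ^ (1 - a) / (1 - a) :=
      div_nonneg (Real.rpow_nonneg (le_of_lt hz0) _) (by linarith)
    have hs := (summable_integral_coef_sq hE.orthonormal (gradz u)).mul_left
      (z ^ (1 - a) / (1 - a))
    have hs' := hs.of_nonneg_of_le (fun i => sq_nonneg _) hz
    obtain ⟨y, hy⟩ := summable_smul_of_orthonormal hE.orthonormal hs'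
    refine ⟨y, hy, ?_, ?_⟩
    · rw [← (sq_norm_hasSum hE.orthonormal hy).tsum_eq]
      refine (hs'.tsum_le_tsum hz hs).trans ?_
      rw [tsum_mul_left]
      exact mul_le_mul_of_nonneg_left
        (tsum_integral_coef_sq_le hE.orthonormal (gradz u)) hW
    · exact (hE.hasSum hmf).congr_fun fun i => by rw [real_inner_comm]
  have hgood' := eventually_zeroAE hgood
  obtain ⟨z₀, y₀, hy₀, -, hz₀⟩ := hgood'.exists
  -- One good `z₀` suffices to show that `∑ c_i e_i` converges: it is the slice at `z₀` minus the
  -- increment.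
  have hg : HasSum (fun i => hE.dcoef ha u i • e i) (slice (fnOf u) z₀ - y₀) :=
    (hz₀.sub hy₀).congr_fun fun i => by rw [← sub_smul, sub_sub_cancel]
  refine ⟨_, hg, ?_⟩
  rw [isDirichletTrace_iff]
  have hlim : Tendsto (fun z : ℝ => √(z ^ (1 - a) / (1 - a) * ‖gradz u‖ ^ 2)) zeroAE (𝓝 0) := by
    have h1 := ((tendsto_rpow_zeroAE (b := 1 - a) (by linarith)).div_const (1 - a)).mul_const
      (‖gradz u‖ ^ 2)
    rw [zero_div, zero_mul] at h1
    have h2 := (Real.continuous_sqrt.tendsto 0).comp h1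
    rwa [Real.sqrt_zero] at h2
  refine squeeze_zero' (Eventually.of_forall fun z => norm_nonneg _) ?_ hlim
  filter_upwards [hgood'] with z ⟨y, hy, hyn, hz⟩
  have h1 : slice (fnOf u) z - (slice (fnOf u) z₀ - y₀) = y :=
    ((hz.sub hg).congr_fun fun i => by rw [← sub_smul]).unique hy
  rw [h1]
  exact Real.le_sqrt_of_sq_le hyn

end Eigen

/-! ### Bounds for the traces -/

/-- Optimising the Young parameter at `ε = Y / X` recombines the two squares without losing a
constant. It is applied after summation over `i`, so the same `ε` serves all modes. -/
theorem le_sq_add_of_forall {T X Y : ℝ} (hX : 0 ≤ X) (hY : 0 ≤ Y)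
    (h : ∀ ε, 0 < ε → T ≤ (1 + ε) * X ^ 2 + (1 + ε⁻¹) * Y ^ 2) : T ≤ (X + Y) ^ 2 := by
  have h1 : ∀ δ, 0 < δ → T ≤ (X + δ + (Y + δ)) ^ 2 := fun δ hδ => by
    have hX' : 0 < X + δ := by linarith
    have hY' : 0 < Y + δ := by linarith
    -- The shift by `δ` keeps the optimal parameter defined and positive when `X` or `Y` vanishes.
    have h2 := h ((Y + δ) / (X + δ)) (by positivity)
    have h3 : (1 + (Y + δ) / (X + δ)) * (X + δ) ^ 2
        + (1 + ((Y + δ) / (X + δ))⁻¹) * (Y + δ) ^ 2 = (X + δ + (Y + δ)) ^ 2 := by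
      field_simp
      ring
    rw [← h3]
    refine h2.trans ?_
    gcongr <;> linarith
  have h2 : Tendsto (fun δ : ℝ => (X + δ + (Y + δ)) ^ 2) (𝓝[>] 0) (𝓝 ((X + 0 + (Y + 0)) ^ 2)) :=
    (Continuous.tendsto (by fun_prop) 0).mono_left nhdsWithin_le_nhds
  rw [add_zero, add_zero] at h2
  exact ge_of_tendsto h2 (eventually_nhdsWithin_of_forall h1)

theorem sq_gradNorm {a : ℝ} (u : spaceH D a) :
    gradNorm u ^ 2 = ‖gradz u‖ ^ 2 + ∑ j, ‖gradx u j‖ ^ 2 :=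
  Real.sq_sqrt (by positivity)

section Eigen

variable {e : ℕ → D.L2} {k : ℕ → ℝ}

theorem IsEigenbasis.summable_k_coef_sq (hE : IsEigenbasis D e k) {a : ℝ} (u : spaceH D a) :
    Summable fun i => k i * ∫ z, inner ℝ (slice (fnOf u) z) (e i) ^ 2 ∂halfLine :=
  summable_of_sum_le (fun i => mul_nonneg (hE.k_pos i).le (integral_nonneg fun _ => sq_nonneg _))
    (hE.sum_k_coef_sq_le (ae_mem_graphV u))

theorem IsEigenbasis.tsum_k_coef_sq_le (hE : IsEigenbasis D e k) {a : ℝ} (u : spaceH D a) :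
    ∑' i, k i * ∫ z, inner ℝ (slice (fnOf u) z) (e i) ^ 2 ∂halfLine ≤ ∑ j, ‖gradx u j‖ ^ 2 :=
  Real.tsum_le_of_sum_le
    (fun i => mul_nonneg (hE.k_pos i).le (integral_nonneg fun _ => sq_nonneg _))
    (hE.sum_k_coef_sq_le (ae_mem_graphV u))

/-- The one-dimensional inequality with `k = k_i`, summed over the modes: the terms `g_i²` add up to
the vertical part of the energy, the terms `k_i u_i²` to the horizontal part. -/
theorem IsEigenbasis.dcoef_bound (hE : IsEigenbasis D e k) {a : ℝ} (ha : a < 1) {C : ℝ}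
    (hC0 : 0 < C) (hC : ∀ (k : ℝ), 0 < k → ∀ (c : ℝ) (g : ℝ → ℝ), MemLp g 2 halfLine →
      MemLp (prim c fun z => z ^ (-a / 2) * g z) 2 halfLine →
      k ^ ((1 - a) / (2 - a)) * c ^ 2 ≤ C *
        ∫ z in Ioi (0 : ℝ), (g z ^ 2 + k * prim c (fun z => z ^ (-a / 2) * g z) z ^ 2))
    (u : spaceH D a) :
    (Summable fun i => k i ^ ((1 - a) / (2 - a)) * hE.dcoef ha u i ^ 2) ∧
      √(∑' i, k i ^ ((1 - a) / (2 - a)) * hE.dcoef ha u i ^ 2) ≤ √C * gradNorm u := by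
  have h1 : ∀ i, k i ^ ((1 - a) / (2 - a)) * hE.dcoef ha u i ^ 2
      ≤ C * ((∫ z, inner ℝ (slice (gradz u) z) (e i) ^ 2 ∂halfLine)
        + k i * ∫ z, inner ℝ (slice (fnOf u) z) (e i) ^ 2 ∂halfLine) := fun i => by
    have hsp := hE.dcoef_spec ha u i
    have h2 := hC (k i) (hE.k_pos i) (hE.dcoef ha u i) _ (memLp_coef (gradz u) (e i))
      ((memLp_coef (fnOf u) (e i)).ae_eq hsp)
    rw [integral_add (memLp_coef (gradz u) (e i)).integrable_sq
      (((memLp_coef (fnOf u) (e i)).ae_eq hsp).integrable_sq.const_mul _), integral_const_mul] at h2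
    refine h2.trans (le_of_eq ?_)
    congr 3
    refine integral_congr_ae ?_
    filter_upwards [hsp] with z hz
    rw [hz]
  have hs := ((summable_integral_coef_sq hE.orthonormal (gradz u)).add
    (hE.summable_k_coef_sq u)).mul_left C
  have h0 : ∀ i, 0 ≤ k i ^ ((1 - a) / (2 - a)) * hE.dcoef ha u i ^ 2 := fun i =>
    mul_nonneg (Real.rpow_nonneg (hE.k_pos i).le _) (sq_nonneg _)
  have hs' := hs.of_nonneg_of_le h0 h1
  refine ⟨hs', Real.sqrt_le_iff.2 ⟨by unfold gradNorm; positivity, ?_⟩⟩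
  rw [mul_pow, Real.sq_sqrt hC0.le, sq_gradNorm]
  refine (hs'.tsum_le_tsum h1 hs).trans ?_
  rw [tsum_mul_left, (summable_integral_coef_sq hE.orthonormal (gradz u)).tsum_add
    (hE.summable_k_coef_sq u)]
  exact mul_le_mul_of_nonneg_left (add_le_add
    (tsum_integral_coef_sq_le hE.orthonormal (gradz u)) (hE.tsum_k_coef_sq_le u)) hC0.le

/-- Young's inequality for the source term `k v + f` of the flux. -/
theorem IsEigenbasis.inv_k_mul_integral_source_sq_le (hE : IsEigenbasis D e k) {a : ℝ}
    (v : spaceH2 D a) (i : ℕ) {ε : ℝ} (hε : 0 < ε) :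
    (k i)⁻¹ * ∫ z, (k i * inner ℝ (slice (fnOf (toH v)) z) (e i)
        + inner ℝ (slice (lap v) z) (e i)) ^ 2 ∂halfLine
      ≤ (1 + ε) * (k i * ∫ z, inner ℝ (slice (fnOf (toH v)) z) (e i) ^ 2 ∂halfLine)
        + (1 + ε⁻¹) * (poincareConst D ^ 2
          * ∫ z, inner ℝ (slice (lap v) z) (e i) ^ 2 ∂halfLine) := by
  have hk := hE.k_pos i
  have hm := memLp_source k e v i
  have m1 := memLp_coef (fnOf (toH v)) (e i)
  have m2 := memLp_coef (lap v) (e i)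
  have h1 : (k i)⁻¹ * ∫ z, (k i * inner ℝ (slice (fnOf (toH v)) z) (e i)
        + inner ℝ (slice (lap v) z) (e i)) ^ 2 ∂halfLine
      ≤ (1 + ε) * (k i * ∫ z, inner ℝ (slice (fnOf (toH v)) z) (e i) ^ 2 ∂halfLine)
        + (1 + ε⁻¹) * ((k i)⁻¹ * ∫ z, inner ℝ (slice (lap v) z) (e i) ^ 2 ∂halfLine) := by
    simp only [← integral_const_mul]
    rw [← integral_add ((m1.integrable_sq.const_mul _).const_mul _)
      ((m2.integrable_sq.const_mul _).const_mul _)]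
    refine integral_mono (hm.integrable_sq.const_mul _)
      (((m1.integrable_sq.const_mul _).const_mul _).add
        ((m2.integrable_sq.const_mul _).const_mul _)) fun z => ?_
    set x := inner ℝ (slice (fnOf (toH v)) z) (e i)
    set y := inner ℝ (slice (lap v) z) (e i)
    have h2 : (1 + ε) * (k i * x ^ 2) + (1 + ε⁻¹) * ((k i)⁻¹ * y ^ 2)
        - (k i)⁻¹ * (k i * x + y) ^ 2 = (k i * ε)⁻¹ * (ε * (k i * x) - y) ^ 2 := by
      field_simp
      ring
    have h3 : 0 ≤ (k i * ε)⁻¹ * (ε * (k i * x) - y) ^ 2 := by positivity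
    linarith
  exact h1.trans (add_le_add le_rfl (mul_le_mul_of_nonneg_left (mul_le_mul_of_nonneg_right
    (hE.inv_k_le i) (integral_nonneg fun _ => sq_nonneg _)) (by positivity)))

/-- Young's inequality keeps the factor `1 + ε` on the gradient part and leaves `1 + ε⁻¹` on the
source `Δ_λ v`. Summability needs only `ε = 1`; the stated bound needs every `ε > 0`. -/
theorem IsEigenbasis.ncoef_bound (hE : IsEigenbasis D e k) {a : ℝ} {C : ℝ}
    (hC0 : 0 < C) (hC : ∀ (k : ℝ), 0 < k → ∀ (c : ℝ) (g q : ℝ → ℝ), MemLp g 2 halfLine →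
      MemLp q 2 halfLine → (∀ᵐ z ∂halfLine, z ^ (a / 2) * g z = prim c q z) →
      k ^ (-((1 - a) / (2 - a))) * c ^ 2 ≤ C *
        ∫ z in Ioi (0 : ℝ), (g z ^ 2 + k⁻¹ * q z ^ 2))
    (v : spaceH2 D a) :
    (Summable fun i => k i ^ (-((1 - a) / (2 - a))) * hE.ncoef v i ^ 2) ∧
      √(∑' i, k i ^ (-((1 - a) / (2 - a))) * hE.ncoef v i ^ 2)
        ≤ √C * (gradNorm (toH v) + poincareConst D * ‖lap v‖) := by
  have s1 := summable_integral_coef_sq hE.orthonormal (gradz (toH v))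
  have s2 := hE.summable_k_coef_sq (toH v)
  have s3 := summable_integral_coef_sq hE.orthonormal (lap v)
  have h1 : ∀ ε, 0 < ε → ∀ i, k i ^ (-((1 - a) / (2 - a))) * hE.ncoef v i ^ 2
      ≤ C * ((∫ z, inner ℝ (slice (gradz (toH v)) z) (e i) ^ 2 ∂halfLine)
        + ((1 + ε) * (k i * ∫ z, inner ℝ (slice (fnOf (toH v)) z) (e i) ^ 2 ∂halfLine)
          + (1 + ε⁻¹) * (poincareConst D ^ 2
          * ∫ z, inner ℝ (slice (lap v) z) (e i) ^ 2 ∂halfLine))) := fun ε hε i => by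
    have hm := memLp_source k e v i
    have h2 := hC (k i) (hE.k_pos i) (hE.ncoef v i) _ _ (memLp_coef (gradz (toH v)) (e i)) hm
      (hE.ncoef_spec v i)
    rw [integral_add (memLp_coef (gradz (toH v)) (e i)).integrable_sq
      (hm.integrable_sq.const_mul _), integral_const_mul] at h2
    refine h2.trans (mul_le_mul_of_nonneg_left ?_ hC0.le)
    gcongr
    exact hE.inv_k_mul_integral_source_sq_le v i hε
  have hs : ∀ ε : ℝ, Summable _ := fun ε =>
    (s1.add ((s2.mul_left (1 + ε)).add ((s3.mul_left (poincareConst D ^ 2)).mul_left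
      (1 + ε⁻¹)))).mul_left C
  have h0 : ∀ i, 0 ≤ k i ^ (-((1 - a) / (2 - a))) * hE.ncoef v i ^ 2 := fun i =>
    mul_nonneg (Real.rpow_nonneg (hE.k_pos i).le _) (sq_nonneg _)
  have hs' := (hs 1).of_nonneg_of_le h0 (h1 1 one_pos)
  have hX : 0 ≤ gradNorm (toH v) := Real.sqrt_nonneg _
  have hY : 0 ≤ poincareConst D * ‖lap v‖ := mul_nonneg (poincareConst_nonneg D) (norm_nonneg _)
  refine ⟨hs', Real.sqrt_le_iff.2 ⟨by positivity, ?_⟩⟩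
  rw [mul_pow, Real.sq_sqrt hC0.le, ← div_le_iff₀' hC0]
  refine le_sq_add_of_forall hX hY fun ε hε => ?_
  rw [div_le_iff₀' hC0]
  refine (hs'.tsum_le_tsum (h1 ε hε) (hs ε)).trans ?_
  rw [tsum_mul_left, s1.tsum_add ((s2.mul_left (1 + ε)).add
    ((s3.mul_left (poincareConst D ^ 2)).mul_left (1 + ε⁻¹))),
    (s2.mul_left (1 + ε)).tsum_add ((s3.mul_left (poincareConst D ^ 2)).mul_left (1 + ε⁻¹)),
    tsum_mul_left, tsum_mul_left, tsum_mul_left]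
  refine mul_le_mul_of_nonneg_left ?_ hC0.le
  have b1 := tsum_integral_coef_sq_le hE.orthonormal (gradz (toH v))
  have b2 := hE.tsum_k_coef_sq_le (toH v)
  have b3 := tsum_integral_coef_sq_le hE.orthonormal (lap v)
  have b4 : (1 + ε) * ∑' i, k i * ∫ z, inner ℝ (slice (fnOf (toH v)) z) (e i) ^ 2 ∂halfLine
      ≤ (1 + ε) * ∑ j, ‖gradx (toH v) j‖ ^ 2 := mul_le_mul_of_nonneg_left b2 (by positivity)
  have b5 : (1 + ε⁻¹) * (poincareConst D ^ 2
        * ∑' i, ∫ z, inner ℝ (slice (lap v) z) (e i) ^ 2 ∂halfLine)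
      ≤ (1 + ε⁻¹) * (poincareConst D * ‖lap v‖) ^ 2 := by
    rw [mul_pow]
    gcongr
  rw [sq_gradNorm]
  have b6 : 0 ≤ ε * ‖gradz (toH v)‖ ^ 2 := by positivity
  nlinarith

/-- Green's formula for the coefficients. -/
theorem IsEigenbasis.coef_green (hE : IsEigenbasis D e k) {a : ℝ} (ha : a < 1) (u : spaceH D a)
    (v : spaceH2 D a) (i : ℕ) :
    (∫ z, inner ℝ (slice (gradz u) z) (e i) * inner ℝ (slice (gradz (toH v)) z) (e i) ∂halfLine)
      + k i * (∫ z, inner ℝ (slice (fnOf u) z) (e i)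
        * inner ℝ (slice (fnOf (toH v)) z) (e i) ∂halfLine)
      + (∫ z, inner ℝ (slice (fnOf u) z) (e i) * inner ℝ (slice (lap v) z) (e i) ∂halfLine)
      = -hE.ncoef v i * hE.dcoef ha u i := by
  have m1 := memLp_coef (gradz u) (e i)
  have m2 := memLp_coef (gradz (toH v)) (e i)
  have m3 := memLp_coef (fnOf u) (e i)
  have m4 := memLp_coef (fnOf (toH v)) (e i)
  have m5 := memLp_coef (lap v) (e i)
  have i1 : Integrable (fun z => inner ℝ (slice (gradz u) z) (e i)
    * inner ℝ (slice (gradz (toH v)) z) (e i)) halfLine := m1.integrable_mul m2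
  have i2 : Integrable (fun z => k i * (inner ℝ (slice (fnOf u) z) (e i)
    * inner ℝ (slice (fnOf (toH v)) z) (e i))) halfLine := (m3.integrable_mul m4).const_mul (k i)
  have i3 : Integrable (fun z => inner ℝ (slice (fnOf u) z) (e i)
    * inner ℝ (slice (lap v) z) (e i)) halfLine := m3.integrable_mul m5
  have i12 : Integrable (fun z => inner ℝ (slice (gradz u) z) (e i)
    * inner ℝ (slice (gradz (toH v)) z) (e i) + k i * (inner ℝ (slice (fnOf u) z) (e i)
    * inner ℝ (slice (fnOf (toH v)) z) (e i))) halfLine := i1.add i2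
  have heq : ∀ᵐ z ∂halfLine, inner ℝ (slice (gradz u) z) (e i)
        * inner ℝ (slice (gradz (toH v)) z) (e i)
        + k i * (inner ℝ (slice (fnOf u) z) (e i) * inner ℝ (slice (fnOf (toH v)) z) (e i))
        + inner ℝ (slice (fnOf u) z) (e i) * inner ℝ (slice (lap v) z) (e i)
      = (z ^ (-a / 2) * inner ℝ (slice (gradz u) z) (e i))
          * prim (hE.ncoef v i) (fun z => k i * inner ℝ (slice (fnOf (toH v)) z) (e i)
            + inner ℝ (slice (lap v) z) (e i)) z
        + prim (hE.dcoef ha u i) (fun z => z ^ (-a / 2) * inner ℝ (slice (gradz u) z) (e i)) z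
          * (k i * inner ℝ (slice (fnOf (toH v)) z) (e i)
            + inner ℝ (slice (lap v) z) (e i)) := by
    filter_upwards [hE.dcoef_spec ha u i, hE.ncoef_spec v i, ae_restrict_mem measurableSet_Ioi]
      with z h1 h2 hz
    rw [← h1, ← h2]
    have h3 : z ^ (-a / 2) * z ^ (a / 2) = 1 := by
      rw [← Real.rpow_add hz, neg_div, neg_add_cancel, Real.rpow_zero]
    linear_combination (-(inner ℝ (slice (gradz u) z) (e i)
        * inner ℝ (slice (gradz (toH v)) z) (e i))) * h3
  -- The product `u_i w_i` equals `z ^ (a/2)` times an integrable function and `a / 2 ≤ 1`, so there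
  -- is no contribution from infinity; `c_i d_i` is the only boundary term.
  have key := integral_prim_mul_prim (c := hE.dcoef ha u i) (d := hE.ncoef v i) (X := 1)
    (h := fun z => |inner ℝ (slice (fnOf u) z) (e i) * inner ℝ (slice (gradz (toH v)) z) (e i)|)
    (fun Z hZ => weight_mul_intervalIntegrable ha m1 hZ)
    (fun Z hZ => memLp_intervalIntegrable (memLp_source k e v i) hZ)
    ((i12.add i3).congr heq) (m3.integrable_mul m2).abs ?_
  · rw [← integral_const_mul, ← integral_add i1 i2, ← integral_add i12 i3, neg_mul,
      mul_comm (hE.ncoef v i), ← key]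
    exact integral_congr_ae heq
  · filter_upwards [hE.dcoef_spec ha u i, hE.ncoef_spec v i, ae_restrict_mem measurableSet_Ioi]
      with z h1 h2 hz hz1
    rw [← h1, ← h2, mul_left_comm, abs_mul, abs_of_nonneg (Real.rpow_nonneg (le_of_lt hz) _)]
    refine mul_le_mul_of_nonneg_right ?_ (abs_nonneg _)
    calc z ^ (a / 2) ≤ z ^ (1 : ℝ) := Real.rpow_le_rpow_of_exponent_le hz1 (by linarith)
      _ = z := Real.rpow_one z

/-- Green's formula in `ℝ₊ × Ω`. -/
theorem IsEigenbasis.green (hE : IsEigenbasis D e k) {a : ℝ} (ha : a < 1) (u : spaceH D a)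
    (v : spaceH2 D a) : ∃ B : ℝ, HasSum (fun i => -hE.ncoef v i * hE.dcoef ha u i) B ∧
      ∫ p, (gradz u p * gradz (toH v) p + ∑ j, gradx u j p * gradx (toH v) j p) ∂D.bulk
        = (∫ p, fnOf u p * (-lap v p) ∂D.bulk) + B := by
  have h := ((hE.hasSum_bulk (ae_meanFree_slice_gradz u) (gradz (toH v))).add
    (hE.hasSum_bulk_grad (ae_mem_graphV u) (ae_mem_graphV (toH v)))).add
    (hE.hasSum_bulk (ae_meanFree_slice u) (lap v))
  refine ⟨_, h.congr_fun fun i => (hE.coef_green ha u v i).symm, ?_⟩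
  rw [integral_add (integrable_bulk_mul _ _)
    (integrable_finsetSum _ fun j _ => integrable_bulk_mul _ _)]
  simp only [mul_neg, integral_neg]
  ring

/-- The weak limit of the flux at `z = 0`. -/
theorem IsEigenbasis.isNeumannTrace (hE : IsEigenbasis D e k) {a : ℝ} (v : spaceH2 D a) :
    IsNeumannTrace a e (gradz (toH v)) fun i => -hE.ncoef v i := by
  intro φ hφ
  obtain ⟨G, hG⟩ := (memV_iff φ).1 hφ
  have hmf := meanFree_of_mem_graphV hG
  set q : ℕ → ℝ → ℝ := fun i z => k i * inner ℝ (slice (fnOf (toH v)) z) (e i)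
    + inner ℝ (slice (lap v) z) (e i) with hq
  -- The weight `(k i)⁻¹` is what makes the squared `L²` norms of the sources summable; it is
  -- compensated by the weight `k i` on the coefficients of `φ`, finite because `φ ∈ V`.
  set Q : ℕ → ℝ := fun i => (k i)⁻¹ * ∫ z, q i z ^ 2 ∂halfLine with hQ
  have hQ0 : ∀ i, 0 ≤ Q i := fun i =>
    mul_nonneg (inv_nonneg.2 (hE.k_pos i).le) (integral_nonneg fun _ => sq_nonneg _)
  have sQ : Summable Q := by
    refine Summable.of_nonneg_of_le hQ0
      (fun i => hE.inv_k_mul_integral_source_sq_le v i one_pos) ?_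
    exact ((hE.summable_k_coef_sq (toH v)).mul_left _).add
      (((summable_integral_coef_sq hE.orthonormal (lap v)).mul_left _).mul_left _)
  have sφ : Summable fun i => k i * inner ℝ (e i) φ ^ 2 :=
    (hE.hasSum_inner_grad hG hG).summable.congr fun i => by rw [sq]
  set M : ℕ → ℝ := fun i => (Q i + k i * inner ℝ (e i) φ ^ 2) / 2 with hM
  have sM : Summable M := (sQ.add sφ).div_const 2
  have hgood : ∀ᵐ z ∂halfLine,
      HasSum (fun i => prim (hE.ncoef v i) (q i) z * inner ℝ (e i) φ)
        (∫ x, (z ^ (a / 2) * gradz (toH v) (z, x)) * φ x ∂D.meas) ∧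
      ∀ i, |(prim (hE.ncoef v i) (q i) z - hE.ncoef v i) * inner ℝ (e i) φ| ≤ √z * M i := by
    filter_upwards [inner_slice (gradz (toH v)), ae_all_iff.2 (hE.ncoef_spec v),
      ae_restrict_mem measurableSet_Ioi] with z h1 h2 hz
    constructor
    · have h3 := (hE.hasSum_inner hmf (slice (gradz (toH v)) z)).mul_left (z ^ (a / 2))
      rw [real_inner_comm, h1 φ, ← integral_const_mul] at h3
      simp only [← mul_assoc] at h3
      refine h3.congr_fun fun i => ?_
      rw [← h2 i, real_inner_comm (e i)]
      ring
    · intro i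
      -- The flux is a primitive of an `L²` function without weight, which is the case `a = 0` of
      -- the increment bound. With the arithmetic–geometric mean inequality it gives the majorant
      -- `√z M i`.
      have h4 := sq_prim_sub_le (a := 0) zero_lt_one (c := hE.ncoef v i)
        (memLp_source k e v i) (le_of_lt hz)
      simp only [neg_zero, zero_div, Real.rpow_zero, one_mul, sub_zero, Real.rpow_one,
        div_one] at h4
      have hk := hE.k_pos i
      have h5 : (prim (hE.ncoef v i) (q i) z - hE.ncoef v i) ^ 2 ≤ z * (k i * Q i) := by
        rw [hQ, mul_inv_cancel_left₀ hk.ne']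
        exact h4
      refine abs_le_of_sq_le_sq ?_ (mul_nonneg (Real.sqrt_nonneg _)
        (div_nonneg (add_nonneg (hQ0 i) (mul_nonneg hk.le (sq_nonneg _))) zero_le_two))
      rw [mul_pow, mul_pow, Real.sq_sqrt (le_of_lt hz)]
      calc _ ≤ z * (k i * Q i) * inner ℝ (e i) φ ^ 2 :=
            mul_le_mul_of_nonneg_right h5 (sq_nonneg _)
        _ = z * (Q i * (k i * inner ℝ (e i) φ ^ 2)) := by ring
        _ ≤ z * M i ^ 2 := by
            refine mul_le_mul_of_nonneg_left ?_ (le_of_lt hz)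
            simp only [hM]
            nlinarith [sq_nonneg (Q i - k i * inner ℝ (e i) φ ^ 2)]
  have hgood' := eventually_zeroAE hgood
  obtain ⟨z₀, hz₀, hz₀'⟩ := hgood'.exists
  -- At one good `z₀` the flux series and the series of increments both converge, hence so does the
  -- limiting series.
  have sd : Summable fun i => hE.ncoef v i * inner ℝ (e i) φ := by
    have h1 : Summable fun i => (prim (hE.ncoef v i) (q i) z₀ - hE.ncoef v i) * inner ℝ (e i) φ :=
      Summable.of_norm_bounded (sM.mul_left √z₀) hz₀'
    exact (hz₀.summable.sub h1).congr fun i => by ring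
  refine ⟨-∑' i, hE.ncoef v i * inner ℝ (e i) φ, ?_, ?_⟩
  · exact sd.hasSum.neg.congr_fun fun i => by rw [neg_mul]
  refine Tendsto.neg ?_
  rw [tendsto_iff_norm_sub_tendsto_zero]
  have hlim : Tendsto (fun z : ℝ => √z * ∑' i, M i) zeroAE (𝓝 0) := by
    have h1 := (tendsto_rpow_zeroAE (b := 1 / 2) (by norm_num)).mul_const (∑' i, M i)
    simpa only [zero_mul, ← Real.sqrt_eq_rpow] using h1
  refine squeeze_zero' (Eventually.of_forall fun z => norm_nonneg _) ?_ hlim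
  filter_upwards [hgood'] with z ⟨h1, h2⟩
  have h3 : HasSum (fun i => (prim (hE.ncoef v i) (q i) z - hE.ncoef v i) * inner ℝ (e i) φ) _ :=
    (h1.sub sd.hasSum).congr_fun fun i => by rw [sub_mul]
  rw [← h3.tsum_eq, ← tsum_mul_left]
  exact tsum_of_norm_bounded (sM.mul_left √z).hasSum h2

end Eigen

/-! ### Fluxes that are continuous up to `z = 0` -/

/-- A flux continuous on `Ω` may blow up at the lateral boundary, so dominated convergence is run on
a compact set: the support of the test in a bounded domain, the closed cell itself on the torus. -/
theorem IsLateralTest.exists_compact {φ : Plane → ℝ} (h : IsLateralTest D φ) :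
    ∃ K : Set Plane, IsCompact K ∧ K ⊆ D.carrier ∧ ∀ x ∈ D.carrier, x ∉ K → φ x = 0 := by
  cases D with
  | torus =>
    refine ⟨_, Metric.isCompact_of_isClosed_isBounded ?_ (carrier_isBounded torus), Subset.rfl,
      fun x hx hx' => absurd hx hx'⟩
    have : torus.carrier = ⋂ j, (fun x : Plane => x j) ⁻¹' Icc (0 : ℝ) (2 * Real.pi) := by
      ext
      simp [carrier]
    rw [this]
    exact isClosed_iInter fun j => isClosed_Icc.preimage (by fun_prop)
  | bounded Ω _ _ _ _ =>
    obtain ⟨K, hK, hKΩ, h0⟩ := h.2.1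
    exact ⟨K, hK, hKΩ, fun x _ hx => h0 () x hx⟩

theorem tendsto_integral_mul_of_continuousOn {F : ℝ × Plane → ℝ}
    (hF : ContinuousOn F (Ici 0 ×ˢ D.carrier)) {φ : Plane → ℝ} (hφ : IsLateralTest D φ) :
    Tendsto (fun z => ∫ x, F (z, x) * φ x ∂D.meas) (𝓝[≥] 0)
      (𝓝 (∫ x, F (0, x) * φ x ∂D.meas)) := by
  obtain ⟨K, hK, hKD, h0⟩ := hφ.exists_compact
  obtain ⟨M, hM⟩ := (isCompact_Icc.prod hK).exists_bound_of_continuousOn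
    (hF.mono (prod_mono (Icc_subset_Ici_self : Icc (0 : ℝ) 1 ⊆ Ici 0) hKD))
  have hev : ∀ᶠ z : ℝ in 𝓝[≥] 0, z ∈ Icc (0 : ℝ) 1 := Icc_mem_nhdsGE one_pos
  refine tendsto_integral_filter_of_dominated_convergence (fun x => M * ‖φ x‖) ?_ ?_ ?_ ?_
  · filter_upwards [hev] with z hz
    have h1 : ContinuousOn (fun x => F (z, x)) D.carrier :=
      hF.comp (by fun_prop) fun x hx => ⟨hz.1, hx⟩
    exact (h1.aestronglyMeasurable (carrier_measurableSet D)).mul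
      hφ.1.continuous.aestronglyMeasurable
  · filter_upwards [hev] with z hz
    filter_upwards [ae_mem_carrier D] with x hx
    rw [norm_mul]
    by_cases hxK : x ∈ K
    · exact mul_le_mul_of_nonneg_right (hM _ ⟨hz, hxK⟩) (norm_nonneg _)
    · simp [h0 x hx hxK]
  · exact (hφ.memLp_self.integrable (by norm_num)).norm.const_mul M
  · filter_upwards [ae_mem_carrier D] with x hx
    refine Tendsto.mul_const _ ?_
    have h1 : ContinuousWithinAt (fun z : ℝ => F (z, x)) (Ici 0) 0 :=
      ContinuousWithinAt.comp (f := fun z : ℝ => (z, x)) (hF (0, x) ⟨le_refl (0 : ℝ), hx⟩)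
        (by fun_prop) fun z hz => ⟨hz, hx⟩
    exact h1

theorem IsNeumannTrace.hasSum_of_continuousOn {a : ℝ} {e : ℕ → D.L2} {Gz : D.L2Bulk} {θ : ℕ → ℝ}
    (h : IsNeumannTrace a e Gz θ) {F : ℝ × Plane → ℝ} (hF : ContinuousOn F (Ici 0 ×ˢ D.carrier))
    (hGF : (fun p : ℝ × Plane => p.1 ^ (a / 2) * Gz p) =ᵐ[D.bulk] F) {φ : Plane → ℝ}
    (hφ : IsLateralTest D φ) :
    HasSum (fun i => θ i * ∫ x, e i x * φ x ∂D.meas) (-∫ x, F (0, x) * φ x ∂D.meas) := by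
  obtain ⟨L, hL, hlim⟩ := h (hφ.memLp_self.toLp φ) ((memV_iff _).2 ⟨_, testPair_mem hφ⟩)
  simp only [inner_toLp] at hL
  have h1 : Tendsto (fun z => -∫ x, F (z, x) * φ x ∂D.meas) zeroAE
      (𝓝 (-∫ x, F (0, x) * φ x ∂D.meas)) :=
    ((tendsto_integral_mul_of_continuousOn hF hφ).mono_left
      (inf_le_left.trans (nhdsWithin_mono _ Ioi_subset_Ici_self))).neg
  have h2 : L = -∫ x, F (0, x) * φ x ∂D.meas := by
    refine tendsto_nhds_unique hlim (h1.congr' ?_)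
    filter_upwards [eventually_zeroAE (ae_slice hGF)] with z hz
    congr 1
    refine integral_congr_ae ?_
    filter_upwards [hz, hφ.memLp_self.coeFn_toLp] with x hx hx'
    rw [hx', ← hx]
  rwa [← h2]

end

end QGTrace

/-! ### The two trace operators and Green's formula -/

theorem proposition4p9 (a : ℝ) (ha : a < 1) :
    -- the constants depend on `a` only
    ∃ C₀ C₁ : ℝ, 0 < C₀ ∧ 0 < C₁ ∧ (a ≤ 0 → C₀ = 1) ∧ (0 ≤ a → C₁ = 1) ∧
      ∀ (D : QGTrace.HorizontalDomain) (e : ℕ → D.L2) (k : ℕ → ℝ),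
        QGTrace.IsEigenbasis D e k →
        ∃ (γ₀ : QGTrace.spaceH D a →ₗ[ℝ] QGTrace.HDot k ((1 - a) / (2 - a)))
          (γl : QGTrace.spaceH2 D a →ₗ[ℝ] QGTrace.HDot k (-((1 - a) / (2 - a)))),
          -- `γ₀ u` is the trace of `u` at `z = 0`, and equals `u(0, ·)` for continuous `u`
          (∀ u : QGTrace.spaceH D a, ∃ g : D.L2,
            HasSum (fun i => (γ₀ u).1 i • e i) g ∧
            QGTrace.IsDirichletTrace (QGTrace.fnOf u) g ∧
            ∀ f : ℝ × QGTrace.Plane → ℝ, ContinuousOn f (Set.Ici 0 ×ˢ D.carrier) →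
              QGTrace.fnOf u =ᵐ[D.bulk] f → g =ᵐ[D.meas] fun x => f (0, x)) ∧
          -- `γ₀` is bounded
          (∀ u : QGTrace.spaceH D a, QGTrace.hdotNorm (γ₀ u) ≤ C₀ * QGTrace.gradNorm u) ∧
          -- `γl v` is the weighted Neumann trace of `v` at `z = 0`, and equals
          -- `- (λ ∂_z v)(0, ·)` when `λ ∂_z v` is continuous
          (∀ v : QGTrace.spaceH2 D a,
            QGTrace.IsNeumannTrace a e (QGTrace.gradz (QGTrace.toH v)) (γl v).1 ∧
            ∀ F : ℝ × QGTrace.Plane → ℝ, ContinuousOn F (Set.Ici 0 ×ˢ D.carrier) →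
              (fun p : ℝ × QGTrace.Plane => p.1 ^ (a / 2) * QGTrace.gradz (QGTrace.toH v) p) =ᵐ[D.bulk] F →
              ∀ φ : QGTrace.Plane → ℝ, QGTrace.IsLateralTest D φ →
                HasSum (fun i => (γl v).1 i * ∫ x, e i x * φ x ∂D.meas)
                  (- ∫ x, F (0, x) * φ x ∂D.meas)) ∧
          -- `γl` is bounded
          (∀ v : QGTrace.spaceH2 D a,
            QGTrace.hdotNorm (γl v) ≤ C₁ * (QGTrace.gradNorm (QGTrace.toH v) + QGTrace.poincareConst D * ‖QGTrace.lap v‖)) ∧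
          -- integration by parts
          (∀ (u : QGTrace.spaceH D a) (v : QGTrace.spaceH2 D a),
            ∃ B : ℝ, HasSum (fun i => (γl v).1 i * (γ₀ u).1 i) B ∧
              ∫ p, (QGTrace.gradz u p * QGTrace.gradz (QGTrace.toH v) p + ∑ j, QGTrace.gradx u j p * QGTrace.gradx (QGTrace.toH v) j p) ∂D.bulk
                = (∫ p, QGTrace.fnOf u p * (-QGTrace.lap v p) ∂D.bulk) + B) := by
  obtain ⟨C, hC0, hC1, hC⟩ := QGTrace.exists_dirichlet_trace_le ha
  obtain ⟨C', hC0', hC1', hC'⟩ := QGTrace.exists_neumann_trace_le ha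
  -- The one-dimensional inequalities bound squares, so the operator constants are square roots; a
  -- constant equal to `1` remains `1`.
  refine ⟨√C, √C', Real.sqrt_pos.2 hC0, Real.sqrt_pos.2 hC0',
    fun h => by rw [hC1 h, Real.sqrt_one], fun h => by rw [hC1' h, Real.sqrt_one],
    fun D e k hE => ?_⟩
  have hN : ∀ v : QGTrace.spaceH2 D a, Summable fun i =>
      k i ^ (-((1 - a) / (2 - a))) * (-hE.ncoef v i) ^ 2 := fun v => by
    simpa only [neg_sq] using (hE.ncoef_bound hC0' hC' v).1
  refine ⟨
    { toFun := fun u => ⟨hE.dcoef ha u, (hE.dcoef_bound ha hC0 hC u).1⟩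
      map_add' := fun u w => Subtype.ext (funext fun i => hE.dcoef_add ha u w i)
      map_smul' := fun c u => Subtype.ext (funext fun i => hE.dcoef_smul ha c u i) },
    { toFun := fun v => ⟨fun i => -hE.ncoef v i, hN v⟩
      map_add' := fun v w => Subtype.ext (funext fun i => ?_)
      map_smul' := fun c v => Subtype.ext (funext fun i => ?_) },
    fun u => ?_, fun u => (hE.dcoef_bound ha hC0 hC u).2, fun v => ?_, fun v => ?_,
    fun u v => hE.green ha u v⟩
  · change -hE.ncoef (v + w) i = -hE.ncoef v i + -hE.ncoef w i
    rw [hE.ncoef_add, neg_add]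
  · change -hE.ncoef (c • v) i = c * -hE.ncoef v i
    rw [hE.ncoef_smul, mul_neg]
  · obtain ⟨g, hg, hug⟩ := hE.exists_dirichlet_trace ha u
    exact ⟨g, hg, hug, fun f hf huf => hug.ae_eq_of_continuousOn hf huf⟩
  · exact ⟨hE.isNeumannTrace v, fun F hF hGF φ hφ =>
      (hE.isNeumannTrace v).hasSum_of_continuousOn hF hGF hφ⟩
  · have h := (hE.ncoef_bound hC0' hC' v).2
    simp only [← neg_sq (hE.ncoef v _)] at h
    exact h
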